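/- Let $n,m\ge 2$; write $x=(x_1,{}'x)\in\mathbb R^n$ with ${}'x=(x_2,\dots,x_n)$, and $y=(y',y_m)\in\mathbb R^m$ with $y'=(y_1,\dots,y_{m-1})$. Let $\alpha_1,M,\nu>0$. Then there is a constant $\delta_*=\delta_*(\alpha_1,M,n,m,\nu)>0$ with the following property. Let $0<\varepsilon_0<\frac{\alpha_1}{4m}$, $$0<\gamma<\min\Bigl\{\tfrac12,\ \tfrac43\bigl(M(Mm^2\varepsilon_0^{-1}+m^2+m(m+1))\bigr)^{-1/2}\Bigr\},$$ $\alpha_0>0$ with $\gamma+\alpha_0<1$, and $\delta>\delta_*$. Put $\eta_0=\frac12\min\{\alpha_0,\gamma\}$, $s=x_1+\eta_0$, $\beta_0=n+2+Mm\bigl((1+3\sqrt{2\gamma})m+1\bigr)$. Then there is $\lambda_*>0$, depending on $\delta$ and on the fixed parameters $n,m,\alpha_1,M,\nu,\varepsilon_0,\gamma,\alpha_0$ only, such that the following holds. Let ${}'x^0=(x^0_2,\dots,x^0_n)\in\mathbb R^{n-1}$, $y'^0=(y^0_1,\dots,y^0_{m-1})\in\mathbb R^{m-1}$, and $$\psi=\delta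 x_1+\tfrac12\sum_{i=2}^n(x_i-x_i^0)^2+\tfrac12\sum_{j=1}^{m-1}(y_j-y_j^0)^2+\tfrac12y_m^2+\alpha_0,\qquad \chi=\exp(\lambda\psi^{-\nu}),$$ $$\Omega_\gamma=\{(x,y):\ x_1>0,\ 0<\psi-\alpha_0<\gamma\}.$$ Let $D\subset\mathbb R^n$ and $G'\subset\mathbb R^{m-1}$ be open and let $a_{ij}=a_{ij}(x,y')\in C^2(\overline{D\times G'})$, $1\le i,j\le m$, satisfy $\|a_{ij}\|_{C^2}\le M$ (the largest of the suprema of the absolute values of the partial derivatives of order at most two) and $$-\sum_{i,j=1}^m\frac{\partial a_{ij}}{\partial x_1}\xi^i\xi^j\ge\alpha_1|\xi|^2\qquad\text{for all }\xi\in\mathbb R^m\text{ and }(x,y')\in D\times G'.$$ Let $\tilde a_{ij}(x,y)=a_{ij}\bigl(\tfrac12(x_1+\eta_0)^2,{}'x,y'\bigr)$, assume that $\bigl(\tfrac12(x_1+\eta_0)^2,{}'x,y'\bigr)\in D\times G'$ for all $(x,y)\in\Omega_\gamma$, and put $$L_0\varphi=s^{-1}\varphi_{x_1x_1}+s\Bigl(\sum_{i=2}^n\varphi_{x_ix_i}-\sum_{i,j=1}^m\tilde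 a_{ij}\varphi_{y_iy_j}\Bigr).$$ Then for all $\varphi\in C^2(\overline{\Omega_\gamma})$ and all $\lambda>\lambda_*$, at every point of $\Omega_\gamma$, $$\psi^{\nu+1}(L_0\varphi)^2\chi^2-2\lambda\nu\beta_0\,\varphi\,s\,(L_0\varphi)\chi^2\ \ge\ 2\lambda\nu\delta s^{-3}\varphi_{x_1}^2\chi^2+2\lambda\nu s^2|\nabla_{'x}\varphi|^2\chi^2+2\lambda\nu s|\nabla_y\varphi|^2\chi^2+\lambda^3\nu^4\delta^4\psi^{-2\nu-3}\varphi^2\chi^2+D(\varphi).$$ Here $D(\varphi)=D_1(\chi\varphi)+D_2(\chi\varphi)+2\lambda\nu\beta_0D_3(\varphi)$ is the following divergence. Let $A_{ij}=\frac12(\tilde a_{ij}+\tilde a_{ji})$, and write $(\cdot)_{x_1}$, $(\cdot)_{x_r}$, $(\cdot)_{y_k}$ for partial derivatives; sums over $r,i'$ run over $2,\dots,n$, sums over $i,j,k$ over $1,\dots,m$. For functions $\vartheta,\omega$ put $$\langle\vartheta,\omega\rangle=\sum_{i,j}A_{ij}\vartheta_{y_i}\omega_{y_j},\quad (\vartheta,\omega)'=\sum_{i'}\vartheta_{x_{i'}}\omega_{x_{i'}},\quad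 (A\vartheta)_k=\sum_iA_{ik}\vartheta_{y_i},$$ $$\phi_1=\lambda^2\nu^2\psi^{-2\nu-2}-\lambda\nu(\nu+1)\psi^{-\nu-2},$$ $$\phi_2=\lambda^2\nu^2\psi^{-2\nu-2}(\psi,\psi)'-\lambda\nu\bigl((\nu+1)\psi^{-\nu-2}(\psi,\psi)'-(n-1)\psi^{-\nu-1}\bigr),$$ $$\phi_3=\lambda^2\nu^2\psi^{-2\nu-2}\langle\psi,\psi\rangle-\lambda\nu\Bigl((\nu+1)\psi^{-\nu-2}\langle\psi,\psi\rangle-\psi^{-\nu-1}\sum_iA_{ii}\Bigr),$$ $$\Phi=\delta^2\phi_1+s^2(\phi_2-\phi_3).$$ Then $$\begin{aligned}D_1(\vartheta)=2\lambda\nu\Bigl\{&\Bigl[\delta s^{-2}\vartheta_{x_1}^2-\delta(\vartheta,\vartheta)'+\delta\langle\vartheta,\vartheta\rangle+\delta^3s^{-2}\phi_1\vartheta^2+\delta(\phi_2-\phi_3)\vartheta^2+2(\psi,\vartheta)'\vartheta_{x_1}-2\langle\psi,\vartheta\rangle\vartheta_{x_1}\Bigr]_{x_1}\\ +\sum_r&\Bigl[2\delta\vartheta_{x_1}\vartheta_{x_r}-\psi_{x_r}\vartheta_{x_1}^2+2s^2(\psi,\vartheta)'\vartheta_{x_r}-s^2\psi_{x_r}(\vartheta,\vartheta)'+s^2\psi_{x_r}\langle\vartheta,\vartheta\rangle+\psi_{x_r}\Phi\vartheta^2-2s^2\langle\psi,\vartheta\rangle\vartheta_{x_r}\Bigr]_{x_r}\\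 +\sum_k&\Bigl[-2\delta(A\vartheta)_k\vartheta_{x_1}-2s^2(\psi,\vartheta)'(A\vartheta)_k+(A\psi)_k\vartheta_{x_1}^2+s^2(A\psi)_k(\vartheta,\vartheta)'+2s^2\langle\psi,\vartheta\rangle(A\vartheta)_k-s^2(A\psi)_k\langle\vartheta,\vartheta\rangle-(A\psi)_k\Phi\vartheta^2\Bigr]_{y_k}\Bigr\},\end{aligned}$$ $$D_2(\vartheta)=-2\lambda^2\nu^2\delta^2\bigl[s^{-3}\psi^{-\nu-1}\vartheta^2\bigr]_{x_1}+2\lambda^2\nu^2(\beta_0-1)\sum_r\bigl[s^2\psi_{x_r}\psi^{-\nu-1}\vartheta^2\bigr]_{x_r}-\lambda^2\nu^2\delta\alpha_1\sum_k\bigl[s\,\psi_{y_k}\psi^{-\nu-1}\vartheta^2\bigr]_{y_k},$$ $$\begin{aligned}D_3(\varphi)=&-\bigl[(\varphi\varphi_{x_1}+\lambda\nu\delta\psi^{-\nu-1}\varphi^2)\chi^2\bigr]_{x_1}-\sum_r\bigl[(\varphi\varphi_{x_r}+\lambda\nu\psi_{x_r}\psi^{-\nu-1}\varphi^2)\chi^2s^2\bigr]_{x_r}\\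 &+\sum_k\Bigl[\sum_j\Bigl(A_{kj}(\varphi_{y_j}\varphi+\lambda\nu\psi_{y_j}\psi^{-\nu-1}\varphi^2)-\tfrac12(A_{kj})_{y_j}\varphi^2\Bigr)\chi^2s^2\Bigr]_{y_k}.\end{aligned}$$ -/

import Mathlib

namespace UltraCarleman

open Finset

/-! ### Points, partial derivatives, `C²` up to the boundary -/

/-- Points `(x, y)` with `x ∈ ℝⁿ`, `y ∈ ℝᵐ`. -/
abbrev Pt (n m : ℕ) : Type := (Fin n → ℝ) × (Fin m → ℝ)

/-- The partial derivative `∂f/∂x_i`. -/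
noncomputable def dx {n m : ℕ} (i : Fin n) (f : Pt n m → ℝ) (z : Pt n m) : ℝ :=
  fderiv ℝ f z (Pi.single i 1, 0)

/-- The partial derivative `∂f/∂y_j`. -/
noncomputable def dy {n m : ℕ} (j : Fin m) (f : Pt n m → ℝ) (z : Pt n m) : ℝ :=
  fderiv ℝ f z (0, Pi.single j 1)

/-- The divergence of the vector field with `x`-components `F` and `y`-components `G`. -/
noncomputable def divergence {n m : ℕ} (F : Fin n → Pt n m → ℝ) (G : Fin m → Pt n m → ℝ)
    (z : Pt n m) : ℝ :=
  ∑ i, dx i (F i) z + ∑ j, dy j (G j) z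

/-- `f ∈ C²(closure U)` for an open set `U`: `f` is of class `C²` in `U` and its derivatives of
order at most two extend continuously to the closure of `U`. -/
def IsC2Closure {n m : ℕ} (U : Set (Pt n m)) (f : Pt n m → ℝ) : Prop :=
  ContDiffOn ℝ 2 f U ∧
    ∀ k : ℕ, k ≤ 2 → ∃ g : Pt n m → ContinuousMultilinearMap ℝ (fun _ : Fin k => Pt n m) ℝ,
      ContinuousOn g (closure U) ∧ Set.EqOn g (iteratedFDeriv ℝ k f) U

/-- `‖f‖_{C²(closure U)} ≤ M`, the norm being the largest of the suprema of the absolute values of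
the partial derivatives of order at most two (suprema over `U` and over its closure agree). -/
def C2NormLE {n m : ℕ} (U : Set (Pt n m)) (f : Pt n m → ℝ) (M : ℝ) : Prop :=
  ∀ z ∈ U, |f z| ≤ M ∧ (∀ i, |dx i f z| ≤ M) ∧ (∀ j, |dy j f z| ≤ M) ∧
    (∀ i i', |dx i (dx i' f) z| ≤ M) ∧ (∀ i j, |dx i (dy j f) z| ≤ M) ∧
    (∀ j j', |dy j (dy j' f) z| ≤ M)

/-! ### Domain and weight

Throughout `n = p + 1` and `m = q + 1`.  The coordinate `x₁` is `x 0`, the coordinates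
`x₂, …, xₙ` are `x i.succ` with `i : Fin p`, the coordinates `y₁, …, y_{m-1}` are `y j.castSucc`
with `j : Fin q` (so that `y' = Fin.init y`), and `y_m` is `y (Fin.last q)`. -/

/-- The parameters of the domain and of the weight.  The centre is `x⁰ = (0, x₀)`,
`y⁰ = (y₀, 0)`. -/
structure Params (p q : ℕ) where
  γ : ℝ
  α₀ : ℝ
  δ : ℝ
  ν : ℝ
  x₀ : Fin p → ℝ
  y₀ : Fin q → ℝ

variable {p q : ℕ}

/-- `δ x₁ + ½ ∑_{i ≥ 2} (x_i - x_i⁰)² + ½ ∑_{j ≤ m-1} (y_j - y_j⁰)² + ½ y_m²`. -/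
noncomputable def Params.psi₀ (P : Params p q) (z : Pt (p + 1) (q + 1)) : ℝ :=
  P.δ * z.1 0 + 1 / 2 * ∑ i : Fin p, (z.1 i.succ - P.x₀ i) ^ 2
    + 1 / 2 * ∑ j : Fin q, (z.2 j.castSucc - P.y₀ j) ^ 2 + 1 / 2 * z.2 (Fin.last q) ^ 2

/-- The domain `Ω_γ`. -/
def Params.omega (P : Params p q) : Set (Pt (p + 1) (q + 1)) :=
  {z | 0 < z.1 0 ∧ 0 < P.psi₀ z ∧ P.psi₀ z < P.γ}

/-- The function `ψ`. -/
noncomputable def Params.psi (P : Params p q) (z : Pt (p + 1) (q + 1)) : ℝ :=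
  P.psi₀ z + P.α₀

/-- The weight `χ = exp (λ ψ^{-ν})`. -/
noncomputable def Params.chi (P : Params p q) (lam : ℝ) (z : Pt (p + 1) (q + 1)) : ℝ :=
  Real.exp (lam * P.psi z ^ (-P.ν))

/-- `η₀`, defined by `2 η₀ = min {α₀, γ}`. -/
noncomputable def Params.eta₀ (P : Params p q) : ℝ := min P.α₀ P.γ / 2

/-- `x₁ + η₀`. -/
noncomputable def Params.s (P : Params p q) (z : Pt (p + 1) (q + 1)) : ℝ := z.1 0 + P.eta₀

/-! ### The operator -/

/-- The map `(x, y) ↦ ((½ (x₁ + η₀)², x₂, …, xₙ), y')`, from the variables in which `Ω_γ` and `L₀`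
are written to the original ones, on which the coefficients `a_ij` depend. -/
noncomputable def Params.orig (P : Params p q) (z : Pt (p + 1) (q + 1)) : Pt (p + 1) q :=
  (Function.update z.1 0 (1 / 2 * P.s z ^ 2), Fin.init z.2)

/-- The coefficients in the new variables,
`ã_ij (x, y) = a_ij (½ (x₁ + η₀)², x₂, …, xₙ, y')`. -/
noncomputable def Params.tilde (P : Params p q)
    (a : Fin (q + 1) → Fin (q + 1) → Pt (p + 1) q → ℝ)
    (i j : Fin (q + 1)) (z : Pt (p + 1) (q + 1)) : ℝ :=
  a i j (P.orig z)

/-- `L₀ φ = (x₁+η₀)⁻¹ φ_{x₁x₁} + (x₁+η₀) (∑_{i ≥ 2} φ_{x_i x_i} - ∑_{i,j} A_ij φ_{y_i y_j})`. -/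
noncomputable def Params.L₀ (P : Params p q)
    (A : Fin (q + 1) → Fin (q + 1) → Pt (p + 1) (q + 1) → ℝ)
    (φ : Pt (p + 1) (q + 1) → ℝ) (z : Pt (p + 1) (q + 1)) : ℝ :=
  (P.s z)⁻¹ * dx 0 (dx 0 φ) z
    + P.s z * (∑ i : Fin p, dx i.succ (dx i.succ φ) z
        - ∑ i, ∑ j, A i j z * dy i (dy j φ) z)

/-- `β₀ = n + 2 + M m ((1 + 3 √(2γ)) m + 1)`. -/
noncomputable def beta₀ (n m : ℕ) (M γ : ℝ) : ℝ :=
  n + 2 + M * m * ((1 + 3 * √(2 * γ)) * m + 1)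

/-! ### The divergence term -/

/-- The symmetric part `½ (A_ij + A_ji)`; it equals `A` when `A` is symmetric. -/
noncomputable def symPart (A : Fin (q + 1) → Fin (q + 1) → Pt (p + 1) (q + 1) → ℝ)
    (i j : Fin (q + 1)) (z : Pt (p + 1) (q + 1)) : ℝ :=
  (A i j z + A j i z) / 2

section Flux

variable (P : Params p q) (A : Fin (q + 1) → Fin (q + 1) → Pt (p + 1) (q + 1) → ℝ) (lam : ℝ)

/-- `φ₁ = λ²ν²ψ^{-2ν-2} - λν(ν+1)ψ^{-ν-2}`. -/
noncomputable def phi₁ (z : Pt (p + 1) (q + 1)) : ℝ :=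
  lam ^ 2 * P.ν ^ 2 * P.psi z ^ (-2 * P.ν - 2)
    - lam * P.ν * (P.ν + 1) * P.psi z ^ (-P.ν - 2)

/-- `φ₂`, the coefficient of `ϑ` in `χ Δ_{'x} (χ⁻¹ ϑ)`. -/
noncomputable def phi₂ (z : Pt (p + 1) (q + 1)) : ℝ :=
  lam ^ 2 * P.ν ^ 2 * (P.psi z ^ (-2 * P.ν - 2) * ∑ i : Fin p, dx i.succ P.psi z ^ 2)
    - lam * P.ν * ((P.ν + 1) * P.psi z ^ (-P.ν - 2) * (∑ i : Fin p, dx i.succ P.psi z ^ 2)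
        - p * P.psi z ^ (-P.ν - 1))

/-- `φ₃`, the coefficient of `ϑ` in `χ ∑ A_ij ∂_{y_i} ∂_{y_j} (χ⁻¹ ϑ)`. -/
noncomputable def phi₃ (z : Pt (p + 1) (q + 1)) : ℝ :=
  lam ^ 2 * P.ν ^ 2 * (P.psi z ^ (-2 * P.ν - 2)
      * ∑ i, ∑ j, A i j z * dy i P.psi z * dy j P.psi z)
    - lam * P.ν * ((P.ν + 1) * P.psi z ^ (-P.ν - 2)
          * (∑ i, ∑ j, A i j z * dy i P.psi z * dy j P.psi z)
        - P.psi z ^ (-P.ν - 1) * ∑ i, A i i z)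

/-- `Φ = δ² φ₁ + (x₁+η₀)² (φ₂ - φ₃)`. -/
noncomputable def bigPhi (z : Pt (p + 1) (q + 1)) : ℝ :=
  P.δ ^ 2 * phi₁ P lam z + P.s z ^ 2 * (phi₂ P lam z - phi₃ P A lam z)

/-- The `x`-components of the vector field whose divergence is `D₁(ϑ)`. -/
noncomputable def flux₁x (θ : Pt (p + 1) (q + 1) → ℝ) :
    Fin (p + 1) → Pt (p + 1) (q + 1) → ℝ :=
  Fin.cons
    (fun z =>
      2 * lam * P.ν * P.δ * (P.s z ^ 2)⁻¹ * dx 0 θ z ^ 2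
      - 2 * lam * P.ν * P.δ * ∑ i : Fin p, dx i.succ θ z ^ 2
      + 2 * lam * P.ν * P.δ * ∑ i, ∑ j, A i j z * dy i θ z * dy j θ z
      + 2 * lam * P.ν * P.δ ^ 3 * (P.s z ^ 2)⁻¹ * phi₁ P lam z * θ z ^ 2
      + 2 * lam * P.ν * P.δ * phi₂ P lam z * θ z ^ 2
      - 2 * lam * P.ν * P.δ * phi₃ P A lam z * θ z ^ 2
      + 4 * lam * P.ν * (∑ i : Fin p, dx i.succ P.psi z * dx i.succ θ z) * dx 0 θ z
      - 4 * lam * P.ν * (∑ i, ∑ j, A i j z * dy i P.psi z * dy j θ z) * dx 0 θ z)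
    (fun r z =>
      4 * lam * P.ν * P.δ * dx 0 θ z * dx r.succ θ z
      - 2 * lam * P.ν * dx r.succ P.psi z * dx 0 θ z ^ 2
      + 4 * lam * P.ν * P.s z ^ 2 * (∑ i : Fin p, dx i.succ P.psi z * dx i.succ θ z)
          * dx r.succ θ z
      - 2 * lam * P.ν * P.s z ^ 2 * dx r.succ P.psi z * ∑ i : Fin p, dx i.succ θ z ^ 2
      + 2 * lam * P.ν * P.s z ^ 2 * dx r.succ P.psi z
          * ∑ i, ∑ j, A i j z * dy i θ z * dy j θ z
      + 2 * lam * P.ν * dx r.succ P.psi z * bigPhi P A lam z * θ z ^ 2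
      - 4 * lam * P.ν * P.s z ^ 2 * (∑ i, ∑ j, A i j z * dy i P.psi z * dy j θ z)
          * dx r.succ θ z)

/-- The `y`-components of the vector field whose divergence is `D₁(ϑ)`. -/
noncomputable def flux₁y (θ : Pt (p + 1) (q + 1) → ℝ) (k : Fin (q + 1))
    (z : Pt (p + 1) (q + 1)) : ℝ :=
  -4 * lam * P.ν * P.δ * (∑ i, A i k z * dy i θ z) * dx 0 θ z
  - 4 * lam * P.ν * P.s z ^ 2 * (∑ i : Fin p, dx i.succ P.psi z * dx i.succ θ z)
      * ∑ i, A i k z * dy i θ z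
  + 2 * lam * P.ν * (∑ i, A i k z * dy i P.psi z) * dx 0 θ z ^ 2
  + 2 * lam * P.ν * P.s z ^ 2 * (∑ i, A i k z * dy i P.psi z)
      * ∑ i : Fin p, dx i.succ θ z ^ 2
  + 4 * lam * P.ν * P.s z ^ 2 * (∑ i, ∑ j, A i j z * dy i P.psi z * dy j θ z)
      * ∑ i, A i k z * dy i θ z
  - 2 * lam * P.ν * P.s z ^ 2 * (∑ i, A i k z * dy i P.psi z)
      * ∑ i, ∑ j, A i j z * dy i θ z * dy j θ z
  - 2 * lam * P.ν * (∑ i, A i k z * dy i P.psi z) * bigPhi P A lam z * θ z ^ 2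

/-- `D₁(ϑ)`. -/
noncomputable def D₁ (θ : Pt (p + 1) (q + 1) → ℝ) (z : Pt (p + 1) (q + 1)) : ℝ :=
  divergence (flux₁x P A lam θ) (flux₁y P A lam θ) z

/-- `D₂(ϑ)`, with `ϑ = χ φ`. -/
noncomputable def D₂ (α₁ β : ℝ) (θ : Pt (p + 1) (q + 1) → ℝ) (z : Pt (p + 1) (q + 1)) : ℝ :=
  divergence
    (Fin.cons
      (fun w => -2 * lam ^ 2 * P.ν ^ 2 * P.δ ^ 2
        * ((P.s w ^ 3)⁻¹ * P.psi w ^ (-P.ν - 1) * θ w ^ 2))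
      (fun (r : Fin p) w => 2 * lam ^ 2 * P.ν ^ 2 * P.s w ^ 2 * (β - 1)
        * (dx r.succ P.psi w * P.psi w ^ (-P.ν - 1) * θ w ^ 2)))
    (fun k w => -lam ^ 2 * P.ν ^ 2 * P.δ * α₁
        * (P.s w * dy k P.psi w * P.psi w ^ (-P.ν - 1) * θ w ^ 2))
    z

/-- `D₃(φ)`. -/
noncomputable def D₃ (φ : Pt (p + 1) (q + 1) → ℝ) (z : Pt (p + 1) (q + 1)) : ℝ :=
  divergence
    (Fin.cons
      (fun w => -((φ w * dx 0 φ w + lam * P.ν * P.δ * P.psi w ^ (-P.ν - 1) * φ w ^ 2)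
        * P.chi lam w ^ 2))
      (fun (r : Fin p) w => -((φ w * dx r.succ φ w
          + lam * P.ν * dx r.succ P.psi w * P.psi w ^ (-P.ν - 1) * φ w ^ 2)
        * P.chi lam w ^ 2 * P.s w ^ 2)))
    (fun k w => (∑ j, (A k j w * (dy j φ w * φ w
          + lam * P.ν * dy j P.psi w * P.psi w ^ (-P.ν - 1) * φ w ^ 2)
          - 1 / 2 * dy j (A k j) w * φ w ^ 2))
        * P.chi lam w ^ 2 * P.s w ^ 2)
    z

/-- The divergence term `D(φ) = D₁(χφ) + D₂(χφ) + 2λνβ₀ D₃(φ)`, in which only the symmetric part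
of the coefficients enters. -/
noncomputable def divTerm (α₁ β : ℝ) (φ : Pt (p + 1) (q + 1) → ℝ) (z : Pt (p + 1) (q + 1)) : ℝ :=
  D₁ P (symPart A) lam (fun w => P.chi lam w * φ w) z
    + D₂ P lam α₁ β (fun w => P.chi lam w * φ w) z
    + 2 * lam * P.ν * β * D₃ P (symPart A) lam φ z

end Flux

end UltraCarleman

open UltraCarleman

/-! The estimate is a pointwise energy identity followed by three algebraic inequalities. Let `C =
diag(1, s², -s²A)` be the principal part of `s L₀`, with `A` the symmetrised coefficients; put `w =
λνψ^{-ν-1}` and `θ = χφ`. Since `∇χ = -wχ∇ψ`, conjugation gives `χ s L₀φ = Z + 2wN` with `N =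
C(∇ψ,∇θ)` and `Z = C:∇²θ + Φθ` (`Z_chi_mul`). After squaring, the factor `ψ^{ν+1} = λν/w` turns the
cross term into `4λν s⁻² N Z`, while the squares of `Z` and `N` are nonnegative and dropped. A
Rellich-type identity writes the cross term as `D₁(θ)` plus `2λν` times a quadratic form in `∇θ`
(`gradForm`) and a potential times `θ²` (`potForm`); this is `D₁_eq`.

As `C` is indefinite, positivity has a different source in each group of variables. In `x₁` it comes
from differentiating the weight `s⁻²`, which yields `2δs⁻³θ_{x₁}²`. In `y` it comes from `-δ
∂A/∂x₁`, bounded below by `δα₁s`. In `'x` the energy identity gives nothing positive. The term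
`-2λνβ₀ φ s L₀φ χ²` is there for that reason: by `D₃_eq` it equals `2λνβ₀ D₃` plus `2λνβ₀
C(∇φ,∇φ)χ²` plus a multiple of `θ²`. Its `'x` part is positive and `β₀` is large enough to win; its
negative `y` part is absorbed by `δα₁` for large `δ`. Passing between `∇θ` and `χ∇φ` creates cross
terms `wθ ∇ψ·∇θ`, and `D₂` is the divergence that removes them (`D₂_eq`). `carleman_of_nonneg` adds
these identities up.

Three inequalities remain. In the gradient inequality (`gradForm_scalar`) every error is of lower
order in `δ` except one, `2δθ_{x₁}` times a first-order expression in `∂_yA` and `θ_y`. For that one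
`s` must be small, and this is the purpose of the upper bound on `γ`. The inequality in `∇_yφ` only
needs `δ` large. The coefficient of `θ²` is a quadratic polynomial in `w`: its leading coefficient
is at least `1` for large `δ`, because it contains `2(ν+1)s⁻²C(∇ψ,∇ψ)²/ψ`, of order `δ⁴`
(`potForm_scalar`); the other two are bounded uniformly in `λ`, so large `λ` suffices
(`potTotal_nonneg`). -/

namespace UltraCarleman

/-! ### Differentiation rules along a family of directions -/

section Calculus

variable {E : Type*} [NormedAddCommGroup E] [NormedSpace ℝ E] {ι : Type*}

/-- `f` is differentiable at `z`, and its derivative in the direction `e K` is `f' K`. -/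
structure HasPD (e : ι → E) (f : E → ℝ) (f' : ι → ℝ) (z : E) : Prop where
  diff : DifferentiableAt ℝ f z
  eq : ∀ K, fderiv ℝ f z (e K) = f' K

variable {e : ι → E} {f g : E → ℝ} {f' g' : ι → ℝ} {z : E}

theorem HasPD.of_diff (e : ι → E) (hf : DifferentiableAt ℝ f z) :
    HasPD e f (fun K => fderiv ℝ f z (e K)) z := ⟨hf, fun _ => rfl⟩

theorem HasPD.congr_val (hf : HasPD e f f' z) (h : ∀ K, f' K = g' K) : HasPD e f g' z :=
  ⟨hf.diff, fun K => (hf.eq K).trans (h K)⟩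

theorem HasPD.congr_of_eventuallyEq (hf : HasPD e f f' z) (h : g =ᶠ[nhds z] f) :
    HasPD e g f' z :=
  ⟨hf.diff.congr_of_eventuallyEq h, fun K => by rw [h.fderiv_eq, hf.eq]⟩

theorem HasPD.const (c : ℝ) : HasPD e (fun _ => c) (fun _ => 0) z :=
  ⟨differentiableAt_const c, fun K => by simp⟩

theorem HasPD.add (hf : HasPD e f f' z) (hg : HasPD e g g' z) :
    HasPD e (fun w => f w + g w) (fun K => f' K + g' K) z :=
  ⟨hf.diff.add hg.diff, fun K => by
    rw [fderiv_fun_add hf.diff hg.diff]; simp [hf.eq, hg.eq]⟩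

theorem HasPD.neg (hf : HasPD e f f' z) : HasPD e (fun w => -f w) (fun K => -f' K) z :=
  ⟨hf.diff.neg, fun K => by rw [fderiv_fun_neg]; simp [hf.eq]⟩

theorem HasPD.sub (hf : HasPD e f f' z) (hg : HasPD e g g' z) :
    HasPD e (fun w => f w - g w) (fun K => f' K - g' K) z :=
  ⟨hf.diff.sub hg.diff, fun K => by
    rw [fderiv_fun_sub hf.diff hg.diff]; simp [hf.eq, hg.eq]⟩

theorem HasPD.mul (hf : HasPD e f f' z) (hg : HasPD e g g' z) :
    HasPD e (fun w => f w * g w) (fun K => f' K * g z + f z * g' K) z :=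
  ⟨hf.diff.mul hg.diff, fun K => by
    rw [fderiv_fun_mul hf.diff hg.diff]; simp [hf.eq, hg.eq]; ring⟩

theorem HasPD.comp (hf : HasPD e f f' z) {u : ℝ → ℝ} {u' : ℝ} (hu : HasDerivAt u u' (f z)) :
    HasPD e (fun w => u (f w)) (fun K => u' * f' K) z := by
  have h := hu.comp_hasFDerivAt z hf.diff.hasFDerivAt
  exact ⟨h.differentiableAt, fun K => by
    rw [show (fun w => u (f w)) = u ∘ f from rfl, h.fderiv]; simp [hf.eq]⟩

theorem HasPD.sum {κ : Type*} [Fintype κ] {F : κ → E → ℝ} {F' : κ → ι → ℝ}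
    (hF : ∀ k, HasPD e (F k) (F' k) z) :
    HasPD e (fun w => ∑ k, F k w) (fun K => ∑ k, F' k K) z :=
  ⟨DifferentiableAt.fun_sum fun k _ => (hF k).diff, fun K => by
    rw [fderiv_fun_sum fun k _ => (hF k).diff]
    simp [(hF _).eq]⟩

end Calculus

/-! ### Bilinear forms and divergence identities for a general second order operator -/

section Bilinear

variable {ι : Type*} [Fintype ι]

/-- The bilinear form with matrix `C`. -/
def bil (C : ι → ι → ℝ) (g h : ι → ℝ) : ℝ := ∑ i, ∑ j, C i j * g i * h j

/-- The matrix `C` applied to the vector `h`. -/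
def app (C : ι → ι → ℝ) (h : ι → ℝ) (i : ι) : ℝ := ∑ j, C i j * h j

variable {C : ι → ι → ℝ}

theorem bil_eq_sum_mul_app (C : ι → ι → ℝ) (g h : ι → ℝ) :
    bil C g h = ∑ i, g i * app C h i := by
  simp only [bil, app, Finset.mul_sum]
  exact Finset.sum_congr rfl fun i _ => Finset.sum_congr rfl fun j _ => by ring

theorem bil_comm (hC : ∀ i j, C i j = C j i) (g h : ι → ℝ) : bil C g h = bil C h g := by
  unfold bil
  rw [Finset.sum_comm]
  exact Finset.sum_congr rfl fun i _ => Finset.sum_congr rfl fun j _ => by rw [hC]; ring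

theorem bil_eq_sum_app_mul (hC : ∀ i j, C i j = C j i) (g h : ι → ℝ) :
    bil C g h = ∑ i, app C g i * h i := by
  rw [bil_comm hC, bil_eq_sum_mul_app]
  exact Finset.sum_congr rfl fun i _ => by ring

variable {E : Type*} [NormedAddCommGroup E] [NormedSpace ℝ E] {κ : Type*} {e : κ → E}

theorem HasPD.bil {C : ι → ι → E → ℝ} {C' : κ → ι → ι → ℝ} {g h : ι → E → ℝ}
    {g' h' : κ → ι → ℝ} {z : E}
    (hC : ∀ i j, HasPD e (C i j) (fun K => C' K i j) z)
    (hg : ∀ i, HasPD e (g i) (fun K => g' K i) z) (hh : ∀ i, HasPD e (h i) (fun K => h' K i) z) :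
    HasPD e (fun w => UltraCarleman.bil (fun i j => C i j w) (fun i => g i w) (fun i => h i w))
      (fun K => UltraCarleman.bil (C' K) (fun i => g i z) (fun i => h i z)
        + UltraCarleman.bil (fun i j => C i j z) (g' K) (fun i => h i z)
        + UltraCarleman.bil (fun i j => C i j z) (fun i => g i z) (h' K)) z := by
  refine (HasPD.sum fun i => HasPD.sum fun j => ((hC i j).mul (hg i)).mul (hh j)).congr_val ?_
  intro K
  simp only [UltraCarleman.bil, ← Finset.sum_add_distrib]
  exact Finset.sum_congr rfl fun i _ => Finset.sum_congr rfl fun j _ => by ring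

theorem HasPD.app {C : ι → ι → E → ℝ} {C' : κ → ι → ι → ℝ} {h : ι → E → ℝ}
    {h' : κ → ι → ℝ} {z : E}
    (hC : ∀ i j, HasPD e (C i j) (fun K => C' K i j) z)
    (hh : ∀ i, HasPD e (h i) (fun K => h' K i) z) (i : ι) :
    HasPD e (fun w => UltraCarleman.app (fun i j => C i j w) (fun i => h i w) i)
      (fun K => UltraCarleman.app (C' K) (fun i => h i z) i
        + UltraCarleman.app (fun i j => C i j z) (h' K) i) z := by
  refine (HasPD.sum fun j => (hC i j).mul (hh j)).congr_val ?_
  intro K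
  simp only [UltraCarleman.app, ← Finset.sum_add_distrib]

/-- Divergence of the energy flux of a second order operator with principal part `C` along the
field `C ∇ψ`: here `g = ∇ψ`, `h = ∇θ`. -/
theorem sum_fderiv_energy_flux {e : ι → E} {C : ι → ι → E → ℝ} {C' : ι → ι → ι → ℝ}
    {g h : ι → E → ℝ} {g' h' : ι → ι → ℝ} {σ Φ θ : E → ℝ} {σ' Φ' : ι → ℝ} {z : E}
    (hC : ∀ i j, HasPD e (C i j) (fun K => C' K i j) z)
    (hg : ∀ i, HasPD e (g i) (fun K => g' K i) z) (hh : ∀ i, HasPD e (h i) (fun K => h' K i) z)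
    (hσ : HasPD e σ σ' z) (hΦ : HasPD e Φ Φ' z) (hθ : HasPD e θ (fun K => h K z) z)
    (hCs : ∀ i j, C i j z = C j i z) (hhs : ∀ i j, h' i j = h' j i) :
    ∑ K, fderiv ℝ (fun w => σ w *
        (2 * bil (fun i j => C i j w) (fun i => g i w) (fun i => h i w)
            * app (fun i j => C i j w) (fun i => h i w) K
          - app (fun i j => C i j w) (fun i => g i w) K
            * (bil (fun i j => C i j w) (fun i => h i w) (fun i => h i w)
              - Φ w * (θ w * θ w)))) z (e K)
      = 2 * σ z * bil (fun i j => C i j z) (fun i => g i z) (fun i => h i z)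
          * ((∑ K, ∑ L, C K L z * h' K L) + Φ z * θ z)
        + ∑ K, σ' K * (2 * bil (fun i j => C i j z) (fun i => g i z) (fun i => h i z)
            * app (fun i j => C i j z) (fun i => h i z) K
          - app (fun i j => C i j z) (fun i => g i z) K
            * (bil (fun i j => C i j z) (fun i => h i z) (fun i => h i z) - Φ z * θ z ^ 2))
        + σ z * (2 * bil (fun i j => C i j z) (fun i => g i z) (fun i => h i z)
              * (∑ K, app (C' K) (fun i => h i z) K)
            + 2 * ∑ K, bil (C' K) (fun i => g i z) (fun i => h i z)
              * app (fun i j => C i j z) (fun i => h i z) K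
            + 2 * ∑ K, bil (fun i j => C i j z) (g' K) (fun i => h i z)
              * app (fun i j => C i j z) (fun i => h i z) K
            - (∑ K, (app (C' K) (fun i => g i z) K + app (fun i j => C i j z) (g' K) K))
              * (bil (fun i j => C i j z) (fun i => h i z) (fun i => h i z) - Φ z * θ z ^ 2)
            - ∑ K, app (fun i j => C i j z) (fun i => g i z) K
              * bil (C' K) (fun i => h i z) (fun i => h i z)
            + (∑ K, app (fun i j => C i j z) (fun i => g i z) K * Φ' K) * θ z ^ 2) := by
  have hN := HasPD.bil hC hg hh
  have hS := HasPD.bil hC hh hh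
  have hCh := HasPD.app hC hh
  have hCg := HasPD.app hC hg
  have key := fun K => (hσ.mul ((((HasPD.const 2).mul hN).mul (hCh K)).sub
    ((hCg K).mul (hS.sub (hΦ.mul (hθ.mul hθ)))))).eq K
  simp only [key]
  set Cz : ι → ι → ℝ := fun i j => C i j z with hCz
  set gz : ι → ℝ := fun i => g i z
  set hz : ι → ℝ := fun i => h i z with hhz
  have hsym : ∀ i j, Cz i j = Cz j i := hCs
  -- Both sides are `∇²θ` evaluated on `C∇ψ` and `C∇θ`. By symmetry of the Hessian the second
  -- derivatives cancel, apart from those forming the trace `C:∇²θ`.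
  have e1 : ∑ K, bil Cz gz (h' K) * app Cz hz K = ∑ K, app Cz gz K * bil Cz hz (h' K) := by
    simp only [bil_eq_sum_app_mul hsym, Finset.sum_mul, Finset.mul_sum]
    rw [Finset.sum_comm]
    refine Finset.sum_congr rfl fun i _ => Finset.sum_congr rfl fun j _ => ?_
    rw [hhs]; ring
  have e2 : ∀ K, bil Cz (h' K) hz = bil Cz hz (h' K) := fun K => bil_comm hsym _ _
  have e3 : ∑ K, ∑ L, C K L z * h' K L = ∑ K, app Cz (h' K) K := rfl
  have e4 : bil Cz gz hz = ∑ K, app Cz gz K * h K z := bil_eq_sum_app_mul hsym _ _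
  have expand : ∀ K, σ' K * (2 * bil Cz gz hz * app Cz hz K
        - app Cz gz K * (bil Cz hz hz - Φ z * (θ z * θ z)))
      + σ z * ((0 * bil Cz gz hz + 2 * (bil (C' K) gz hz + bil Cz (g' K) hz + bil Cz gz (h' K)))
            * app Cz hz K
          + 2 * bil Cz gz hz * (app (C' K) hz K + app Cz (h' K) K)
          - ((app (C' K) gz K + app Cz (g' K) K) * (bil Cz hz hz - Φ z * (θ z * θ z))
            + app Cz gz K * (bil (C' K) hz hz + bil Cz (h' K) hz + bil Cz hz (h' K)
              - (Φ' K * (θ z * θ z) + Φ z * (h K z * θ z + θ z * h K z)))))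
      = σ' K * (2 * bil Cz gz hz * app Cz hz K
            - app Cz gz K * (bil Cz hz hz - Φ z * θ z ^ 2))
        + (2 * σ z * bil Cz gz hz * app (C' K) hz K
        + 2 * σ z * (bil (C' K) gz hz * app Cz hz K)
        + 2 * σ z * (bil Cz (g' K) hz * app Cz hz K)
        + 2 * σ z * (bil Cz gz (h' K) * app Cz hz K)
        + 2 * σ z * bil Cz gz hz * app Cz (h' K) K
        - σ z * (bil Cz hz hz - Φ z * θ z ^ 2) * (app (C' K) gz K + app Cz (g' K) K)
        - σ z * (app Cz gz K * bil (C' K) hz hz)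
        - 2 * σ z * (app Cz gz K * bil Cz hz (h' K))
        + σ z * θ z ^ 2 * (app Cz gz K * Φ' K)
        + 2 * σ z * Φ z * θ z * (app Cz gz K * h K z)) := by
    intro K; rw [e2]; ring
  rw [Finset.sum_congr rfl fun K _ => expand K, Finset.sum_add_distrib]
  simp only [Finset.sum_add_distrib, Finset.sum_sub_distrib, ← Finset.mul_sum]
  rw [e1, e3, ← e4]
  ring

/-- Divergence of the flux obtained by multiplying the operator with principal part `C` by
`φ χ²`, where `∇χ = - w χ g`. -/
theorem sum_fderiv_multiplier_flux {e : ι → E} {C : ι → ι → E → ℝ} {C' : ι → ι → ι → ℝ}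
    {c : ι → E → ℝ} {c' : ι → ι → ℝ}
    {g u : ι → E → ℝ} {g' u' : ι → ι → ℝ} {φ χ w : E → ℝ} {w' : ℝ} {z : E}
    (hC : ∀ i j, HasPD e (C i j) (fun K => C' K i j) z)
    (hc : ∀ i, HasPD e (c i) (fun K => c' K i) z)
    (hg : ∀ i, HasPD e (g i) (fun K => g' K i) z) (hu : ∀ i, HasPD e (u i) (fun K => u' K i) z)
    (hφ : HasPD e φ (fun K => u K z) z) (hχ : HasPD e χ (fun K => -(w z * χ z * g K z)) z)
    (hw : HasPD e w (fun K => w' * g K z) z)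
    (hCs : ∀ i j, C i j z = C j i z)
    (hcC : ∑ K, c K z * u K z = ∑ K, app (C' K) (fun i => u i z) K) :
    ∑ K, fderiv ℝ (fun v => (φ v * app (fun i j => C i j v) (fun i => u i v) K
          + w v * (φ v * φ v) * app (fun i j => C i j v) (fun i => g i v) K
          - 1 / 2 * c K v * (φ v * φ v)) * (χ v * χ v)) z (e K)
      = χ z ^ 2 * (φ z * (∑ K, ∑ L, C K L z * u' K L)
          + bil (fun i j => C i j z) (fun i => u i z) (fun i => u i z))
        + (χ z * φ z) ^ 2 * (-(1 / 2) * (∑ K, c' K K) + w z * (∑ K, c K z * g K z)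
          + w z * (∑ K, (app (C' K) (fun i => g i z) K + app (fun i j => C i j z) (g' K) K))
          + (w' - 2 * w z ^ 2)
            * bil (fun i j => C i j z) (fun i => g i z) (fun i => g i z)) := by
  have hCu := HasPD.app hC hu
  have hCg := HasPD.app hC hg
  have key := fun K => (((((hφ.mul (hCu K)).add ((hw.mul (hφ.mul hφ)).mul (hCg K))).sub
    (((HasPD.const (1 / 2)).mul (hc K)).mul (hφ.mul hφ))).mul (hχ.mul hχ)).eq K)
  simp only [key]
  set Cz : ι → ι → ℝ := fun i j => C i j z with hCz
  set gz : ι → ℝ := fun i => g i z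
  set uz : ι → ℝ := fun i => u i z with huz
  have hsym : ∀ i j, Cz i j = Cz j i := hCs
  have e3 : ∑ K, ∑ L, C K L z * u' K L = ∑ K, app Cz (u' K) K := rfl
  have e4 : bil Cz gz uz = ∑ K, app Cz gz K * u K z := bil_eq_sum_app_mul hsym _ _
  have e5 : bil Cz gz uz = ∑ K, g K z * app Cz uz K := bil_eq_sum_mul_app _ _ _
  have e6 : bil Cz gz gz = ∑ K, g K z * app Cz gz K := bil_eq_sum_mul_app _ _ _
  have e7 : bil Cz uz uz = ∑ K, u K z * app Cz uz K := bil_eq_sum_mul_app _ _ _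
  have expand : ∀ K, (u K z * app Cz uz K + φ z * (app (C' K) uz K + app Cz (u' K) K)
        + ((w' * g K z * (φ z * φ z) + w z * (u K z * φ z + φ z * u K z)) * app Cz gz K
          + w z * (φ z * φ z) * (app (C' K) gz K + app Cz (g' K) K))
        - ((0 * c K z + 1 / 2 * c' K K) * (φ z * φ z)
          + 1 / 2 * c K z * (u K z * φ z + φ z * u K z))) * (χ z * χ z)
      + (φ z * app Cz uz K + w z * (φ z * φ z) * app Cz gz K - 1 / 2 * c K z * (φ z * φ z))
        * (-(w z * χ z * g K z) * χ z + χ z * -(w z * χ z * g K z))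
      = χ z ^ 2 * (u K z * app Cz uz K) + χ z ^ 2 * φ z * app (C' K) uz K
        + χ z ^ 2 * φ z * app Cz (u' K) K
        + w' * χ z ^ 2 * φ z ^ 2 * (g K z * app Cz gz K)
        + 2 * w z * φ z * χ z ^ 2 * (app Cz gz K * u K z)
        + w z * φ z ^ 2 * χ z ^ 2 * (app (C' K) gz K + app Cz (g' K) K)
        - 1 / 2 * φ z ^ 2 * χ z ^ 2 * c' K K
        - φ z * χ z ^ 2 * (c K z * u K z)
        - 2 * w z * χ z ^ 2 * φ z * (g K z * app Cz uz K)
        - 2 * w z ^ 2 * χ z ^ 2 * φ z ^ 2 * (g K z * app Cz gz K)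
        + w z * χ z ^ 2 * φ z ^ 2 * (c K z * g K z) := by
    intro K; ring
  rw [Finset.sum_congr rfl fun K _ => expand K]
  simp only [Finset.sum_add_distrib, Finset.sum_sub_distrib, ← Finset.mul_sum]
  -- Two cancellations leave no `φ∇φ` term: `-½ c φ²` removes the term with the row divergence of
  -- `C` (this is `hcC`), and the derivative of `χ²` cancels that of `wφ²` by symmetry of `C`.
  rw [e3, ← e4, ← e5, ← e6, ← e7, hcC]
  ring

/-- Product rule showing that a cross term `2wθ V·∇θ` is a divergence up to a multiple of `θ²`; this
is the mechanism behind `D₂`. -/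
theorem sum_fderiv_lower_order_flux {e : ι → E} {V : ι → E → ℝ} {V' : ι → ι → ℝ}
    {g h : ι → E → ℝ} {θ w : E → ℝ} {w' : ℝ} {z : E}
    (hV : ∀ i, HasPD e (V i) (fun K => V' K i) z)
    (hθ : HasPD e θ (fun K => h K z) z) (hw : HasPD e w (fun K => w' * g K z) z) :
    ∑ K, fderiv ℝ (fun v => V K v * (w v * (θ v * θ v))) z (e K)
      = (w z * (∑ K, V' K K) + w' * ∑ K, V K z * g K z) * θ z ^ 2
        + 2 * w z * θ z * ∑ K, V K z * h K z := by
  have key := fun K => ((hV K).mul (hw.mul (hθ.mul hθ))).eq K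
  simp only [key]
  simp only [Finset.mul_sum, add_mul, Finset.sum_mul, ← Finset.sum_add_distrib]
  exact Finset.sum_congr rfl fun i _ => by ring

end Bilinear

end UltraCarleman

namespace UltraCarleman

variable {p q : ℕ}

/-! ### Block form of vectors and matrices on `ℝⁿ × ℝᵐ` -/

/-- Indices of the coordinates on `ℝⁿ × ℝᵐ`. -/
abbrev Idx (p q : ℕ) : Type := Fin (p + 1) ⊕ Fin (q + 1)

/-- The coordinate directions. -/
def dir : Idx p q → Pt (p + 1) (q + 1) :=
  Sum.elim (fun i => (Pi.single i 1, 0)) (fun j => (0, Pi.single j 1))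

theorem sum_idx (f : Idx p q → ℝ) :
    ∑ K, f K = f (.inl 0) + ∑ r : Fin p, f (.inl r.succ) + ∑ k, f (.inr k) := by
  rw [Fintype.sum_sum_type, Fin.sum_univ_succ]

theorem divergence_eq_sum (F : Fin (p + 1) → Pt (p + 1) (q + 1) → ℝ)
    (G : Fin (q + 1) → Pt (p + 1) (q + 1) → ℝ) (z : Pt (p + 1) (q + 1)) :
    divergence F G z = ∑ K, fderiv ℝ (Sum.elim F G K) z (dir K) := by
  rw [Fintype.sum_sum_type]; rfl

/-- The vector with components `a`, `x`, `y` in `ℝ × ℝᵖ × ℝᵐ`. -/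
def vec (a : ℝ) (x : Fin p → ℝ) (y : Fin (q + 1) → ℝ) : Idx p q → ℝ :=
  Sum.elim (Fin.cons a x) y

@[simp] theorem vec_zero (a : ℝ) (x : Fin p → ℝ) (y : Fin (q + 1) → ℝ) :
    vec a x y (.inl 0) = a := rfl

@[simp] theorem vec_succ (a : ℝ) (x : Fin p → ℝ) (y : Fin (q + 1) → ℝ) (r : Fin p) :
    vec a x y (.inl r.succ) = x r := rfl

@[simp] theorem vec_inr (a : ℝ) (x : Fin p → ℝ) (y : Fin (q + 1) → ℝ) (k : Fin (q + 1)) :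
    vec a x y (.inr k) = y k := rfl

/-- The block diagonal matrix with blocks `a`, `b I`, `A`. -/
def blk (a b : ℝ) (A : Fin (q + 1) → Fin (q + 1) → ℝ) : Idx p q → Idx p q → ℝ
  | .inl i, .inl j => if i = j then (Fin.cons a (fun _ => b) : Fin (p + 1) → ℝ) i else 0
  | .inl _, .inr _ => 0
  | .inr _, .inl _ => 0
  | .inr i, .inr j => A i j

theorem blk_comm {a b : ℝ} {A : Fin (q + 1) → Fin (q + 1) → ℝ} (hA : ∀ i j, A i j = A j i)
    (I J : Idx p q) : blk a b A I J = blk a b A J I := by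
  rcases I with i | i <;> rcases J with j | j <;> simp only [blk]
  · by_cases h : i = j
    · subst h; rfl
    · rw [if_neg h, if_neg (Ne.symm h)]
  · exact hA i j

section

variable (a b : ℝ) (A : Fin (q + 1) → Fin (q + 1) → ℝ) (h : Idx p q → ℝ)

@[simp] theorem app_blk_zero : app (blk a b A) h (.inl 0) = a * h (.inl 0) := by
  simp [app, blk]

@[simp] theorem app_blk_succ (r : Fin p) :
    app (blk a b A) h (.inl r.succ) = b * h (.inl r.succ) := by
  simp [app, blk]

@[simp] theorem app_blk_inr (k : Fin (q + 1)) :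
    app (blk a b A) h (.inr k) = app A (fun j => h (.inr j)) k := by
  simp [app, blk]

@[simp] theorem bil_blk (g : Idx p q → ℝ) :
    bil (blk a b A) g h = a * (g (.inl 0) * h (.inl 0))
      + b * (∑ r : Fin p, g (.inl r.succ) * h (.inl r.succ))
      + bil A (fun j => g (.inr j)) (fun j => h (.inr j)) := by
  rw [bil_eq_sum_mul_app, sum_idx]
  simp only [app_blk_zero, app_blk_succ, app_blk_inr, ← bil_eq_sum_mul_app, Finset.mul_sum]
  congr 2
  · ring
  · exact Finset.sum_congr rfl fun r _ => by ring

theorem sum_blk_mul (H : Idx p q → Idx p q → ℝ) :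
    ∑ K, ∑ L, blk a b A K L * H K L = a * H (.inl 0) (.inl 0)
      + b * (∑ r : Fin p, H (.inl r.succ) (.inl r.succ))
      + ∑ i, ∑ j, A i j * H (.inr i) (.inr j) := by
  have : ∀ K, ∑ L, blk a b A K L * H K L = app (blk a b A) (H K) K := fun _ => rfl
  simp only [this]
  rw [sum_idx]
  simp only [app_blk_zero, app_blk_succ, app_blk_inr, Finset.mul_sum]
  rfl

end

section Scaling

variable {κ : Type*} [Fintype κ] (A B : κ → κ → ℝ) (g h : κ → ℝ) (c : ℝ)

theorem bil_smul : bil (fun i j => c * A i j) g h = c * bil A g h := by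
  simp only [bil, Finset.mul_sum]
  exact Finset.sum_congr rfl fun i _ => Finset.sum_congr rfl fun j _ => by ring

theorem bil_add : bil (fun i j => A i j + B i j) g h = bil A g h + bil B g h := by
  simp only [bil, ← Finset.sum_add_distrib]
  exact Finset.sum_congr rfl fun i _ => Finset.sum_congr rfl fun j _ => by ring

theorem bil_neg : bil (fun i j => -A i j) g h = -bil A g h := by
  simp only [bil, ← Finset.sum_neg_distrib]
  exact Finset.sum_congr rfl fun i _ => Finset.sum_congr rfl fun j _ => by ring

theorem app_smul (k : κ) : app (fun i j => c * A i j) h k = c * app A h k := by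
  simp only [app, Finset.mul_sum]
  exact Finset.sum_congr rfl fun j _ => by ring

theorem app_neg (k : κ) : app (fun i j => -A i j) h k = -app A h k := by
  simp only [app, ← Finset.sum_neg_distrib]
  exact Finset.sum_congr rfl fun j _ => by ring

end Scaling

theorem HasPD.blk {a b : Pt (p + 1) (q + 1) → ℝ}
    {A : Fin (q + 1) → Fin (q + 1) → Pt (p + 1) (q + 1) → ℝ} {a' b' : Idx p q → ℝ}
    {A' : Idx p q → Fin (q + 1) → Fin (q + 1) → ℝ} {z : Pt (p + 1) (q + 1)}
    (ha : HasPD dir a a' z) (hb : HasPD dir b b' z)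
    (hA : ∀ i j, HasPD dir (A i j) (fun K => A' K i j) z) (I J : Idx p q) :
    HasPD dir (fun w => UltraCarleman.blk (a w) (b w) (fun i j => A i j w) I J)
      (fun K => UltraCarleman.blk (a' K) (b' K) (A' K) I J) z := by
  rcases I with i | i <;> rcases J with j | j <;> simp only [UltraCarleman.blk]
  · by_cases h : i = j
    · simp only [if_pos h]
      refine Fin.cases ?_ (fun r => ?_) i
      · simpa using ha
      · simpa using hb
    · simp only [if_neg h]; exact HasPD.const 0
  · exact HasPD.const 0
  · exact HasPD.const 0
  · exact hA i j

/-! ### The weight -/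

/-- `∂ψ/∂x_r`, `r ≥ 2`. -/
def Params.gx (P : Params p q) (r : Fin p) (z : Pt (p + 1) (q + 1)) : ℝ := z.1 r.succ - P.x₀ r

/-- `∂ψ/∂y_k`. -/
def Params.gy (P : Params p q) (k : Fin (q + 1)) (z : Pt (p + 1) (q + 1)) : ℝ :=
  z.2 k - (Fin.snoc P.y₀ 0 : Fin (q + 1) → ℝ) k

/-- The gradient of `ψ`. -/
def Params.grad (P : Params p q) (I : Idx p q) (z : Pt (p + 1) (q + 1)) : ℝ :=
  vec P.δ (fun r => P.gx r z) (fun k => P.gy k z) I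

/-- Appending `0` to the centre `y₀` puts `y_m` on the same footing as the other `y` coordinates. -/
theorem Params.psi₀_eq (P : Params p q) (z : Pt (p + 1) (q + 1)) :
    P.psi₀ z = P.δ * z.1 0 + 1 / 2 * ∑ r, P.gx r z ^ 2 + 1 / 2 * ∑ k, P.gy k z ^ 2 := by
  rw [Fin.sum_univ_castSucc]
  simp only [Params.psi₀, Params.gx, Params.gy, Fin.snoc_castSucc, Fin.snoc_last, sub_zero]
  ring

theorem hasPD_fst (i : Fin (p + 1)) (z : Pt (p + 1) (q + 1)) :
    HasPD dir (fun w : Pt (p + 1) (q + 1) => w.1 i) (fun K => (dir K : Pt (p + 1) (q + 1)).1 i)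
      z := by
  have h : HasFDerivAt (fun w : Pt (p + 1) (q + 1) => w.1 i)
      ((ContinuousLinearMap.proj i).comp (ContinuousLinearMap.fst ℝ (Fin (p + 1) → ℝ)
        (Fin (q + 1) → ℝ))) z :=
    ((ContinuousLinearMap.proj i).comp (ContinuousLinearMap.fst ℝ (Fin (p + 1) → ℝ)
        (Fin (q + 1) → ℝ))).hasFDerivAt
  exact ⟨h.differentiableAt, fun K => by rw [h.fderiv]; rfl⟩

theorem hasPD_snd (j : Fin (q + 1)) (z : Pt (p + 1) (q + 1)) :
    HasPD dir (fun w : Pt (p + 1) (q + 1) => w.2 j) (fun K => (dir K : Pt (p + 1) (q + 1)).2 j)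
      z := by
  have h : HasFDerivAt (fun w : Pt (p + 1) (q + 1) => w.2 j)
      ((ContinuousLinearMap.proj j).comp (ContinuousLinearMap.snd ℝ (Fin (p + 1) → ℝ)
        (Fin (q + 1) → ℝ))) z :=
    ((ContinuousLinearMap.proj j).comp (ContinuousLinearMap.snd ℝ (Fin (p + 1) → ℝ)
        (Fin (q + 1) → ℝ))).hasFDerivAt
  exact ⟨h.differentiableAt, fun K => by rw [h.fderiv]; rfl⟩

theorem forall_idx {C : Idx p q → Prop} (h0 : C (.inl 0)) (h1 : ∀ r : Fin p, C (.inl r.succ))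
    (h2 : ∀ k, C (.inr k)) : ∀ K, C K := by
  rintro (i | k)
  · exact Fin.cases h0 h1 i
  · exact h2 k

@[simp] theorem dir_zero_fst (i : Fin (p + 1)) :
    (dir (.inl 0) : Pt (p + 1) (q + 1)).1 i = if i = 0 then 1 else 0 := by
  simp [dir, Pi.single_apply]

@[simp] theorem dir_succ_fst (r : Fin p) (i : Fin (p + 1)) :
    (dir (.inl r.succ) : Pt (p + 1) (q + 1)).1 i = if i = r.succ then 1 else 0 := by
  simp [dir, Pi.single_apply]

@[simp] theorem dir_inl_snd (i : Fin (p + 1)) (j : Fin (q + 1)) :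
    (dir (.inl i) : Pt (p + 1) (q + 1)).2 j = 0 := rfl

@[simp] theorem dir_inr_fst (i : Fin (p + 1)) (k : Fin (q + 1)) :
    (dir (.inr k) : Pt (p + 1) (q + 1)).1 i = 0 := rfl

@[simp] theorem dir_inr_snd (j k : Fin (q + 1)) :
    (dir (.inr k) : Pt (p + 1) (q + 1)).2 j = if j = k then 1 else 0 := by
  simp [dir, Pi.single_apply]

/-- The Hessian of `ψ`. -/
def hessPsi : Idx p q → Idx p q → ℝ := blk 0 1 (fun i j => if i = j then 1 else 0)

@[simp] theorem hessPsi_zero : hessPsi (.inl 0) = (0 : Idx p q → ℝ) := by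
  funext I
  revert I
  refine forall_idx ?_ ?_ ?_ <;> simp [hessPsi, blk, (Fin.succ_ne_zero _).symm]

variable (P : Params p q) (z : Pt (p + 1) (q + 1))

theorem Params.hasPD_grad (I : Idx p q) : HasPD dir (P.grad I) (fun K => hessPsi K I) z := by
  revert I
  refine forall_idx ?_ ?_ ?_
  · refine (HasPD.const P.δ).congr_val (forall_idx ?_ ?_ ?_) <;> simp [hessPsi, blk]
  · intro r
    refine ((hasPD_fst r.succ z).sub (HasPD.const (P.x₀ r))).congr_val (forall_idx ?_ ?_ ?_) <;>
      simp [hessPsi, blk, eq_comm, Fin.succ_ne_zero]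
  · intro k
    refine ((hasPD_snd k z).sub (HasPD.const _)).congr_val (forall_idx ?_ ?_ ?_) <;>
      simp [hessPsi, blk, eq_comm]

theorem Params.hasPD_psi : HasPD dir P.psi (fun K => P.grad K z) z := by
  have h : P.psi = fun w => (P.δ * w.1 0 + 1 / 2 * ∑ r, P.gx r w * P.gx r w
      + 1 / 2 * ∑ k, P.gy k w * P.gy k w) + P.α₀ := by
    funext w; rw [Params.psi, P.psi₀_eq]; simp only [sq]
  rw [h]
  have hx : ∀ r, HasPD dir (P.gx r) (fun K => hessPsi K (.inl r.succ)) z :=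
    fun r => P.hasPD_grad z (.inl r.succ)
  have hy : ∀ k, HasPD dir (P.gy k) (fun K => hessPsi K (.inr k)) z :=
    fun k => P.hasPD_grad z (.inr k)
  refine (((((HasPD.const P.δ).mul (hasPD_fst 0 z)).add ((HasPD.const (1 / 2)).mul
    (HasPD.sum fun r => (hx r).mul (hx r)))).add ((HasPD.const (1 / 2)).mul
    (HasPD.sum fun r => (hy r).mul (hy r)))).add (HasPD.const P.α₀)).congr_val
    (forall_idx ?_ ?_ ?_)
  · simp [Params.grad]
  · intro r
    simp [hessPsi, blk, Params.grad, Finset.sum_add_distrib, (Fin.succ_ne_zero _).symm]; ring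
  · intro k
    simp [hessPsi, blk, Params.grad, Finset.sum_add_distrib]; ring

theorem Params.dx_succ_psi (r : Fin p) : dx r.succ P.psi = P.gx r :=
  funext fun z => (P.hasPD_psi z).eq (.inl r.succ)

theorem Params.dy_psi (k : Fin (q + 1)) : dy k P.psi = P.gy k :=
  funext fun z => (P.hasPD_psi z).eq (.inr k)

theorem Params.hasPD_s : HasPD dir P.s (fun K => vec 1 0 0 K) z := by
  refine ((hasPD_fst 0 z).add (HasPD.const P.eta₀)).congr_val (forall_idx ?_ ?_ ?_) <;>
    simp [(Fin.succ_ne_zero _).symm]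

/-- `λ ν ψ^{-ν-1}`, so that `∇χ = - w χ ∇ψ`. -/
noncomputable def Params.w (lam : ℝ) (z : Pt (p + 1) (q + 1)) : ℝ :=
  lam * P.ν * P.psi z ^ (-P.ν - 1)

variable {z} {lam : ℝ}

theorem Params.hasPD_w (h : 0 < P.psi z) :
    HasPD dir (P.w lam) (fun K => -(P.ν + 1) * P.w lam z / P.psi z * P.grad K z) z := by
  have := (P.hasPD_psi z).comp (u := fun t => lam * P.ν * t ^ (-P.ν - 1))
    ((Real.hasDerivAt_rpow_const (p := -P.ν - 1) (Or.inl h.ne')).const_mul (lam * P.ν))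
  refine this.congr_val fun K => ?_
  rw [Real.rpow_sub_one h.ne', Params.w]; ring

theorem Params.hasPD_chi (h : 0 < P.psi z) :
    HasPD dir (P.chi lam) (fun K => -(P.w lam z * P.chi lam z * P.grad K z)) z := by
  have := (P.hasPD_psi z).comp (u := fun t => Real.exp (lam * t ^ (-P.ν)))
    (((Real.hasDerivAt_rpow_const (p := -P.ν) (Or.inl h.ne')).const_mul lam).exp)
  refine this.congr_val fun K => ?_
  rw [Params.w, Params.chi]; ring

/-- In terms of `w` and `1/ψ` the real powers disappear, so that the later identities are rational
and within reach of `field_simp` and `ring`. -/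
theorem Params.phi₁_eq (h : 0 < P.psi z) :
    phi₁ P lam z = P.w lam z ^ 2 - (P.ν + 1) * P.w lam z / P.psi z := by
  rw [phi₁, Params.w,
    show -2 * P.ν - 2 = (-P.ν - 1) * (2 : ℕ) by push_cast; ring, Real.rpow_mul_natCast h.le,
    show -P.ν - 2 = -P.ν - 1 - 1 by ring, Real.rpow_sub_one h.ne' (-P.ν - 1)]
  ring

/-- The matrix `diag (1, s², - s² A)` of the principal part of `s L₀`. -/
noncomputable def Params.prin (A : Fin (q + 1) → Fin (q + 1) → Pt (p + 1) (q + 1) → ℝ)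
    (I J : Idx p q) (z : Pt (p + 1) (q + 1)) : ℝ :=
  blk 1 (P.s z * P.s z) (fun i j => -(P.s z * P.s z * A i j z)) I J

variable {A : Fin (q + 1) → Fin (q + 1) → Pt (p + 1) (q + 1) → ℝ}

theorem Params.prin_comm (hA : ∀ i j, A i j z = A j i z) (I J : Idx p q) :
    P.prin A I J z = P.prin A J I z :=
  blk_comm (fun i j => by rw [hA]) I J

/-- The derivatives of the matrix of the principal part. -/
noncomputable def Params.prin' (A : Fin (q + 1) → Fin (q + 1) → Pt (p + 1) (q + 1) → ℝ)
    (z : Pt (p + 1) (q + 1)) (K I J : Idx p q) : ℝ :=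
  blk 0 (2 * P.s z * vec 1 0 0 K)
    (fun i j => -(2 * P.s z * vec 1 0 0 K * A i j z
      + P.s z ^ 2 * fderiv ℝ (A i j) z (dir K))) I J

theorem Params.hasPD_prin (hA : ∀ i j, DifferentiableAt ℝ (A i j) z) (I J : Idx p q) :
    HasPD dir (P.prin A I J) (fun K => P.prin' A z K I J) z := by
  have hs := (P.hasPD_s z).mul (P.hasPD_s z)
  refine (HasPD.blk (HasPD.const 1) hs
    (fun i j => (hs.mul (HasPD.of_diff dir (hA i j))).neg) I J).congr_val fun K => ?_
  unfold Params.prin'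
  congr 1
  · ring
  · funext i j; ring

end UltraCarleman

/-! ### The energy identity behind `D₁` -/

namespace UltraCarleman

variable {p q : ℕ} {P : Params p q} {z : Pt (p + 1) (q + 1)} {lam : ℝ}
  {A : Fin (q + 1) → Fin (q + 1) → Pt (p + 1) (q + 1) → ℝ}

theorem hasPD_fderiv {θ : Pt (p + 1) (q + 1) → ℝ} (hθ : ContDiffAt ℝ 2 θ z) (I : Idx p q) :
    HasPD dir (fun w => fderiv ℝ θ w (dir I))
      (fun K => fderiv ℝ (fun w => fderiv ℝ θ w (dir I)) z (dir K)) z := by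
  have h1 : ContDiffAt ℝ 1 (fderiv ℝ θ) z := hθ.fderiv_right (by norm_num)
  exact HasPD.of_diff dir ((h1.differentiableAt (by norm_num)).clm_apply
    (differentiableAt_const _))

theorem fderiv_fderiv_comm {θ : Pt (p + 1) (q + 1) → ℝ} (hθ : ContDiffAt ℝ 2 θ z)
    (u v : Pt (p + 1) (q + 1)) :
    fderiv ℝ (fun w => fderiv ℝ θ w u) z v = fderiv ℝ (fun w => fderiv ℝ θ w v) z u := by
  have h1 : ContDiffAt ℝ 1 (fderiv ℝ θ) z := hθ.fderiv_right (by norm_num)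
  have h2 := h1.differentiableAt (by norm_num)
  rw [fderiv_clm_apply h2 (differentiableAt_const _), fderiv_clm_apply h2 (differentiableAt_const _)]
  simpa using (hθ.isSymmSndFDerivAt (by simp)).eq v u

/-- `C(∇ψ, ∇ψ)`, where `C` is the principal part of `s L₀`. -/
noncomputable def Params.Q (P : Params p q)
    (A : Fin (q + 1) → Fin (q + 1) → Pt (p + 1) (q + 1) → ℝ) (z : Pt (p + 1) (q + 1)) : ℝ :=
  bil (fun I J => P.prin A I J z) (fun I => P.grad I z) (fun I => P.grad I z)

/-- `C : ∇²ψ`, where `C` is the principal part of `s L₀`. -/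
noncomputable def Params.τ (P : Params p q)
    (A : Fin (q + 1) → Fin (q + 1) → Pt (p + 1) (q + 1) → ℝ) (z : Pt (p + 1) (q + 1)) : ℝ :=
  P.s z * P.s z * (p - ∑ i, A i i z)

theorem Params.Q_eq : P.Q A z = P.δ ^ 2 + P.s z ^ 2 * ((∑ r, P.gx r z ^ 2)
    - bil (fun i j => A i j z) (fun k => P.gy k z) (fun k => P.gy k z)) := by
  simp only [Params.Q, Params.prin, bil_blk, Params.grad, vec_zero, vec_succ, vec_inr, bil_neg,
    bil_smul, ← sq]
  ring

/-- `Φ` is the zeroth order coefficient of the conjugated operator, `(w² + w')C(∇ψ,∇ψ) + w C:∇²ψ`,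
where `w' = -(ν+1)w/ψ` is the derivative of `w` with respect to `ψ`. Hence only `Q` and `τ` have to
be differentiated afresh. -/
theorem bigPhi_eq (h : 0 < P.psi z) : bigPhi P A lam z
    = (P.w lam z * P.w lam z - (P.ν + 1) * (P.w lam z * (P.psi z)⁻¹)) * P.Q A z
      + P.w lam z * P.τ A z := by
  have e1 := P.phi₁_eq (lam := lam) h
  have e2 : phi₂ P lam z = phi₁ P lam z * (∑ r, P.gx r z ^ 2) + P.w lam z * p := by
    rw [phi₂, phi₁, Params.w]; simp only [Params.dx_succ_psi]; ring
  have e3 : phi₃ P A lam z = phi₁ P lam z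
      * bil (fun i j => A i j z) (fun k => P.gy k z) (fun k => P.gy k z)
      + P.w lam z * ∑ i, A i i z := by
    rw [phi₃, phi₁, Params.w, bil]; simp only [Params.dy_psi]; ring
  rw [bigPhi, e2, e3, e1, Params.Q_eq, Params.τ]
  ring

theorem HasPD.div {E : Type*} [NormedAddCommGroup E] [NormedSpace ℝ E] {ι : Type*} {e : ι → E}
    {f : E → ℝ} {f' : ι → ℝ} {z : E} (hf : HasPD e f f' z) (h : f z ≠ 0) :
    HasPD e (fun w => (f w)⁻¹) (fun K => -(f z ^ 2)⁻¹ * f' K) z :=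
  hf.comp (hasDerivAt_inv h)

theorem eventually_psi_pos (h : 0 < P.psi z) : ∀ᶠ v in nhds z, 0 < P.psi v :=
  (P.hasPD_psi z).diff.continuousAt.eventually_const_lt h

theorem eventually_s_pos (h : 0 < P.s z) : ∀ᶠ v in nhds z, 0 < P.s v :=
  (P.hasPD_s z).diff.continuousAt.eventually_const_lt h

/-- The derivatives of `C(∇ψ, ∇ψ)`. -/
noncomputable def Params.Q' (P : Params p q)
    (A : Fin (q + 1) → Fin (q + 1) → Pt (p + 1) (q + 1) → ℝ) (z : Pt (p + 1) (q + 1)) :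
    Idx p q → ℝ :=
  vec (2 * P.s z * ((∑ r, P.gx r z ^ 2)
        - bil (fun i j => A i j z) (fun k => P.gy k z) (fun k => P.gy k z))
      - P.s z ^ 2 * bil (fun i j => dx 0 (A i j) z) (fun k => P.gy k z) (fun k => P.gy k z))
    (fun r => P.s z ^ 2 * (2 * P.gx r z
      - bil (fun i j => dx r.succ (A i j) z) (fun k => P.gy k z) (fun k => P.gy k z)))
    (fun k => -(P.s z ^ 2) * (2 * app (fun i j => A i j z) (fun k => P.gy k z) k
      + bil (fun i j => dy k (A i j) z) (fun k => P.gy k z) (fun k => P.gy k z)))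

/-- The derivatives of `C : ∇²ψ`. -/
noncomputable def Params.τ' (P : Params p q)
    (A : Fin (q + 1) → Fin (q + 1) → Pt (p + 1) (q + 1) → ℝ) (z : Pt (p + 1) (q + 1)) :
    Idx p q → ℝ :=
  vec (2 * P.s z * (p - ∑ i, A i i z) - P.s z ^ 2 * ∑ i, dx 0 (A i i) z)
    (fun r => -(P.s z ^ 2) * ∑ i, dx r.succ (A i i) z)
    (fun k => -(P.s z ^ 2) * ∑ i, dy k (A i i) z)

theorem hessPsi_succ (r : Fin p) :
    (hessPsi (.inl r.succ) : Idx p q → ℝ) = vec 0 (Pi.single r 1) 0 := by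
  funext I
  revert I
  refine forall_idx ?_ ?_ ?_ <;>
    simp [hessPsi, blk, Pi.single_apply, eq_comm]

theorem hessPsi_inr (k : Fin (q + 1)) :
    (hessPsi (.inr k) : Idx p q → ℝ) = vec 0 0 (Pi.single k 1) := by
  funext I
  revert I
  refine forall_idx ?_ ?_ ?_ <;>
    simp [hessPsi, blk, Pi.single_apply, eq_comm]

theorem prin'_zero : P.prin' A z (.inl 0) = blk 0 (2 * P.s z)
    (fun i j => -(2 * P.s z * A i j z + P.s z ^ 2 * dx 0 (A i j) z)) := by
  funext I J
  simp only [Params.prin', vec_zero, mul_one]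
  rfl

theorem prin'_succ (r : Fin p) : P.prin' A z (.inl r.succ) = blk 0 0
    (fun i j => -(P.s z ^ 2 * dx r.succ (A i j) z)) := by
  funext I J
  simp only [Params.prin', vec_succ, Pi.zero_apply, mul_zero, zero_mul, zero_add]
  rfl

theorem prin'_inr (k : Fin (q + 1)) : P.prin' A z (.inr k) = blk 0 0
    (fun i j => -(P.s z ^ 2 * dy k (A i j) z)) := by
  funext I J
  simp only [Params.prin', vec_inr, Pi.zero_apply, mul_zero, zero_mul, zero_add]
  rfl

theorem prin_eq : (fun I J => P.prin A I J z)
    = blk 1 (P.s z * P.s z) (fun i j => -(P.s z * P.s z * A i j z)) := rfl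

theorem bil_single_right {κ : Type*} [Fintype κ] [DecidableEq κ] {B : κ → κ → ℝ}
    (hB : ∀ i j, B i j = B j i) (h : κ → ℝ) (k : κ) :
    bil B h (Pi.single k 1) = app B h k := by
  rw [bil_eq_sum_app_mul hB]; simp [Pi.single_apply]

@[simp] theorem bil_zero_right {κ : Type*} [Fintype κ] (B : κ → κ → ℝ) (h : κ → ℝ) :
    bil B h 0 = 0 := by simp [bil]

theorem grad_eq : (fun I => P.grad I z) = vec P.δ (fun r => P.gx r z) (fun k => P.gy k z) := rfl

theorem Params.hasPD_Q (hA : ∀ i j, DifferentiableAt ℝ (A i j) z)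
    (hAs : ∀ i j, A i j z = A j i z) : HasPD dir (P.Q A) (P.Q' A z) z := by
  refine (HasPD.bil (P.hasPD_prin hA) (P.hasPD_grad z) (P.hasPD_grad z)).congr_val fun K => ?_
  rw [bil_comm (P.prin_comm hAs) (fun i => P.grad i z) (hessPsi K),
    bil_comm (P.prin_comm hAs) (hessPsi K), prin_eq, grad_eq]
  revert K
  refine forall_idx ?_ ?_ ?_
  · rw [prin'_zero, hessPsi_zero]
    simp only [bil_blk, Params.Q', bil_neg, bil_add, bil_smul, vec_zero, vec_succ, vec_inr, ← sq,
      bil_zero_right]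
    ring
  · intro r
    rw [prin'_succ, hessPsi_succ]
    simp only [bil_blk, Params.Q', bil_neg, bil_smul, vec_zero, vec_succ, vec_inr, ← sq,
      bil_zero_right, Pi.single_apply, mul_ite, mul_one, mul_zero, Finset.sum_ite_eq',
      Finset.mem_univ, if_true]
    ring
  · intro k
    rw [prin'_inr, hessPsi_inr]
    simp only [bil_blk, Params.Q', bil_neg, bil_smul, vec_zero, vec_succ, vec_inr, ← sq,
      Pi.zero_apply, mul_zero, Finset.sum_const_zero, bil_single_right hAs]
    ring

theorem Params.hasPD_τ (hA : ∀ i j, DifferentiableAt ℝ (A i j) z) :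
    HasPD dir (P.τ A) (P.τ' A z) z := by
  have hs := (P.hasPD_s z).mul (P.hasPD_s z)
  refine (hs.mul ((HasPD.const (p : ℝ)).sub
    (HasPD.sum fun i => HasPD.of_diff dir (hA i i)))).congr_val (forall_idx ?_ ?_ ?_)
  · simp only [vec_zero, Params.τ', dx]
    simp only [dir, Sum.elim_inl]; ring
  · intro r
    simp only [vec_succ, Params.τ', dx, Pi.zero_apply]
    simp only [dir, Sum.elim_inl]; ring
  · intro r
    simp only [vec_inr, Params.τ', dy, Pi.zero_apply]
    simp only [dir, Sum.elim_inr]; ring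

theorem hasPD_bigPhi (h : 0 < P.psi z) (hA : ∀ i j, DifferentiableAt ℝ (A i j) z)
    (hAs : ∀ i j, A i j z = A j i z) :
    HasPD dir (bigPhi P A lam) (fun K =>
      (-2 * (P.ν + 1) * P.w lam z ^ 2 / P.psi z
        + (P.ν + 1) * (P.ν + 2) * P.w lam z / P.psi z ^ 2) * P.Q A z * P.grad K z
      + (P.w lam z ^ 2 - (P.ν + 1) * P.w lam z / P.psi z) * P.Q' A z K
      - (P.ν + 1) * P.w lam z / P.psi z * P.τ A z * P.grad K z
      + P.w lam z * P.τ' A z K) z := by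
  have hw := P.hasPD_w (lam := lam) h
  have hi := (P.hasPD_psi z).div h.ne'
  -- The rational formula for `Φ` is available only where `ψ > 0`, hence on a neighbourhood of `z`.
  refine HasPD.congr_of_eventuallyEq ((((((hw.mul hw).sub ((HasPD.const (P.ν + 1)).mul
    (hw.mul hi))).mul (P.hasPD_Q hA hAs)).add (hw.mul (P.hasPD_τ hA)))).congr_val fun K => ?_)
    ((eventually_psi_pos h).mono fun v hv => bigPhi_eq hv)
  field_simp
  ring

/-- `C(∇ψ, ∇θ)` in terms of the gradient `h` of `θ`. -/
noncomputable def Params.N (P : Params p q)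
    (A : Fin (q + 1) → Fin (q + 1) → Pt (p + 1) (q + 1) → ℝ) (z : Pt (p + 1) (q + 1))
    (h : Idx p q → ℝ) : ℝ :=
  P.δ * h (.inl 0) + P.s z ^ 2 * (∑ r, P.gx r z * h (.inl r.succ))
    - P.s z ^ 2 * bil (fun i j => A i j z) (fun k => P.gy k z) (fun k => h (.inr k))

/-- `C(∇θ, ∇θ)` in terms of the gradient `h` of `θ`. -/
noncomputable def Params.S (P : Params p q)
    (A : Fin (q + 1) → Fin (q + 1) → Pt (p + 1) (q + 1) → ℝ) (z : Pt (p + 1) (q + 1))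
    (h : Idx p q → ℝ) : ℝ :=
  h (.inl 0) ^ 2 + P.s z ^ 2 * (∑ r : Fin p, h (.inl r.succ) ^ 2)
    - P.s z ^ 2 * bil (fun i j => A i j z) (fun k => h (.inr k)) (fun k => h (.inr k))

/-- `div (A ∇ψ)`. -/
noncomputable def Params.divA (P : Params p q)
    (A : Fin (q + 1) → Fin (q + 1) → Pt (p + 1) (q + 1) → ℝ) (z : Pt (p + 1) (q + 1)) : ℝ :=
  (∑ i, A i i z) + ∑ k, app (fun i j => dy k (A i j) z) (fun j => P.gy j z) k

/-- `s L₀ θ + Φ θ`. -/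
noncomputable def Params.Z (P : Params p q)
    (A : Fin (q + 1) → Fin (q + 1) → Pt (p + 1) (q + 1) → ℝ) (lam : ℝ)
    (θ : Pt (p + 1) (q + 1) → ℝ) (z : Pt (p + 1) (q + 1)) : ℝ :=
  dx 0 (dx 0 θ) z + P.s z ^ 2 * (∑ i : Fin p, dx i.succ (dx i.succ θ) z
    - ∑ i, ∑ j, A i j z * dy i (dy j θ) z) + bigPhi P A lam z * θ z

/-- The quadratic form in the gradient `h` of `θ` left over by the energy identity. -/
noncomputable def Params.gradForm (P : Params p q)
    (A : Fin (q + 1) → Fin (q + 1) → Pt (p + 1) (q + 1) → ℝ) (z : Pt (p + 1) (q + 1))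
    (h : Idx p q → ℝ) : ℝ :=
  2 * P.δ * (P.s z ^ 3)⁻¹ * h (.inl 0) ^ 2
    + 2 * h (.inl 0) * bil (fun i j => dx 0 (A i j) z) (fun k => P.gy k z) (fun k => h (.inr k))
    - P.δ * bil (fun i j => dx 0 (A i j) z) (fun k => h (.inr k)) (fun k => h (.inr k))
    + 2 * P.N A z h * (∑ k, app (fun i j => dy k (A i j) z) (fun j => h (.inr j)) k)
    + 2 * P.s z ^ 2 * (∑ r : Fin p, bil (fun i j => dx r.succ (A i j) z) (fun k => P.gy k z)
        (fun k => h (.inr k)) * h (.inl r.succ))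
    - 2 * P.s z ^ 2 * (∑ k, bil (fun i j => dy k (A i j) z) (fun k => P.gy k z)
        (fun k => h (.inr k)) * app (fun i j => A i j z) (fun j => h (.inr j)) k)
    - 2 * P.s z ^ 2 * (∑ r : Fin p, h (.inl r.succ) ^ 2)
    - 2 * P.s z ^ 2 * (∑ k, app (fun i j => A i j z) (fun j => h (.inr j)) k ^ 2)
    + (p - P.divA A z) * P.S A z h
    - P.s z ^ 2 * (∑ r : Fin p, bil (fun i j => dx r.succ (A i j) z) (fun k => h (.inr k))
        (fun k => h (.inr k)) * P.gx r z)
    + P.s z ^ 2 * (∑ k, bil (fun i j => dy k (A i j) z) (fun k => h (.inr k))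
        (fun k => h (.inr k)) * app (fun i j => A i j z) (fun j => P.gy j z) k)

/-- `C(∇ψ, v)` where `C` is the principal part of `s L₀`. -/
noncomputable def Params.CC (P : Params p q)
    (A : Fin (q + 1) → Fin (q + 1) → Pt (p + 1) (q + 1) → ℝ) (z : Pt (p + 1) (q + 1))
    (v : Idx p q → ℝ) : ℝ :=
  P.δ * v (.inl 0) + P.s z ^ 2 * (∑ r, P.gx r z * v (.inl r.succ))
    - P.s z ^ 2 * ∑ k, app (fun i j => A i j z) (fun j => P.gy j z) k * v (.inr k)

/-- The coefficient of `θ²` left over by the energy identity. -/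
noncomputable def Params.potForm (P : Params p q)
    (A : Fin (q + 1) → Fin (q + 1) → Pt (p + 1) (q + 1) → ℝ) (lam : ℝ)
    (z : Pt (p + 1) (q + 1)) : ℝ :=
  -((-2 * P.δ * (P.s z ^ 3)⁻¹ + p - P.divA A z) * bigPhi P A lam z
    + (P.s z ^ 2)⁻¹ * ((-2 * (P.ν + 1) * P.w lam z ^ 2 / P.psi z
        + (P.ν + 1) * (P.ν + 2) * P.w lam z / P.psi z ^ 2) * P.Q A z ^ 2
      + (P.w lam z ^ 2 - (P.ν + 1) * P.w lam z / P.psi z) * P.CC A z (P.Q' A z)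
      - (P.ν + 1) * P.w lam z / P.psi z * P.τ A z * P.Q A z
      + P.w lam z * P.CC A z (P.τ' A z)))

/-- The gradient of `θ`. -/
noncomputable def gradAt (θ : Pt (p + 1) (q + 1) → ℝ) (z : Pt (p + 1) (q + 1)) (I : Idx p q) : ℝ :=
  fderiv ℝ θ z (dir I)

@[simp] theorem gradAt_inl (θ : Pt (p + 1) (q + 1) → ℝ) (i : Fin (p + 1)) :
    gradAt θ z (.inl i) = dx i θ z := rfl

@[simp] theorem gradAt_inr (θ : Pt (p + 1) (q + 1) → ℝ) (i : Fin (q + 1)) :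
    gradAt θ z (.inr i) = dy i θ z := rfl

theorem N_eq (h : Idx p q → ℝ) :
    bil (fun I J => P.prin A I J z) (fun I => P.grad I z) h = P.N A z h := by
  simp only [prin_eq, grad_eq, bil_blk, vec_zero, vec_succ, vec_inr, bil_neg, bil_smul, Params.N]
  ring

theorem S_eq (h : Idx p q → ℝ) :
    bil (fun I J => P.prin A I J z) h h = P.S A z h := by
  simp only [prin_eq, bil_blk, bil_neg, bil_smul, Params.S, ← sq]
  ring

theorem CC_eq (v : Idx p q → ℝ) :
    ∑ K, app (fun I J => P.prin A I J z) (fun I => P.grad I z) K * v K = P.CC A z v := by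
  rw [sum_idx]
  simp only [prin_eq, grad_eq, app_blk_zero, app_blk_succ, app_blk_inr, vec_zero, vec_succ,
    vec_inr, app_neg, app_smul, Params.CC, Finset.mul_sum]
  rw [sub_eq_add_neg, ← Finset.sum_neg_distrib]
  congr 1
  · congr 1
    · ring
    · exact Finset.sum_congr rfl fun r _ => by ring
  · exact Finset.sum_congr rfl fun r _ => by ring

/-- The long list of flux terms is one energy flux `2N C∇θ - (C(∇θ,∇θ) - Φθ²)C∇ψ` with weight `2λν
s⁻²`, so the general divergence identity applies to it. -/
theorem flux₁_eq {v : Pt (p + 1) (q + 1)} (hs : 0 < P.s v) (hAs : ∀ i j, A i j v = A j i v)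
    (θ : Pt (p + 1) (q + 1) → ℝ) (K : Idx p q) :
    Sum.elim (flux₁x P A lam θ) (flux₁y P A lam θ) K v
      = 2 * lam * P.ν * (P.s v * P.s v)⁻¹ *
        (2 * bil (fun i j => P.prin A i j v) (fun i => P.grad i v) (fun i => gradAt θ v i)
            * app (fun i j => P.prin A i j v) (fun i => gradAt θ v i) K
          - app (fun i j => P.prin A i j v) (fun i => P.grad i v) K
            * (bil (fun i j => P.prin A i j v) (fun i => gradAt θ v i) (fun i => gradAt θ v i)
              - bigPhi P A lam v * (θ v * θ v))) := by
  rw [N_eq, S_eq, prin_eq, grad_eq, Params.N, Params.S]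
  have e1 : ∀ (g : Fin (q + 1) → ℝ) k, ∑ i, A i k v * g i = app (fun i j => A i j v) g k :=
    fun g k => Finset.sum_congr rfl fun i _ => by rw [hAs]
  have e2 : ∀ (g h : Fin (q + 1) → ℝ),
    ∑ i, ∑ j, A i j v * g i * h j = bil (fun i j => A i j v) g h := fun _ _ => rfl
  have hs' := hs.ne'
  revert K
  refine forall_idx ?_ ?_ ?_
  · simp only [Sum.elim_inl, flux₁x, Fin.cons_zero, app_blk_zero, vec_zero, gradAt_inl, gradAt_inr,
      bigPhi, Params.dx_succ_psi, Params.dy_psi, e2]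
    field_simp
    ring
  · intro r
    simp only [Sum.elim_inl, flux₁x, Fin.cons_succ, app_blk_succ, vec_succ, gradAt_inl, gradAt_inr,
      Params.dx_succ_psi, Params.dy_psi, e2]
    field_simp
    ring
  · intro k
    simp only [Sum.elim_inr, flux₁y, app_blk_inr, vec_inr, gradAt_inl, gradAt_inr,
      Params.dx_succ_psi, Params.dy_psi, e2, e1, app_neg, app_smul]
    field_simp
    ring

theorem sum_app_prin' (h : Idx p q → ℝ) : ∑ K, app (P.prin' A z K) h K
    = -(P.s z ^ 2) * ∑ k, app (fun i j => dy k (A i j) z) (fun j => h (.inr j)) k := by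
  rw [sum_idx]
  simp only [prin'_zero, prin'_succ, prin'_inr, app_blk_zero, app_blk_succ, app_blk_inr, zero_mul,
    Finset.sum_const_zero, zero_add, app_neg, app_smul, Finset.mul_sum, neg_mul]

theorem sum_app_hess :
    ∑ K, app (fun I J => P.prin A I J z) (hessPsi K) K
      = P.s z ^ 2 * (p - ∑ i, A i i z) := by
  rw [sum_idx]
  simp only [prin_eq, hessPsi_zero, hessPsi_succ, hessPsi_inr, app_blk_zero, app_blk_succ,
    app_blk_inr, vec_succ, vec_inr, app_neg, app_smul, Pi.zero_apply, Pi.single_eq_same]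
  simp [app, Pi.single_apply, ← Finset.mul_sum]
  ring

theorem sum_app_prin'_add :
    ∑ K, (app (P.prin' A z K) (fun I => P.grad I z) K
      + app (fun I J => P.prin A I J z) (hessPsi K) K) = P.s z ^ 2 * (p - P.divA A z) := by
  rw [Finset.sum_add_distrib, sum_app_prin', sum_app_hess, Params.divA]
  simp only [Params.grad, vec_inr]
  ring

theorem sum_bil_prin'_mul_app (h : Idx p q → ℝ) :
    ∑ K, bil (P.prin' A z K) (fun I => P.grad I z) h * app (fun I J => P.prin A I J z) h K
      = (2 * P.s z * ((∑ r, P.gx r z * h (.inl r.succ))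
            - bil (fun i j => A i j z) (fun k => P.gy k z) (fun k => h (.inr k)))
          - P.s z ^ 2
            * bil (fun i j => dx 0 (A i j) z) (fun k => P.gy k z) (fun k => h (.inr k)))
          * h (.inl 0)
        - P.s z ^ 4 * (∑ r : Fin p, bil (fun i j => dx r.succ (A i j) z) (fun k => P.gy k z)
          (fun k => h (.inr k)) * h (.inl r.succ))
        + P.s z ^ 4 * (∑ k, bil (fun i j => dy k (A i j) z) (fun k => P.gy k z)
          (fun k => h (.inr k)) * app (fun i j => A i j z) (fun j => h (.inr j)) k) := by
  rw [sum_idx]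
  simp only [prin'_zero, prin'_succ, prin'_inr, bil_blk, prin_eq, grad_eq, app_blk_zero,
    app_blk_succ, app_blk_inr, vec_zero, vec_succ, vec_inr, bil_neg, bil_add, bil_smul, app_neg,
    app_smul, zero_mul, Finset.sum_const_zero, zero_add, Finset.mul_sum, sub_eq_add_neg, ← Finset.sum_neg_distrib]
  congr 1
  · congr 1
    · simp only [← Finset.mul_sum]
      ring
    · exact Finset.sum_congr rfl fun r _ => by ring
  · exact Finset.sum_congr rfl fun r _ => by ring

theorem sum_app_mul_bil_prin' (h : Idx p q → ℝ) :
    ∑ K, app (fun I J => P.prin A I J z) (fun I => P.grad I z) K * bil (P.prin' A z K) h h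
      = P.δ * (2 * P.s z * ((∑ r : Fin p, h (.inl r.succ) ^ 2)
            - bil (fun i j => A i j z) (fun k => h (.inr k)) (fun k => h (.inr k)))
          - P.s z ^ 2
            * bil (fun i j => dx 0 (A i j) z) (fun k => h (.inr k)) (fun k => h (.inr k)))
        - P.s z ^ 4 * (∑ r : Fin p, bil (fun i j => dx r.succ (A i j) z) (fun k => h (.inr k))
          (fun k => h (.inr k)) * P.gx r z)
        + P.s z ^ 4 * (∑ k, bil (fun i j => dy k (A i j) z) (fun k => h (.inr k))
          (fun k => h (.inr k)) * app (fun i j => A i j z) (fun j => P.gy j z) k) := by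
  rw [sum_idx]
  simp only [prin'_zero, prin'_succ, prin'_inr, bil_blk, prin_eq, grad_eq, app_blk_zero,
    app_blk_succ, app_blk_inr, vec_zero, vec_succ, vec_inr, bil_neg, bil_add, bil_smul, app_neg,
    app_smul, zero_mul, Finset.sum_const_zero, zero_add, Finset.mul_sum, sub_eq_add_neg, 
    ← Finset.sum_neg_distrib, ← sq]
  congr 1
  · congr 1
    · simp only [← Finset.mul_sum]
      ring
    · exact Finset.sum_congr rfl fun r _ => by ring
  · exact Finset.sum_congr rfl fun r _ => by ring

theorem sum_bil_hess_mul_app (hA : ∀ i j, A i j z = A j i z) (h : Idx p q → ℝ) :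
    ∑ K, bil (fun I J => P.prin A I J z) (hessPsi K) h * app (fun I J => P.prin A I J z) h K
      = P.s z ^ 4 * (∑ r : Fin p, h (.inl r.succ) ^ 2)
        + P.s z ^ 4 * (∑ k, app (fun i j => A i j z) (fun j => h (.inr j)) k ^ 2) := by
  simp only [bil_comm (P.prin_comm hA) (hessPsi _) h]
  rw [sum_idx]
  simp only [prin_eq, hessPsi_zero, hessPsi_succ, hessPsi_inr, bil_blk, app_blk_zero, app_blk_succ,
    app_blk_inr, vec_zero, vec_succ, vec_inr, bil_neg, bil_smul, app_neg, app_smul, bil_zero_right,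
    bil_single_right (B := fun i j => A i j z) hA]
  simp only [Pi.single_apply, mul_ite, mul_one, mul_zero, Finset.sum_ite_eq', Finset.mem_univ,
    if_true, Pi.zero_apply, Finset.sum_const_zero, zero_mul, add_zero, zero_add,
    Finset.mul_sum]
  congr 1
  · exact Finset.sum_congr rfl fun r _ => by ring
  · exact Finset.sum_congr rfl fun r _ => by ring

theorem CC_add (u v : Idx p q → ℝ) :
    P.CC A z (fun K => u K + v K) = P.CC A z u + P.CC A z v := by
  simp only [← CC_eq, mul_add, Finset.sum_add_distrib]

theorem CC_smul (c : ℝ) (u : Idx p q → ℝ) :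
    P.CC A z (fun K => c * u K) = c * P.CC A z u := by
  simp only [← CC_eq, Finset.mul_sum]
  exact Finset.sum_congr rfl fun r _ => by ring

theorem CC_grad : P.CC A z (fun I => P.grad I z) = P.Q A z := by
  rw [← CC_eq, Params.Q, bil_eq_sum_mul_app]
  exact Finset.sum_congr rfl fun r _ => by ring

theorem CC_gradPhi (a b c d : ℝ) : P.CC A z (fun K => a * P.grad K z + b * P.Q' A z K
    - c * P.grad K z + d * P.τ' A z K)
    = (a - c) * P.Q A z + b * P.CC A z (P.Q' A z) + d * P.CC A z (P.τ' A z) := by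
  have : (fun K => a * P.grad K z + b * P.Q' A z K - c * P.grad K z + d * P.τ' A z K)
      = fun K => (a - c) * P.grad K z + (b * P.Q' A z K + d * P.τ' A z K) := by
    funext K; ring
  rw [this, CC_add, CC_add (fun K => b * P.Q' A z K), CC_smul, CC_smul, CC_smul, CC_grad]
  ring

theorem sum_prin_mul_hess (θ : Pt (p + 1) (q + 1) → ℝ) :
    ∑ K, ∑ L, P.prin A K L z * fderiv ℝ (fun w => fderiv ℝ θ w (dir L)) z (dir K)
      = dx 0 (dx 0 θ) z + P.s z ^ 2 * (∑ i : Fin p, dx i.succ (dx i.succ θ) z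
          - ∑ i, ∑ j, A i j z * dy i (dy j θ) z) := by
  simp only [Params.prin, sum_blk_mul (H := fun K L =>
    fderiv ℝ (fun w => fderiv ℝ θ w (dir L)) z (dir K)), neg_mul, mul_assoc, Finset.sum_neg_distrib,
    ← Finset.mul_sum]
  simp only [dir, Sum.elim_inl, Sum.elim_inr,
    show dx (n := p + 1) (m := q + 1) = fun i f z => fderiv ℝ f z (Pi.single i 1, 0) from rfl,
    show dy (n := p + 1) (m := q + 1) = fun i f z => fderiv ℝ f z (0, Pi.single i 1) from rfl]
  ring

/-- The weight `s⁻²` compensates the factor `s²` in the tangential blocks of `C`: the terms in which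
`∂/∂x₁` falls on `s⁻²` and on `s²` cancel, and only `2δs⁻³θ_{x₁}²` survives in the gradient form,
with the favourable sign. -/
theorem D₁_eq (hs : 0 < P.s z) (hψ : 0 < P.psi z) (hA : ∀ i j, DifferentiableAt ℝ (A i j) z)
    (hAs : ∀ i j v, A i j v = A j i v) {θ : Pt (p + 1) (q + 1) → ℝ} (hθ : ContDiffAt ℝ 2 θ z) :
    D₁ P A lam θ z = 2 * lam * P.ν * (2 * (P.s z ^ 2)⁻¹ * P.N A z (gradAt θ z) * P.Z A lam θ z
      - P.gradForm A z (gradAt θ z) - P.potForm A lam z * θ z ^ 2) := by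
  have hs2 := (P.hasPD_s z).mul (P.hasPD_s z)
  have hσ := (HasPD.const (e := dir) (z := z) (2 * lam * P.ν)).mul
    (hs2.div (mul_pos hs hs).ne')
  have hss : ∀ i j, fderiv ℝ (fun w => fderiv ℝ θ w (dir j)) z (dir i)
      = fderiv ℝ (fun w => fderiv ℝ θ w (dir i)) z (dir j) :=
    fun i j => fderiv_fderiv_comm hθ _ _
  have key := sum_fderiv_energy_flux (P.hasPD_prin hA) (P.hasPD_grad z)
    (fun I => hasPD_fderiv hθ I) hσ (hasPD_bigPhi (lam := lam) hψ hA (fun i j => hAs i j z))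
    (HasPD.of_diff dir (hθ.differentiableAt (by norm_num)))
    (P.prin_comm fun i j => hAs i j z) (h' := fun K I => fderiv ℝ (fun w => fderiv ℝ θ w (dir I)) z (dir K)) hss
  -- The two forms of the flux agree only where `s > 0`, which is enough for equality of derivatives
  -- at `z`.
  have flux : ∀ K, (fun v => Sum.elim (flux₁x P A lam θ) (flux₁y P A lam θ) K v) =ᶠ[nhds z] _ :=
    fun K => (eventually_s_pos hs).mono fun v hv => flux₁_eq hv (fun i j => hAs i j v) θ K
  rw [D₁, divergence_eq_sum]
  refine ((Finset.sum_congr rfl fun K _ => ?_).trans key).trans ?_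
  · exact DFunLike.congr_fun (flux K).fderiv_eq (dir K)
  -- Contracts the eta-expanded gradient of `θ` to `gradAt θ z`, so that the evaluation lemmas for
  -- `C` can rewrite.
  change _ * bil _ _ (gradAt θ z) * _ + (∑ K, _ * (_ * bil _ _ (gradAt θ z)
      * app _ (gradAt θ z) K - _ * (bil _ (gradAt θ z) (gradAt θ z) - _)))
    + _ * (_ * bil _ _ (gradAt θ z) * (∑ K, app _ (gradAt θ z) K)
    + _ * (∑ K, bil _ _ (gradAt θ z) * app _ (gradAt θ z) K)
    + _ * (∑ K, bil _ _ (gradAt θ z) * app _ (gradAt θ z) K)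
    - _ * (bil _ (gradAt θ z) (gradAt θ z) - _)
    - (∑ K, _ * bil _ (gradAt θ z) (gradAt θ z)) + _) = _
  rw [N_eq, S_eq, sum_prin_mul_hess, sum_app_prin', sum_app_prin'_add,
    sum_bil_prin'_mul_app, sum_app_mul_bil_prin', sum_bil_hess_mul_app (fun i j => hAs i j z), CC_eq]
  have hs' := hs.ne'
  simp only [CC_gradPhi]
  rw [sum_idx]
  simp only [prin_eq, grad_eq, app_blk_zero, vec_zero, vec_succ, vec_inr, Pi.zero_apply,
    Params.Z, Params.gradForm, Params.potForm, mul_zero, zero_mul, add_zero,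
    Finset.sum_const_zero]
  simp only [Params.N, Params.S, Params.Q]
  field_simp
  ring

end UltraCarleman

/-! ### The divergences `D₂` and `D₃`, and conjugation by the weight -/

namespace UltraCarleman

variable {p q : ℕ} {P : Params p q} {z : Pt (p + 1) (q + 1)} {lam : ℝ}
  {A : Fin (q + 1) → Fin (q + 1) → Pt (p + 1) (q + 1) → ℝ}

theorem HasPD.vec {a : Pt (p + 1) (q + 1) → ℝ} {x : Fin p → Pt (p + 1) (q + 1) → ℝ}
    {y : Fin (q + 1) → Pt (p + 1) (q + 1) → ℝ} {a' : Idx p q → ℝ} {x' : Idx p q → Fin p → ℝ}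
    {y' : Idx p q → Fin (q + 1) → ℝ}
    (ha : HasPD dir a a' z) (hx : ∀ r, HasPD dir (x r) (fun K => x' K r) z)
    (hy : ∀ k, HasPD dir (y k) (fun K => y' K k) z) (I : Idx p q) :
    HasPD dir (fun v => UltraCarleman.vec (a v) (fun r => x r v) (fun k => y k v) I)
      (fun K => UltraCarleman.vec (a' K) (x' K) (y' K) I) z := by
  revert I
  exact forall_idx ha hx hy

theorem Params.hasPD_gx (r : Fin p) :
    HasPD dir (P.gx r) (fun K => hessPsi K (.inl r.succ)) z := P.hasPD_grad z (.inl r.succ)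

theorem Params.hasPD_gy (k : Fin (q + 1)) :
    HasPD dir (P.gy k) (fun K => hessPsi K (.inr k)) z := P.hasPD_grad z (.inr k)

/-- The coefficients `-δs⁻³`, `(β-1)s²`, `-½δα₁s` are those with which the squares of the `x₁`, `'x`
and `y` derivatives of `θ` are exchanged for those of `φ` in `carleman_of_nonneg`; the cross terms
produced there are exactly the ones in this formula. -/
theorem D₂_eq (hs : 0 < P.s z) (hψ : 0 < P.psi z) (α₁ β : ℝ)
    {θ : Pt (p + 1) (q + 1) → ℝ} (hθ : DifferentiableAt ℝ θ z) :
    D₂ P lam α₁ β θ z = 2 * lam * P.ν *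
      ((P.w lam z * (3 * P.δ ^ 2 * (P.s z ^ 4)⁻¹ + (β - 1) * P.s z ^ 2 * p
          - 1 / 2 * P.δ * α₁ * P.s z * (q + 1))
        - (P.ν + 1) * P.w lam z / P.psi z * (-P.δ ^ 3 * (P.s z ^ 3)⁻¹
          + (β - 1) * P.s z ^ 2 * (∑ r, P.gx r z ^ 2)
          - 1 / 2 * P.δ * α₁ * P.s z * ∑ k, P.gy k z ^ 2)) * θ z ^ 2
      + 2 * P.w lam z * θ z * (-P.δ ^ 2 * (P.s z ^ 3)⁻¹ * dx 0 θ z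
          + (β - 1) * P.s z ^ 2 * (∑ r, P.gx r z * dx r.succ θ z)
          - 1 / 2 * P.δ * α₁ * P.s z * ∑ k, P.gy k z * dy k θ z)) := by
  have hs1 := P.hasPD_s z
  have hs2 := hs1.mul hs1
  have hs3 := (hs1.mul hs2).div (mul_pos hs (mul_pos hs hs)).ne'
  have hV := HasPD.vec ((HasPD.const (2 * lam * P.ν * -P.δ ^ 2)).mul hs3)
    (fun r => (((HasPD.const (2 * lam * P.ν * (β - 1))).mul hs2).mul (P.hasPD_gx (z := z) r)))
    (fun k => (((HasPD.const (2 * lam * P.ν * (-(1 / 2) * P.δ * α₁))).mul hs1).mul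
      (P.hasPD_gy (z := z) k)))
  have key := sum_fderiv_lower_order_flux hV (HasPD.of_diff dir hθ) (h := fun K v => gradAt θ v K)
    (P.hasPD_w (lam := lam) hψ)
  rw [D₂, divergence_eq_sum]
  refine ((Finset.sum_congr rfl fun K hK => ?_).trans key).trans ?_
  · clear hK
    refine DFunLike.congr_fun (congrArg (fun f => fderiv ℝ f z) ?_) (dir K)
    funext v
    revert K
    refine forall_idx ?_ ?_ ?_
    · simp only [Sum.elim_inl, Fin.cons_zero, vec_zero, Params.w]; ring
    · intro r
      simp only [Sum.elim_inl, Fin.cons_succ, vec_succ, Params.w, Params.dx_succ_psi]; ring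
    · intro k
      simp only [Sum.elim_inr, vec_inr, Params.w, Params.dy_psi]; ring
  · simp only [sum_idx, vec_zero, vec_succ, vec_inr, hessPsi_succ, hessPsi_inr, Pi.zero_apply,
      Pi.single_eq_same, Params.grad, gradAt_inl, gradAt_inr, mul_zero, zero_mul, zero_add, add_zero,
      mul_one, Finset.sum_const, Finset.card_univ, Fintype.card_fin, nsmul_eq_mul, mul_assoc,
      ← Finset.mul_sum, ← sq]
    push_cast
    field_simp
    ring

theorem sum_divA_mul (hAs : ∀ i j v, A i j v = A j i v) (g : Fin (q + 1) → ℝ) :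
    ∑ k, (∑ j, dy j (A k j) z) * g k = ∑ k, app (fun i j => dy k (A i j) z) g k := by
  simp only [app, Finset.sum_mul]
  rw [Finset.sum_comm]
  refine Finset.sum_congr rfl fun i _ => Finset.sum_congr rfl fun j _ => ?_
  rw [show A j i = A i j from funext (hAs j i)]

theorem fderiv_fun_neg_apply {E : Type*} [NormedAddCommGroup E] [NormedSpace ℝ E] (f : E → ℝ)
    (z v : E) : fderiv ℝ (fun w => -f w) z v = -fderiv ℝ f z v := by
  rw [fderiv_fun_neg]; rfl

theorem s_mul_L₀ (hs : 0 < P.s z) (φ : Pt (p + 1) (q + 1) → ℝ) :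
    P.s z * P.L₀ A φ z
      = ∑ K, ∑ L, P.prin A K L z * fderiv ℝ (fun w => fderiv ℝ φ w (dir L)) z (dir K) := by
  have := hs.ne'
  rw [sum_prin_mul_hess, Params.L₀]
  field_simp

/-- Multiplication of `s L₀φ` by `φχ²` and the product rule. The outcome contains `C(∇φ,∇φ)`, with
`φ` in place of `θ`, and therefore feeds the estimate with `χ²|∇_{'x}φ|²` directly. -/
theorem D₃_eq (hs : 0 < P.s z) (hψ : 0 < P.psi z) (hA : ∀ i j, ContDiffAt ℝ 2 (A i j) z)
    (hAs : ∀ i j v, A i j v = A j i v) {φ : Pt (p + 1) (q + 1) → ℝ} (hφ : ContDiffAt ℝ 2 φ z) :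
    D₃ P A lam φ z = -(P.chi lam z ^ 2 * (φ z * (P.s z * P.L₀ A φ z) + P.S A z (gradAt φ z))
        + (P.chi lam z * φ z) ^ 2 *
          (1 / 2 * P.s z ^ 2 * (∑ k, ∑ j, dy k (dy j (A k j)) z)
            - P.w lam z * P.s z ^ 2 * (∑ k, app (fun i j => dy k (A i j) z) (fun j => P.gy j z) k)
            + P.w lam z * (P.s z ^ 2 * (p - P.divA A z))
            - ((P.ν + 1) * P.w lam z / P.psi z + 2 * P.w lam z ^ 2) * P.Q A z)) := by
  have hA1 : ∀ i j, DifferentiableAt ℝ (A i j) z := fun i j =>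
    (hA i j).differentiableAt (by norm_num)
  have hs2 := (P.hasPD_s z).mul (P.hasPD_s z)
  have hc := HasPD.vec (HasPD.const (e := dir) (z := z) 0)
    (fun _ : Fin p => HasPD.const (e := dir) (z := z) 0)
    (fun k => (hs2.mul (HasPD.sum fun j => hasPD_fderiv (hA k j) (.inr j))).neg)
  -- Only the `y` block of `C` has a row divergence: the `x₁` entry is constant and `s²` is not
  -- differentiated in its own directions `x_r`.
  have hcC : ∀ u : Idx p q → ℝ, ∑ K, vec 0 (fun _ : Fin p => (0 : ℝ))
      (fun k => -(P.s z * P.s z * ∑ j, fderiv ℝ (A k j) z (dir (.inr j)))) K * u K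
      = ∑ K, app (P.prin' A z K) u K := by
    intro u
    rw [sum_app_prin', ← sum_divA_mul hAs, sum_idx]
    simp only [vec_zero, vec_succ, vec_inr, zero_mul, Finset.sum_const_zero, zero_add,
      Finset.mul_sum]
    refine Finset.sum_congr rfl fun k _ => ?_
    rw [← Finset.mul_sum]
    simp only [dy, dir, Sum.elim_inr]
    ring
  have key := sum_fderiv_multiplier_flux (P.hasPD_prin hA1) hc (P.hasPD_grad z)
    (fun I => hasPD_fderiv hφ I) (HasPD.of_diff dir (hφ.differentiableAt (by norm_num)))
    (P.hasPD_chi (lam := lam) hψ) (P.hasPD_w (lam := lam) hψ)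
    (P.prin_comm fun i j => hAs i j z) (hcC _)
  rw [D₃, divergence_eq_sum]
  refine ((Finset.sum_congr rfl fun K hK => ?_).trans
    ((Finset.sum_neg_distrib _).trans (congrArg Neg.neg key))).trans ?_
  · clear hK
    refine Eq.trans (DFunLike.congr_fun (congrArg (fun f => fderiv ℝ f z) ?_) (dir K))
      (fderiv_fun_neg_apply _ _ _)
    funext v
    revert K
    refine forall_idx ?_ ?_ ?_
    · simp only [Sum.elim_inl, Fin.cons_zero, prin_eq, grad_eq, app_blk_zero, vec_zero, Params.w, dx]
      simp only [dir, Sum.elim_inl]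
      ring
    · intro r
      simp only [Sum.elim_inl, Fin.cons_succ, prin_eq, grad_eq, app_blk_succ, vec_succ, Params.w,
        Params.dx_succ_psi]
      simp only [dir, Sum.elim_inl, dx]
      ring
    · intro k
      simp only [Sum.elim_inr, prin_eq, grad_eq, app_blk_inr, vec_inr, Params.w, Params.dy_psi, app_neg,
        app_smul]
      simp only [dir, Sum.elim_inr, app, dy, Finset.sum_sub_distrib, mul_add, Finset.sum_add_distrib]
      have e1 : ∑ j, A k j v * (fderiv ℝ φ v (0, Pi.single j 1) * φ v)
          = φ v * ∑ j, A k j v * fderiv ℝ φ v (0, Pi.single j 1) := by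
        rw [Finset.mul_sum]; exact Finset.sum_congr rfl fun j _ => by ring
      have e2 : ∑ j, A k j v * (lam * P.ν * P.gy j v * P.psi v ^ (-P.ν - 1) * φ v ^ 2)
          = lam * P.ν * P.psi v ^ (-P.ν - 1) * φ v ^ 2 * ∑ j, A k j v * P.gy j v := by
        rw [Finset.mul_sum]; exact Finset.sum_congr rfl fun j _ => by ring
      have e3 : ∑ j, 1 / 2 * fderiv ℝ (A k j) v (0, Pi.single j 1) * φ v ^ 2
          = 1 / 2 * φ v ^ 2 * ∑ j, fderiv ℝ (A k j) v (0, Pi.single j 1) := by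
        rw [Finset.mul_sum]; exact Finset.sum_congr rfl fun j _ => by ring
      rw [e1, e2, e3]
      ring
  · rw [hcC, sum_app_prin'_add, ← s_mul_L₀ hs, sum_app_prin', sum_idx]
    change -(_ * (_ + bil _ (gradAt φ z) (gradAt φ z)) + _ * (_ + _ + _ + _ * P.Q A z)) = _
    rw [S_eq]
    simp only [vec_zero, vec_succ, vec_inr, Pi.zero_apply, Finset.sum_const_zero, mul_zero, zero_mul,
      zero_add, Finset.sum_neg_distrib, ← Finset.mul_sum, Params.grad]
    rw [show ∑ k, ∑ j, fderiv ℝ (fun w => fderiv ℝ (A k j) w (dir (.inr j))) z (dir (.inr k))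
      = ∑ k, ∑ j, dy k (dy j (A k j)) z from rfl]
    ring

theorem gradAt_chi_mul (hψ : 0 < P.psi z) {φ : Pt (p + 1) (q + 1) → ℝ}
    (hφ : DifferentiableAt ℝ φ z) (K : Idx p q) :
    gradAt (fun v => P.chi lam v * φ v) z K
      = P.chi lam z * (gradAt φ z K - P.w lam z * P.grad K z * φ z) := by
  rw [gradAt, ((P.hasPD_chi hψ).mul (HasPD.of_diff dir hφ)).eq, gradAt]
  ring

theorem contDiffAt_chi (hψ : 0 < P.psi z) : ContDiffAt ℝ 2 (P.chi lam) z := by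
  have h : ContDiff ℝ 2 P.psi := by
    have : P.psi = fun z : Pt (p + 1) (q + 1) => P.δ * z.1 0
        + 1 / 2 * ∑ i : Fin p, (z.1 i.succ - P.x₀ i) ^ 2
        + 1 / 2 * ∑ j : Fin q, (z.2 j.castSucc - P.y₀ j) ^ 2 + 1 / 2 * z.2 (Fin.last q) ^ 2
        + P.α₀ := rfl
    rw [this]
    fun_prop
  exact Real.contDiff_exp.contDiffAt.comp z
    (contDiffAt_const.mul (h.contDiffAt.rpow_const_of_ne hψ.ne'))

theorem sum_conj_hess {ι : Type*} [Fintype ι] {C : ι → ι → ℝ} (hC : ∀ i j, C i j = C j i)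
    (H H' : ι → ι → ℝ) (g u : ι → ℝ) (c w m n : ℝ) :
    ∑ K, ∑ L, C K L * (c * (H K L - w * g K * u L - w * g L * u K + m * (g K * g L) - n * H' K L))
      = c * ((∑ K, ∑ L, C K L * H K L) - 2 * w * bil C g u + m * bil C g g
        - n * ∑ K, ∑ L, C K L * H' K L) := by
  have e : 2 * w * bil C g u = w * bil C g u + w * bil C u g := by rw [bil_comm hC u g]; ring
  rw [e]
  simp only [bil, Finset.mul_sum, ← Finset.sum_add_distrib, ← Finset.sum_sub_distrib]
  exact Finset.sum_congr rfl fun i _ => Finset.sum_congr rfl fun j _ => by ring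

/-- Conjugation of `s L₀` by `χ`: the terms of even order in `∇` and the potential form `Z`, and the
first order part is `2wN`. Everything rests on `∇χ = -wχ∇ψ`, applied once for the gradient and once
more for the Hessian. -/
theorem Z_chi_mul (hψ : 0 < P.psi z) (hs : 0 < P.s z) (hAs : ∀ i j, A i j z = A j i z)
    {φ : Pt (p + 1) (q + 1) → ℝ} (hφ : ContDiffAt ℝ 2 φ z) :
    P.Z A lam (fun v => P.chi lam v * φ v) z
        + 2 * P.w lam z * P.N A z (gradAt (fun v => P.chi lam v * φ v) z)
      = P.chi lam z * (P.s z * P.L₀ A φ z) := by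
  have hφ1 := hφ.differentiableAt (by norm_num)
  have h2 : ∀ K L, fderiv ℝ (fun v => gradAt (fun v => P.chi lam v * φ v) v L) z (dir K)
      = P.chi lam z * (fderiv ℝ (fun v => fderiv ℝ φ v (dir L)) z (dir K)
        - P.w lam z * P.grad K z * gradAt φ z L - P.w lam z * P.grad L z * gradAt φ z K
        + (P.w lam z ^ 2 + (P.ν + 1) * P.w lam z / P.psi z) * φ z * (P.grad K z * P.grad L z)
        - P.w lam z * φ z * hessPsi K L) := by
    intro K L
    have h3 : (fun v => gradAt (fun v => P.chi lam v * φ v) v L) =ᶠ[nhds z] fun v =>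
        P.chi lam v * (fderiv ℝ φ v (dir L) - P.w lam v * P.grad L v * φ v) := by
      filter_upwards [eventually_psi_pos hψ, hφ.eventually (by simp)] with v hv hv'
      exact gradAt_chi_mul hv (hv'.differentiableAt (by norm_num)) L
    rw [h3.fderiv_eq, ((P.hasPD_chi hψ).mul ((hasPD_fderiv hφ L).sub
      (((P.hasPD_w hψ).mul (P.hasPD_grad z L)).mul (HasPD.of_diff dir hφ1)))).eq]
    simp only [gradAt]
    ring
  have e1 := sum_prin_mul_hess (P := P) (A := A) (z := z) (fun v => P.chi lam v * φ v)
  have e2 : P.N A z (gradAt (fun v => P.chi lam v * φ v) z)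
      = P.chi lam z * (P.N A z (gradAt φ z) - P.w lam z * φ z * P.Q A z) := by
    rw [← N_eq, ← N_eq, Params.Q]
    simp only [bil, Finset.mul_sum, ← Finset.sum_sub_distrib, gradAt_chi_mul hψ hφ1]
    exact Finset.sum_congr rfl fun i _ => Finset.sum_congr rfl fun j _ => by ring
  have e3 : ∑ K, ∑ L, P.prin A K L z * hessPsi K L = P.τ A z := by
    rw [Params.τ, ← sq]; exact sum_app_hess
  rw [Params.Z, ← e1, s_mul_L₀ hs, e2, bigPhi_eq hψ]
  change (∑ K, ∑ L, _ * fderiv ℝ (fun v => gradAt _ v L) z (dir K)) + _ + _ = _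
  simp only [h2]
  rw [sum_conj_hess (P.prin_comm hAs), e3]
  change P.chi lam z * (_ - _ * bil _ _ (gradAt φ z) + _ * P.Q A z - _) + _ + _ = _
  rw [N_eq]
  ring

end UltraCarleman

/-! ### Reduction to three algebraic inequalities -/

namespace UltraCarleman

variable {p q : ℕ} {P : Params p q} {z : Pt (p + 1) (q + 1)} {lam : ℝ}
  {A : Fin (q + 1) → Fin (q + 1) → Pt (p + 1) (q + 1) → ℝ}

/-- The coefficient of `θ²` in the difference of the two sides of the Carleman estimate, up to a
factor `2 λ ν`. -/
noncomputable def Params.potTotal (P : Params p q)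
    (A : Fin (q + 1) → Fin (q + 1) → Pt (p + 1) (q + 1) → ℝ) (lam α₁ β : ℝ)
    (z : Pt (p + 1) (q + 1)) : ℝ :=
  P.potForm A lam z
    - (P.w lam z * (3 * P.δ ^ 2 * (P.s z ^ 4)⁻¹ + (β - 1) * P.s z ^ 2 * p
          - 1 / 2 * P.δ * α₁ * P.s z * (q + 1))
        - (P.ν + 1) * P.w lam z / P.psi z * (-P.δ ^ 3 * (P.s z ^ 3)⁻¹
          + (β - 1) * P.s z ^ 2 * (∑ r, P.gx r z ^ 2)
          - 1 / 2 * P.δ * α₁ * P.s z * ∑ k, P.gy k z ^ 2))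
    + β * (1 / 2 * P.s z ^ 2 * (∑ k, ∑ j, dy k (dy j (A k j)) z)
            - P.w lam z * P.s z ^ 2 * (∑ k, app (fun i j => dy k (A i j) z) (fun j => P.gy j z) k)
            + P.w lam z * (P.s z ^ 2 * (p - P.divA A z))
            - ((P.ν + 1) * P.w lam z / P.psi z + 2 * P.w lam z ^ 2) * P.Q A z)
    - P.w lam z ^ 2 * P.δ ^ 3 * (P.s z ^ 3)⁻¹
    + P.w lam z ^ 2 * (β - 1) * P.s z ^ 2 * (∑ r, P.gx r z ^ 2)
    - 1 / 2 * P.δ * α₁ * P.s z * P.w lam z ^ 2 * (∑ k, P.gy k z ^ 2)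
    - 1 / 2 * P.ν * P.δ ^ 4 * P.w lam z ^ 2 / P.psi z

/-- Applied with `u = ∇φ`, `g = ∇ψ`, `h = ∇(χφ)`, `c = χ`, `t = χwφ`, separately in the `'x` and the
`y` variables. -/
theorem sum_sq_shift {κ : Type*} [Fintype κ] (u g h : κ → ℝ) (c t : ℝ)
    (hu : ∀ k, h k = c * u k - t * g k) :
    c ^ 2 * ∑ k, u k ^ 2 = (∑ k, h k ^ 2) + 2 * t * (∑ k, g k * h k) + t ^ 2 * ∑ k, g k ^ 2 := by
  simp only [Finset.mul_sum, ← Finset.sum_add_distrib, hu]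
  exact Finset.sum_congr rfl fun k _ => by ring

/-- The Carleman estimate at a point, reduced to the nonnegativity of the three algebraic
remainders. -/
theorem carleman_of_nonneg (hs : 0 < P.s z) (hψ : 0 < P.psi z) (hν : 0 < P.ν) (hlam : 0 < lam)
    (hA : ∀ i j, ContDiffAt ℝ 2 (A i j) z) (hAs : ∀ i j v, A i j v = A j i v)
    {φ : Pt (p + 1) (q + 1) → ℝ} (hφ : ContDiffAt ℝ 2 φ z) {α₁ β : ℝ} (hβ : 0 ≤ β)
    (hG : ∀ h : Idx p q → ℝ, 1 / 2 * P.δ * α₁ * P.s z * (∑ k, h (.inr k) ^ 2)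
      ≤ P.gradForm A z h - P.δ * (P.s z ^ 3)⁻¹ * h (.inl 0) ^ 2
        + (β - 1) * P.s z ^ 2 * ∑ r : Fin p, h (.inl r.succ) ^ 2)
    (hY : ∀ u : Fin (q + 1) → ℝ, P.s z * (∑ k, u k ^ 2)
        + β * P.s z ^ 2 * bil (fun i j => A i j z) u u
      ≤ 1 / 2 * P.δ * α₁ * P.s z * ∑ k, u k ^ 2)
    (hP : 0 ≤ P.potTotal A lam α₁ β z) :
    2 * lam * P.ν * P.δ * (P.s z ^ 3)⁻¹ * dx 0 φ z ^ 2 * P.chi lam z ^ 2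
      + 2 * lam * P.ν * P.s z ^ 2 * (∑ i : Fin p, dx i.succ φ z ^ 2) * P.chi lam z ^ 2
      + 2 * lam * P.ν * P.s z * (∑ j, dy j φ z ^ 2) * P.chi lam z ^ 2
      + lam ^ 3 * P.ν ^ 4 * P.δ ^ 4 * P.psi z ^ (-2 * P.ν - 3) * φ z ^ 2 * P.chi lam z ^ 2
      + (D₁ P A lam (fun w => P.chi lam w * φ w) z
        + D₂ P lam α₁ β (fun w => P.chi lam w * φ w) z + 2 * lam * P.ν * β * D₃ P A lam φ z)
    ≤ P.psi z ^ (P.ν + 1) * P.L₀ A φ z ^ 2 * P.chi lam z ^ 2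
      - 2 * lam * P.ν * β * φ z * P.s z * P.L₀ A φ z * P.chi lam z ^ 2 := by
  have hφ1 := hφ.differentiableAt (by norm_num)
  have hθ : ContDiffAt ℝ 2 (fun v => P.chi lam v * φ v) z := (contDiffAt_chi hψ).mul hφ
  have hg := gradAt_chi_mul (P := P) (lam := lam) hψ hφ1
  have hZ := Z_chi_mul (P := P) (lam := lam) hψ hs (fun i j => hAs i j z) hφ
  rw [D₁_eq hs hψ (fun i j => (hA i j).differentiableAt (by norm_num)) hAs hθ,
    D₂_eq hs hψ α₁ β (hθ.differentiableAt (by norm_num)), D₃_eq hs hψ hA hAs hφ]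
  specialize hG (gradAt (fun v => P.chi lam v * φ v) z)
  specialize hY (fun k => P.chi lam z * dy k φ z)
  have e0 := hg (.inl 0)
  have ex := sum_sq_shift (fun r : Fin p => dx r.succ φ z) (fun r => P.gx r z) _ (P.chi lam z)
    (P.chi lam z * P.w lam z * φ z) (fun r => (hg (.inl r.succ)).trans (by
      simp only [gradAt_inl, Params.grad, vec_succ]; ring))
  have ey := sum_sq_shift (fun r => dy r φ z) (fun r => P.gy r z) _ (P.chi lam z)
    (P.chi lam z * P.w lam z * φ z) (fun r => (hg (.inr r)).trans (by
      simp only [gradAt_inr, Params.grad, vec_inr]; ring))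
  have ea : bil (fun i j => A i j z) (fun k => P.chi lam z * dy k φ z)
      (fun k => P.chi lam z * dy k φ z)
      = P.chi lam z ^ 2 * bil (fun i j => A i j z) (fun k => dy k φ z) (fun k => dy k φ z) := by
    simp only [bil, Finset.mul_sum]
    exact Finset.sum_congr rfl fun i _ => Finset.sum_congr rfl fun j _ => by ring
  have ec : ∑ k, (P.chi lam z * dy k φ z) ^ 2 = P.chi lam z ^ 2 * ∑ k, dy k φ z ^ 2 := by
    simp only [Finset.mul_sum, mul_pow]
  -- The exponent `ν+1` is the one that makes the cross term of the square carry the constant factor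
  -- `4λν`, as in `D₁`.
  have hψ1 : P.psi z ^ (P.ν + 1) * P.w lam z = lam * P.ν := by
    rw [Params.w, mul_left_comm, ← Real.rpow_add hψ]; ring_nf; simp
  have hψ2 : lam ^ 3 * P.ν ^ 4 * P.δ ^ 4 * P.psi z ^ (-2 * P.ν - 3)
      = lam * P.ν ^ 2 * P.δ ^ 4 * P.w lam z ^ 2 * (P.psi z)⁻¹ := by
    rw [Params.w, show -2 * P.ν - 3 = (-P.ν - 1) * (2 : ℕ) - 1 by push_cast; ring,
      Real.rpow_sub_one hψ.ne', Real.rpow_mul_natCast hψ.le]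
    ring
  have hL : P.L₀ A φ z ^ 2 * P.chi lam z ^ 2 = (P.s z ^ 2)⁻¹
      * (P.Z A lam (fun v => P.chi lam v * φ v) z
        + 2 * P.w lam z * P.N A z (gradAt (fun v => P.chi lam v * φ v) z)) ^ 2 := by
    rw [hZ]; have := hs.ne'; field_simp
  rw [hψ2, mul_assoc (P.psi z ^ _), hL]
  simp only [gradAt_inl, gradAt_inr] at hG ex ey e0
  rw [ec, ea] at hY
  rw [Params.S]
  unfold Params.potTotal at hP
  simp only [gradAt_inl, gradAt_inr]
  simp only [Params.grad, vec_zero] at e0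
  have hc : 0 < P.psi z ^ (P.ν + 1) := Real.rpow_pos_of_pos hψ _
  -- What remains is an identity between finitely many scalars; `∇θ` and `∇φ` are linked only
  -- through `e0`, `ex` and `ey`.
  generalize P.psi z ^ (P.ν + 1) = c at *
  generalize P.Z A lam (fun v => P.chi lam v * φ v) z = Z at *
  generalize P.N A z (gradAt (fun v => P.chi lam v * φ v) z) = N at *
  generalize P.gradForm A z (gradAt (fun v => P.chi lam v * φ v) z) = G at *
  generalize P.potForm A lam z = pf at *
  generalize (∑ k, ∑ j, dy k (dy j (A k j)) z) = DD at *
  generalize (∑ k, app (fun i j => dy k (A i j) z) (fun j => P.gy j z) k) = dG at *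
  generalize P.divA A z = dA at *
  generalize P.Q A z = Q at *
  generalize P.L₀ A φ z = L at *
  generalize dx 0 (fun w => P.chi lam w * φ w) z = h0 at *
  generalize dx 0 φ z = φ0 at *
  generalize ∑ r : Fin p, dx r.succ φ z ^ 2 = X' at *
  generalize ∑ r, dy r φ z ^ 2 = Y' at *
  generalize ∑ r : Fin p, dx r.succ (fun w => P.chi lam w * φ w) z ^ 2 = X at *
  generalize ∑ r, dy r (fun w => P.chi lam w * φ w) z ^ 2 = Y at *
  generalize ∑ r : Fin p, P.gx r z * dx r.succ (fun w => P.chi lam w * φ w) z = gh at *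
  generalize ∑ r, P.gy r z * dy r (fun w => P.chi lam w * φ w) z = gyh at *
  generalize ∑ r, P.gx r z ^ 2 = gg at *
  generalize ∑ r, P.gy r z ^ 2 = gyy at *
  generalize bil (fun i j => A i j z) (fun k => dy k φ z) (fun k => dy k φ z) = aφ at *
  generalize P.w lam z = w at *
  generalize P.chi lam z = χ at *
  generalize φ z = f at *
  generalize P.s z = s at *
  generalize P.psi z = ψ at *
  generalize P.ν = ν at *
  generalize P.δ = δ at *
  generalize (p : ℝ) = n at *
  generalize (q : ℝ) = m at *
  clear hg hθ hφ1 hφ hA hAs hL hψ2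
  subst e0
  obtain rfl : X = χ ^ 2 * X' - 2 * (χ * w * f) * gh - (χ * w * f) ^ 2 * gg := by linarith
  obtain rfl : Y = χ ^ 2 * Y' - 2 * (χ * w * f) * gyh - (χ * w * f) ^ 2 * gyy := by linarith
  have hP' := mul_nonneg hP (sq_nonneg (χ * f))
  -- The discarded squares in the expansion of `(Z + 2wN)²`.
  have h1 : 0 ≤ c * (s ^ 2)⁻¹ * (Z ^ 2 + 4 * w ^ 2 * N ^ 2) := by positivity
  have hln : 0 < 2 * lam * ν := by positivity
  have h2 := mul_le_mul_of_nonneg_left hG hln.le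
  have h3 := mul_le_mul_of_nonneg_left hY hln.le
  have h4 := mul_nonneg hln.le hP'
  -- The `x₁` part of `β C(∇φ,∇φ)`, positive and not needed. The difference of the two sides is the
  -- sum of `h1` to `h5`, once `cw = λν` is inserted in the cross term.
  have h5 : 0 ≤ 2 * lam * ν * (β * (χ * φ0) ^ 2) := by positivity
  refine sub_nonneg.mp (le_of_le_of_eq (add_nonneg (add_nonneg (add_nonneg (add_nonneg h1
    (sub_nonneg.mpr h2)) (sub_nonneg.mpr h3)) h4) h5) ?_)
  linear_combination (-4 * (s ^ 2)⁻¹ * Z * N) * hψ1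

end UltraCarleman

namespace UltraCarleman

/-! ### Elementary bounds for bilinear forms -/

section Bounds

variable {κ : Type*} [Fintype κ] {B : κ → κ → ℝ} {M : ℝ}

/-- The Euclidean norm of a vector. -/
noncomputable def nrm (v : κ → ℝ) : ℝ := √(∑ k, v k ^ 2)

theorem nrm_nonneg (v : κ → ℝ) : 0 ≤ nrm v := Real.sqrt_nonneg _

theorem nrm_sq (v : κ → ℝ) : nrm v ^ 2 = ∑ k, v k ^ 2 :=
  Real.sq_sqrt (Finset.sum_nonneg fun _ _ => sq_nonneg _)

theorem abs_le_nrm (v : κ → ℝ) (k : κ) : |v k| ≤ nrm v := by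
  refine Real.abs_le_sqrt ?_
  exact Finset.single_le_sum (f := fun k => v k ^ 2) (fun _ _ => sq_nonneg _) (Finset.mem_univ k)

theorem abs_sum_le_card {f : κ → ℝ} {c : ℝ} (hf : ∀ k, |f k| ≤ c) :
    |∑ k, f k| ≤ Fintype.card κ * c := by
  refine (Finset.abs_sum_le_sum_abs _ _).trans ?_
  refine (Finset.sum_le_sum fun k _ => hf k).trans ?_
  simp

theorem abs_mul_le_of_le {a b c d : ℝ} (h1 : |a| ≤ c) (h2 : |b| ≤ d) : |a * b| ≤ c * d := by
  rw [abs_mul]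
  exact mul_le_mul h1 h2 (abs_nonneg _) ((abs_nonneg _).trans h1)

theorem abs_app_le (hB : ∀ i j, |B i j| ≤ M) (h : κ → ℝ) (k : κ) :
    |app B h k| ≤ Fintype.card κ * (M * nrm h) :=
  abs_sum_le_card fun j => abs_mul_le_of_le (hB k j) (abs_le_nrm h j)

theorem abs_bil_le (hB : ∀ i j, |B i j| ≤ M) (g h : κ → ℝ) :
    |bil B g h| ≤ Fintype.card κ * (nrm g * (Fintype.card κ * (M * nrm h))) := by
  rw [bil_eq_sum_mul_app]
  exact abs_sum_le_card fun j => abs_mul_le_of_le (abs_le_nrm g j) (abs_app_le hB h j)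

/-- Cauchy–Schwarz on `∑ |h j|` gives the third power of the dimension, where bounding each
component by the norm would give the fourth. The third power is what the condition on `γ` controls
in `small_gamma`. -/
theorem sq_sum_app_le {C : κ → κ → κ → ℝ} (hC : ∀ k i j, |C k i j| ≤ M) (h : κ → ℝ) :
    (∑ k, app (C k) h k) ^ 2 ≤ M ^ 2 * Fintype.card κ ^ 3 * ∑ k, h k ^ 2 := by
  have h1 : ∀ k, |app (C k) h k| ≤ M * ∑ j, |h j| := by
    intro k
    rw [Finset.mul_sum]
    refine (Finset.abs_sum_le_sum_abs _ _).trans (Finset.sum_le_sum fun j _ => ?_)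
    rw [abs_mul]
    exact mul_le_mul_of_nonneg_right (hC _ _ _) (abs_nonneg _)
  have h2 := abs_sum_le_card h1
  have h3 : (∑ j, |h j|) ^ 2 ≤ Fintype.card κ * ∑ k, h k ^ 2 := by
    have := sq_sum_le_card_mul_sum_sq (s := Finset.univ) (f := fun j => |h j|)
    simpa using this
  calc (∑ k, app (C k) h k) ^ 2 = |∑ k, app (C k) h k| ^ 2 := (sq_abs _).symm
    _ ≤ (Fintype.card κ * (M * ∑ j, |h j|)) ^ 2 := by gcongr
    _ = M ^ 2 * Fintype.card κ ^ 2 * (∑ j, |h j|) ^ 2 := by ring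
    _ ≤ M ^ 2 * Fintype.card κ ^ 2 * (Fintype.card κ * ∑ k, h k ^ 2) := by gcongr
    _ = _ := by ring

end Bounds

/-! ### Scalar inequalities -/

/-- Here `a`, `b`, `h0` stand for the sizes of `θ_y`, `θ_{'x}` and for `θ_{x₁}`. The available
positive terms are `δs⁻³h0²`, `δα₁s a²` and `(β-3+n-e)s²b²`; everything else is absorbed into them.
-/
theorem gradForm_scalar {K α₁ δ s a b h0 gh aGH aHH a0GH a0HH dH xGH yGH AA xHH yHH e D β n : ℝ}
    (hK : 1 ≤ K) (hs : 0 < s) (hs1 : s < 1)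
    (h1 : |gh| ≤ K * b) (h2 : |aGH| ≤ K * a) (h3 : |aHH| ≤ K * a ^ 2) (h4 : |a0GH| ≤ K * a)
    (h5 : α₁ * s * a ^ 2 ≤ -a0HH) (h6 : |dH| ≤ K * a) (h7 : |xGH| ≤ K * (a * b))
    (h8 : |yGH| ≤ K * a ^ 2) (h9 : |AA| ≤ K * a ^ 2) (h10 : |xHH| ≤ K * a ^ 2)
    (h11 : |yHH| ≤ K * a ^ 2) (h12 : |n - e| ≤ K) (h13 : dH ^ 2 ≤ D * a ^ 2)
    (h14 : s ^ 2 * D ≤ α₁ / 4) (h15 : 1 ≤ β - 3 + n - e) (hδ1 : 8 * K ≤ δ)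
    (hδ2 : 6 * (4 * K ^ 4 + 7 * K ^ 2 + 7 * K) ≤ δ * α₁) :
    1 / 2 * δ * α₁ * s * a ^ 2 ≤
      2 * δ * (s ^ 3)⁻¹ * h0 ^ 2 + 2 * h0 * a0GH - δ * a0HH
      + 2 * (δ * h0 + s ^ 2 * gh - s ^ 2 * aGH) * dH + 2 * s ^ 2 * xGH - 2 * s ^ 2 * yGH
      - 2 * s ^ 2 * b ^ 2 - 2 * s ^ 2 * AA + (n - e) * (h0 ^ 2 + s ^ 2 * b ^ 2 - s ^ 2 * aHH)
      - s ^ 2 * xHH + s ^ 2 * yHH - δ * (s ^ 3)⁻¹ * h0 ^ 2 + (β - 1) * s ^ 2 * b ^ 2 := by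
  have hδ : 0 < δ := by linarith
  have hs2 : 0 < s ^ 2 := by positivity
  have t0 : δ * (α₁ * s * a ^ 2) ≤ -(δ * a0HH) := by
    have := mul_le_mul_of_nonneg_left h5 hδ.le; linarith
  -- The critical term: it carries the same power of `δ` as the good terms, so large `δ` is of no
  -- help. Young's inequality spends `3/4` of the `h0²` budget and, thanks to `s²D ≤ α₁/4`, `1/3` of
  -- the `a²` budget. Since `1/2` of the latter must be kept, `1/4` and `1/6` are left for the rest,
  -- whence the factors `8` and `6` in the conditions on `δ`.
  have t1 : -(3 / 4 * δ * (s ^ 3)⁻¹ * h0 ^ 2 + 1 / 3 * δ * α₁ * s * a ^ 2) ≤ 2 * δ * h0 * dH := by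
    have e1 : 4 / 3 * s ^ 3 * dH ^ 2 ≤ 1 / 3 * α₁ * s * a ^ 2 := by
      have i1 := mul_le_mul_of_nonneg_left h13 (by positivity : 0 ≤ 4 / 3 * s ^ 3)
      have i2 := mul_le_mul_of_nonneg_right h14 (by positivity : 0 ≤ 4 / 3 * s * a ^ 2)
      linarith
    have e2 : 0 ≤ 3 / 4 * (s ^ 3)⁻¹ * (h0 + 4 / 3 * s ^ 3 * dH) ^ 2 := by positivity
    have e3 : 3 / 4 * (s ^ 3)⁻¹ * (h0 + 4 / 3 * s ^ 3 * dH) ^ 2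
        = 3 / 4 * (s ^ 3)⁻¹ * h0 ^ 2 + 2 * h0 * dH + 4 / 3 * s ^ 3 * dH ^ 2 := by
      field_simp; ring
    have e4 := mul_le_mul_of_nonneg_left (e2.trans_eq e3) hδ.le
    have e5 := mul_le_mul_of_nonneg_left e1 hδ.le
    linarith
  have hsi : 1 ≤ (s ^ 3)⁻¹ := by
    rw [one_le_inv₀ (by positivity)]; exact pow_le_one₀ hs.le hs1.le
  have hsi' : s⁻¹ ≤ (s ^ 3)⁻¹ := by
    apply inv_anti₀ (by positivity)
    calc s ^ 3 = s * s ^ 2 := by ring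
      _ ≤ s * 1 := by gcongr; exact pow_le_one₀ hs.le hs1.le
      _ = s := by ring
  have t2 : -(K * ((s ^ 3)⁻¹ * h0 ^ 2 + s * a ^ 2)) ≤ 2 * h0 * a0GH := by
    have e1 : |2 * h0 * a0GH| ≤ 2 * |h0| * (K * a) := by
      rw [abs_mul, abs_mul, abs_two]; gcongr
    have e2 : 0 ≤ s⁻¹ * (|h0| - s * a) ^ 2 := by positivity
    have e3 : s⁻¹ * (|h0| - s * a) ^ 2 = s⁻¹ * h0 ^ 2 - 2 * |h0| * a + s * a ^ 2 := by
      rw [← sq_abs h0]; field_simp; ring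
    have e4 := mul_le_mul_of_nonneg_right hsi' (sq_nonneg h0)
    have e5 := mul_le_mul_of_nonneg_left (e2.trans_eq e3) (by linarith : 0 ≤ K)
    have e6 := mul_le_mul_of_nonneg_left e4 (by linarith : 0 ≤ K)
    have := neg_le_of_abs_le e1
    linarith
  have t3 : -(1 / 4 * b ^ 2 + 4 * K ^ 4 * a ^ 2) ≤ 2 * (gh * dH) := by
    have e1 := neg_le_of_abs_le (abs_mul_le_of_le h1 h6)
    linarith [sq_nonneg (1 / 2 * b - 2 * K ^ 2 * a)]
  have t4 : -(2 * K ^ 2 * a ^ 2) ≤ -(2 * (aGH * dH)) := by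
    have e1 := le_of_abs_le (abs_mul_le_of_le h2 h6)
    linarith
  have t5 : -(1 / 4 * b ^ 2 + 4 * K ^ 2 * a ^ 2) ≤ 2 * xGH := by
    have e1 := neg_le_of_abs_le h7
    linarith [sq_nonneg (1 / 2 * b - 2 * K * a)]
  have t6 : -(K ^ 2 * a ^ 2) ≤ -((n - e) * aHH) := by
    have e1 := le_of_abs_le (abs_mul_le_of_le h12 h3)
    linarith
  have t7 : -(6 * K * a ^ 2) ≤ -(2 * yGH) - 2 * AA - xHH + yHH := by
    linarith [le_of_abs_le h8, le_of_abs_le h9, le_of_abs_le h10, neg_le_of_abs_le h11]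
  have t8 : -(K * ((s ^ 3)⁻¹ * h0 ^ 2)) ≤ (n - e) * h0 ^ 2 := by
    have e1 := mul_le_mul_of_nonneg_right (neg_le_of_abs_le h12) (sq_nonneg h0)
    have e2 := mul_le_mul_of_nonneg_left (mul_le_mul_of_nonneg_right hsi (sq_nonneg h0))
      (by linarith : 0 ≤ K)
    linarith
  have t9 : b ^ 2 ≤ (β - 3 + n - e) * b ^ 2 := by
    have := mul_le_mul_of_nonneg_right h15 (sq_nonneg b); linarith
  have inner := mul_le_mul_of_nonneg_left
    -- All these terms carry the factor `s²`. Those in `b²` cost `½b²`, against the `b²` supplied by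
    -- `t9`; those in `a²` are passed to the `δα₁s` term through `s² ≤ s`.
    (add_le_add (add_le_add (add_le_add (add_le_add (add_le_add t3 t4) t5) t6) t7) t9) hs2.le
  have u1 : 8 * K * ((s ^ 3)⁻¹ * h0 ^ 2) ≤ δ * ((s ^ 3)⁻¹ * h0 ^ 2) :=
    mul_le_mul_of_nonneg_right hδ1 (by positivity)
  have u2 : 6 * (4 * K ^ 4 + 7 * K ^ 2 + 7 * K) * (s * a ^ 2) ≤ δ * α₁ * (s * a ^ 2) :=
    mul_le_mul_of_nonneg_right hδ2 (by positivity)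
  have u3 : s ^ 2 * ((4 * K ^ 4 + 7 * K ^ 2 + 6 * K) * a ^ 2)
      ≤ s * ((4 * K ^ 4 + 7 * K ^ 2 + 6 * K) * a ^ 2) := by
    have : s ^ 2 ≤ s := pow_le_of_le_one hs.le hs1.le two_ne_zero
    have hK0 : 0 < K := by linarith
    gcongr
  have u4 : 0 ≤ s ^ 2 * b ^ 2 := by positivity
  linarith

/-- The coefficient of `w²` in the zeroth order remainder. -/
theorem potForm_scalar {K α₁ δ ν s ψ R G0 B n e β gg gyy : ℝ}
    (hα : 0 < α₁) (hν : 0 < ν) (hK : 1 ≤ K) (hs : 0 < s) (hs1 : s < 1) (hψ : 0 < ψ) (hψ1 : ψ < 1)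
    (hR : |R| ≤ K) (hG0 : |G0| ≤ K) (hB : |B| ≤ K) (he : |n - e + 2 * β| ≤ K) (hβ : 1 ≤ β)
    (hgg : 0 ≤ gg) (hgyy : gyy ≤ 1) (hδ : 1 + 4 * K + α₁ ≤ δ) :
    1 ≤ δ ^ 3 * (s ^ 3)⁻¹ + δ * G0 - s ^ 2 * B - (n - e + 2 * β) * (δ ^ 2 + s ^ 2 * R)
      + 2 * (ν + 1) * (s ^ 2)⁻¹ * (δ ^ 2 + s ^ 2 * R) ^ 2 * ψ⁻¹ + (β - 1) * s ^ 2 * gg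
      - 1 / 2 * δ * α₁ * s * gyy - 1 / 2 * ν * δ ^ 4 * ψ⁻¹ := by
  have hδ0 : 1 < δ := by linarith
  have hδ0' : 0 < δ := by linarith
  have hs2 : s ^ 2 ≤ 1 := pow_le_one₀ hs.le hs1.le
  have hsR : |s ^ 2 * R| ≤ 1 * K := abs_mul_le_of_le (by rwa [abs_of_nonneg (by positivity)]) hR
  have hδ2 : δ ≤ δ ^ 2 := by nlinarith
  obtain ⟨r1, r2⟩ := abs_le.mp hsR
  have hQ1 : 3 / 4 * δ ^ 2 ≤ δ ^ 2 + s ^ 2 * R := by linarith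
  have hQ2 : δ ^ 2 + s ^ 2 * R ≤ 2 * δ ^ 2 := by linarith
  have t1 : (n - e + 2 * β) * (δ ^ 2 + s ^ 2 * R) ≤ K * (2 * δ ^ 2) := by
    refine le_of_abs_le (abs_mul_le_of_le he ?_)
    rwa [abs_of_nonneg (by nlinarith)]
  -- From `C(∇ψ,∇ψ) ≥ ¾δ²` the left over coefficient is at least `2(ν+1)·9/16 - ν/2 ≥ 1`. The
  -- resulting `δ⁴` absorbs every other term.
  have t2 : δ ^ 4 ≤ 2 * (ν + 1) * (s ^ 2)⁻¹ * (δ ^ 2 + s ^ 2 * R) ^ 2 * ψ⁻¹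
      - 1 / 2 * ν * δ ^ 4 * ψ⁻¹ := by
    have hψi : 1 ≤ ψ⁻¹ := (one_le_inv₀ hψ).mpr hψ1.le
    have hsi : 1 ≤ (s ^ 2)⁻¹ := (one_le_inv₀ (by positivity)).mpr hs2
    have e1 : 9 / 16 * δ ^ 4 ≤ (δ ^ 2 + s ^ 2 * R) ^ 2 := by
      calc 9 / 16 * δ ^ 4 = (3 / 4 * δ ^ 2) ^ 2 := by ring
        _ ≤ _ := by gcongr
    have e2 : 2 * (ν + 1) * 1 * (9 / 16 * δ ^ 4) ≤ 2 * (ν + 1) * (s ^ 2)⁻¹ *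
        (δ ^ 2 + s ^ 2 * R) ^ 2 := by gcongr
    have e3 := mul_le_mul_of_nonneg_right e2 (by linarith : 0 ≤ ψ⁻¹)
    have e4 : δ ^ 4 * 1 ≤ δ ^ 4 * ψ⁻¹ := by gcongr
    have e5 : 0 ≤ ν * δ ^ 4 * ψ⁻¹ := by positivity
    nlinarith
  have t3 : -(δ * K) ≤ δ * G0 := by
    have := mul_le_mul_of_nonneg_left (neg_le_of_abs_le hG0) hδ0'.le; linarith
  have t4 : s ^ 2 * B ≤ 1 * K :=
    le_of_abs_le (abs_mul_le_of_le (by rwa [abs_of_nonneg (by positivity)]) hB)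
  have t5 : 0 ≤ (β - 1) * s ^ 2 * gg := by
    have : 0 ≤ β - 1 := by linarith
    positivity
  have t6 : 1 / 2 * δ * α₁ * s * gyy ≤ 1 / 2 * δ * α₁ := by
    have e1 : s * gyy ≤ 1 := by nlinarith
    have := mul_le_mul_of_nonneg_left e1 (by positivity : 0 ≤ 1 / 2 * δ * α₁)
    linarith
  have t7 : 0 ≤ δ ^ 3 * (s ^ 3)⁻¹ := by positivity
  have t8 : 1 + 2 * K * δ ^ 2 + δ * K + K + 1 / 2 * δ * α₁ ≤ δ ^ 4 := by
    have e1 : (1 + 4 * K + α₁) * δ ^ 2 ≤ δ ^ 2 * δ ^ 2 := by gcongr; linarith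
    nlinarith
  linarith

end UltraCarleman

/-! ### Pointwise bounds and the gradient inequality -/

namespace UltraCarleman

variable {p q : ℕ} {P : Params p q} {z : Pt (p + 1) (q + 1)} {lam M : ℝ}
  {A : Fin (q + 1) → Fin (q + 1) → Pt (p + 1) (q + 1) → ℝ}

/-- Bounds at a point for the coefficients, their derivatives and the gradient of the weight. -/
structure PointBounds (P : Params p q)
    (A : Fin (q + 1) → Fin (q + 1) → Pt (p + 1) (q + 1) → ℝ) (M : ℝ) (z : Pt (p + 1) (q + 1)) :
    Prop where
  s_pos : 0 < P.s z
  s_lt : P.s z < 1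
  psi_pos : 0 < P.psi z
  psi_lt : P.psi z < 1
  coeff : ∀ i j, |A i j z| ≤ M
  dx_zero : ∀ i j, |dx 0 (A i j) z| ≤ M
  dx_succ : ∀ (r : Fin p) i j, |dx r.succ (A i j) z| ≤ M
  dy : ∀ k i j, |dy k (A i j) z| ≤ M
  dy_dy : ∀ k j, |UltraCarleman.dy k (UltraCarleman.dy j (A k j)) z| ≤ M
  gx : nrm (fun r => P.gx r z) ≤ 1
  gy : nrm (fun k => P.gy k z) ≤ 1

/-- `M m²`. -/
noncomputable def kap (q : ℕ) (M : ℝ) : ℝ := M * ((q : ℝ) + 1) ^ 2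

/-- A bound for all quantities that are estimated independently of the large parameters. -/
noncomputable def bigK (p q : ℕ) (M : ℝ) : ℝ :=
  10 + 5 * p + 5 * kap q M + p * kap q M + 3 * kap q M ^ 2
    + 2 * (M * ((q : ℝ) + 1) * (4 * ((q : ℝ) + 1) + 1))

theorem kap_nonneg (hM : 0 < M) : 0 ≤ kap q M := by unfold kap; positivity

theorem mul_le_kap (hM : 0 < M) : M * ((q : ℝ) + 1) ≤ kap q M := by
  unfold kap
  have : (0 : ℝ) ≤ q := by positivity
  have : M * ((q : ℝ) + 1) * 1 ≤ M * ((q : ℝ) + 1) * ((q : ℝ) + 1) := by gcongr; linarith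
  linarith

theorem le_bigK (hM : 0 < M) {a : ℝ} (h : a ≤ 10 + 5 * p + 5 * kap q M + p * kap q M
    + 3 * kap q M ^ 2) : a ≤ bigK p q M := by
  unfold bigK
  have : 0 ≤ M * ((q : ℝ) + 1) * (4 * ((q : ℝ) + 1) + 1) := by positivity
  linarith

theorem bil_le_kap {B : Fin (q + 1) → Fin (q + 1) → ℝ} (hB : ∀ i j, |B i j| ≤ M)
    (g h : Fin (q + 1) → ℝ) : |bil B g h| ≤ kap q M * (nrm g * nrm h) := by
  refine (abs_bil_le hB g h).trans_eq ?_
  simp [kap]; ring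

theorem bil_le_kap_of_le_one (hM : 0 < M) {B : Fin (q + 1) → Fin (q + 1) → ℝ}
    (hB : ∀ i j, |B i j| ≤ M) {g : Fin (q + 1) → ℝ} (hg : nrm g ≤ 1) (h : Fin (q + 1) → ℝ) :
    |bil B g h| ≤ kap q M * nrm h := by
  refine (bil_le_kap hB g h).trans ?_
  have := nrm_nonneg h
  have := kap_nonneg (q := q) hM
  calc kap q M * (nrm g * nrm h) ≤ kap q M * (1 * nrm h) := by gcongr
    _ = _ := by ring

theorem app_le {B : Fin (q + 1) → Fin (q + 1) → ℝ}
    (hB : ∀ i j, |B i j| ≤ M) (h : Fin (q + 1) → ℝ) (k : Fin (q + 1)) :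
    |app B h k| ≤ M * ((q : ℝ) + 1) * nrm h := by
  refine (abs_app_le hB h k).trans_eq ?_
  simp; ring

theorem sum_app_le {B : Fin (q + 1) → Fin (q + 1) → Fin (q + 1) → ℝ}
    (hB : ∀ k i j, |B k i j| ≤ M) (h : Fin (q + 1) → ℝ) :
    |∑ k, app (B k) h k| ≤ kap q M * nrm h := by
  refine (abs_sum_le_card fun k => app_le (hB k) h k).trans_eq ?_
  simp [kap]; ring

theorem tr_le {B : Fin (q + 1) → ℝ} (hB : ∀ i, |B i| ≤ M) :
    |∑ k, B k| ≤ M * ((q : ℝ) + 1) := by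
  refine (abs_sum_le_card hB).trans_eq ?_
  simp; ring

theorem PointBounds.divA_le (hb : PointBounds P A M z) :
    |P.divA A z| ≤ M * ((q : ℝ) + 1) + kap q M * nrm (fun k => P.gy k z) :=
  (abs_add_le _ _).trans (add_le_add (tr_le fun i => hb.coeff i i) (sum_app_le hb.dy _))

theorem PointBounds.sub_divA_le (hb : PointBounds P A M z) (hM : 0 < M) :
    |p - P.divA A z| ≤ p + 2 * kap q M := by
  have h1 := hb.divA_le
  have h2 := mul_le_kap (q := q) hM
  have h3 := mul_le_mul_of_nonneg_left hb.gy (kap_nonneg (q := q) hM)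
  have h4 := abs_sub (p : ℝ) (P.divA A z)
  rw [abs_of_nonneg (by positivity : (0 : ℝ) ≤ p)] at h4
  linarith

theorem PointBounds.gradForm_ge (hb : PointBounds P A M z) (hM : 0 < M) {α₁ β : ℝ}
    (hco : ∀ ξ : Fin (q + 1) → ℝ, α₁ * P.s z * ∑ i, ξ i ^ 2
      ≤ -bil (fun i j => dx 0 (A i j) z) ξ ξ)
    (hsm : P.s z ^ 2 * (M ^ 2 * ((q : ℝ) + 1) ^ 3) ≤ α₁ / 4)
    (hβ : 1 ≤ β - 3 + p - P.divA A z) (hδ1 : 8 * bigK p q M ≤ P.δ)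
    (hδ2 : 6 * (4 * bigK p q M ^ 4 + 7 * bigK p q M ^ 2 + 7 * bigK p q M) ≤ P.δ * α₁)
    (h : Idx p q → ℝ) :
    1 / 2 * P.δ * α₁ * P.s z * (∑ k, h (.inr k) ^ 2)
      ≤ P.gradForm A z h - P.δ * (P.s z ^ 3)⁻¹ * h (.inl 0) ^ 2
        + (β - 1) * P.s z ^ 2 * ∑ r : Fin p, h (.inl r.succ) ^ 2 := by
  have hκ := kap_nonneg (q := q) hM
  have hp : (0 : ℝ) ≤ p := by positivity
  have hpκ : 0 ≤ p * kap q M := by positivity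
  have hκ2 : 0 ≤ kap q M ^ 2 := by positivity
  have hκm := mul_le_kap (q := q) hM
  have ha := nrm_nonneg (fun k => h (.inr k))
  have hbn := nrm_nonneg (fun r : Fin p => h (.inl r.succ))
  unfold Params.gradForm Params.N Params.S
  rw [← nrm_sq, ← nrm_sq]
  have hAA : |∑ k, app (fun i j => A i j z) (fun j => h (.inr j)) k ^ 2|
      ≤ kap q M ^ 2 * nrm (fun k => h (.inr k)) ^ 2 := by
    simp only [sq (app _ _ _)]
    refine (abs_sum_le_card fun k => abs_mul_le_of_le (app_le hb.coeff _ k)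
      (app_le hb.coeff _ k)).trans ?_
    have : M * ((q : ℝ) + 1) * nrm (fun k => h (.inr k)) ≤ kap q M * nrm (fun k => h (.inr k)) := by
      gcongr
    calc _ = kap q M * nrm (fun k => h (.inr k)) * (M * ((q : ℝ) + 1) * nrm (fun k => h (.inr k))) := by
            simp [kap]; ring
      _ ≤ kap q M * nrm (fun k => h (.inr k)) * (kap q M * nrm (fun k => h (.inr k))) := by gcongr
      _ = _ := by ring
  have hyGH : |∑ k, bil (fun i j => UltraCarleman.dy k (A i j) z) (fun k => P.gy k z)
      (fun k => h (.inr k)) * app (fun i j => A i j z) (fun j => h (.inr j)) k|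
      ≤ kap q M ^ 2 * nrm (fun k => h (.inr k)) ^ 2 := by
    refine (abs_sum_le_card fun k => abs_mul_le_of_le (bil_le_kap_of_le_one hM (hb.dy k) hb.gy _)
      (app_le hb.coeff _ k)).trans_eq ?_
    simp [kap]; ring
  have hyHH : |∑ k, bil (fun i j => UltraCarleman.dy k (A i j) z) (fun k => h (.inr k))
      (fun k => h (.inr k)) * app (fun i j => A i j z) (fun j => P.gy j z) k|
      ≤ kap q M ^ 2 * nrm (fun k => h (.inr k)) ^ 2 := by
    refine (abs_sum_le_card fun k => abs_mul_le_of_le (bil_le_kap (hb.dy k) _ _)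
      ((app_le hb.coeff _ k).trans (mul_le_of_le_one_right (by positivity) hb.gy))).trans_eq ?_
    simp [kap]; ring
  have hxGH : |∑ r : Fin p, bil (fun i j => dx r.succ (A i j) z) (fun k => P.gy k z)
      (fun k => h (.inr k)) * h (.inl r.succ)|
      ≤ p * kap q M * (nrm (fun k => h (.inr k)) * nrm (fun r : Fin p => h (.inl r.succ))) := by
    refine (abs_sum_le_card fun r => abs_mul_le_of_le
      (bil_le_kap_of_le_one hM (hb.dx_succ r) hb.gy _)
      (abs_le_nrm (fun r : Fin p => h (.inl r.succ)) r)).trans_eq ?_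
    simp; ring
  have hxHH : |∑ r : Fin p, bil (fun i j => dx r.succ (A i j) z) (fun k => h (.inr k))
      (fun k => h (.inr k)) * P.gx r z| ≤ p * kap q M * nrm (fun k => h (.inr k)) ^ 2 := by
    refine (abs_sum_le_card fun r => abs_mul_le_of_le (bil_le_kap (hb.dx_succ r) _ _)
      ((abs_le_nrm (fun r => P.gx r z) r).trans hb.gx)).trans_eq ?_
    simp; ring
  have hgh : |∑ r, P.gx r z * h (.inl r.succ)| ≤ p * nrm (fun r : Fin p => h (.inl r.succ)) := by
    refine (abs_sum_le_card fun r => abs_mul_le_of_le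
      ((abs_le_nrm (fun r => P.gx r z) r).trans hb.gx)
      (abs_le_nrm (fun r : Fin p => h (.inl r.succ)) r)).trans_eq ?_
    simp
  refine gradForm_scalar (K := bigK p q M) (D := M ^ 2 * ((q : ℝ) + 1) ^ 3)
    (le_bigK hM (by linarith)) hb.s_pos hb.s_lt (hgh.trans ?_)
    ((bil_le_kap_of_le_one hM hb.coeff hb.gy _).trans ?_) ((bil_le_kap hb.coeff _ _).trans ?_)
    ((bil_le_kap_of_le_one hM hb.dx_zero hb.gy _).trans ?_) ?_ ((sum_app_le hb.dy _).trans ?_)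
    (hxGH.trans ?_) (hyGH.trans ?_) (hAA.trans ?_) (hxHH.trans ?_) (hyHH.trans ?_)
    ((hb.sub_divA_le hM).trans (le_bigK hM (by linarith))) ?_ hsm hβ hδ1 hδ2
  · gcongr; exact le_bigK hM (by linarith)
  · gcongr; exact le_bigK hM (by linarith)
  · rw [← sq]; gcongr; exact le_bigK hM (by linarith)
  · gcongr; exact le_bigK hM (by linarith)
  · rw [nrm_sq]; exact hco _
  · gcongr; exact le_bigK hM (by linarith)
  · gcongr; exact le_bigK hM (by linarith)
  · gcongr; exact le_bigK hM (by linarith)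
  · gcongr; exact le_bigK hM (by linarith)
  · gcongr; exact le_bigK hM (by linarith)
  · gcongr; exact le_bigK hM (by linarith)
  · rw [nrm_sq]
    refine (sq_sum_app_le hb.dy _).trans_eq ?_
    simp

end UltraCarleman

/-! ### The zeroth order inequality -/

namespace UltraCarleman

variable {p q : ℕ} {P : Params p q} {z : Pt (p + 1) (q + 1)} {lam M : ℝ}
  {A : Fin (q + 1) → Fin (q + 1) → Pt (p + 1) (q + 1) → ℝ}

/-- The part of `C(∇ψ, ∇ C(∇ψ, ∇ψ))` that does not come from `∂/∂x₁`, up to a factor `s⁴`. -/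
noncomputable def Params.tangQ (P : Params p q)
    (A : Fin (q + 1) → Fin (q + 1) → Pt (p + 1) (q + 1) → ℝ) (z : Pt (p + 1) (q + 1)) : ℝ :=
  (∑ r, P.gx r z * (2 * P.gx r z
      - bil (fun i j => dx r.succ (A i j) z) (fun k => P.gy k z) (fun k => P.gy k z)))
    + ∑ k, app (fun i j => A i j z) (fun j => P.gy j z) k
      * (2 * app (fun i j => A i j z) (fun j => P.gy j z) k
        + bil (fun i j => dy k (A i j) z) (fun k => P.gy k z) (fun k => P.gy k z))

/-- The part of `C(∇ψ, ∇ (C : ∇²ψ))` that does not come from `∂/∂x₁`, up to a factor `s⁴`. -/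
noncomputable def Params.tangτ (P : Params p q)
    (A : Fin (q + 1) → Fin (q + 1) → Pt (p + 1) (q + 1) → ℝ) (z : Pt (p + 1) (q + 1)) : ℝ :=
  -(∑ r, P.gx r z * ∑ i, dx r.succ (A i i) z)
    + ∑ k, app (fun i j => A i j z) (fun j => P.gy j z) k * ∑ i, dy k (A i i) z

/-- Separates the `x₁` part, the only one carrying `δ`. Its summand with the factor `2δs` cancels,
in the `w²` coefficient of the potential, against the `s²` part of `C(∇ψ,∇ψ)` in `2δs⁻³Φ`. -/
theorem CC_Q' : P.CC A z (P.Q' A z) = P.δ * (2 * P.s z * ((∑ r, P.gx r z ^ 2)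
        - bil (fun i j => A i j z) (fun k => P.gy k z) (fun k => P.gy k z))
      - P.s z ^ 2 * bil (fun i j => dx 0 (A i j) z) (fun k => P.gy k z) (fun k => P.gy k z))
    + P.s z ^ 4 * P.tangQ A z := by
  simp only [Params.CC, Params.Q', vec_zero, vec_succ, vec_inr, Params.tangQ]
  have e : ∀ f : Fin p → ℝ, ∑ r, P.gx r z * (P.s z ^ 2 * f r)
      = P.s z ^ 2 * ∑ r, P.gx r z * f r := fun f => by
    rw [Finset.mul_sum]; exact Finset.sum_congr rfl fun r _ => by ring
  rw [e]
  simp only [mul_left_comm _ (-P.s z ^ 2), ← Finset.mul_sum]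
  ring

theorem CC_τ' : P.CC A z (P.τ' A z) = P.δ * (2 * P.s z * (p - ∑ i, A i i z)
      - P.s z ^ 2 * ∑ i, dx 0 (A i i) z) + P.s z ^ 4 * P.tangτ A z := by
  simp only [Params.CC, Params.τ', vec_zero, vec_succ, vec_inr, Params.tangτ]
  simp only [mul_left_comm _ (-P.s z ^ 2), ← Finset.mul_sum]
  ring

/-- The coefficient of `w` in the zeroth order remainder, as a polynomial in bounded quantities. -/
noncomputable def linPot (n m δ ν α₁ β : ℝ) (v : Fin 12 → ℝ) : ℝ :=
  -((-2 * δ * v 1 ^ 3 + n - (v 6 + v 9))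
        * (-(ν + 1) * (δ ^ 2 + v 0 ^ 2 * v 3) * v 2 + v 0 ^ 2 * (n - v 6))
      + v 1 ^ 2 * ((ν + 1) * (ν + 2) * (δ ^ 2 + v 0 ^ 2 * v 3) ^ 2 * v 2 ^ 2
        - (ν + 1) * v 2 * (δ * (2 * v 0 * v 3 - v 0 ^ 2 * v 4) + v 0 ^ 4 * v 5)
        - (ν + 1) * v 2 * (v 0 ^ 2 * (n - v 6)) * (δ ^ 2 + v 0 ^ 2 * v 3)
        + (δ * (2 * v 0 * (n - v 6) - v 0 ^ 2 * v 7) + v 0 ^ 4 * v 8)))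
    - (3 * δ ^ 2 * v 1 ^ 4 + (β - 1) * v 0 ^ 2 * n - 1 / 2 * δ * α₁ * v 0 * m)
    + (ν + 1) * v 2 * (-δ ^ 3 * v 1 ^ 3 + (β - 1) * v 0 ^ 2 * v 10 - 1 / 2 * δ * α₁ * v 0 * v 11)
    + β * (-(v 0 ^ 2 * v 9) + v 0 ^ 2 * (n - (v 6 + v 9)) - (ν + 1) * (δ ^ 2 + v 0 ^ 2 * v 3) * v 2)

/-- A polynomial is bounded on a cube. No explicit value is needed, since the bound enters only the
threshold for `λ`, which may depend on `δ` and all the fixed parameters. -/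
theorem exists_linPot_bound (n m δ ν α₁ β R : ℝ) :
    ∃ L, ∀ v : Fin 12 → ℝ, (∀ i, |v i| ≤ R) → |linPot n m δ ν α₁ β v| ≤ L := by
  have hc : Continuous (linPot n m δ ν α₁ β) := by unfold linPot; fun_prop
  obtain ⟨L, hL⟩ := (isCompact_univ_pi fun _ : Fin 12 =>
    isCompact_Icc (a := -R) (b := R)).exists_bound_of_continuousOn hc.continuousOn
  exact ⟨L, fun v hv => hL v fun i _ => abs_le.mp (hv i)⟩

/-- The bounded quantities entering the zeroth order remainder. -/
noncomputable def Params.atoms (P : Params p q)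
    (A : Fin (q + 1) → Fin (q + 1) → Pt (p + 1) (q + 1) → ℝ) (z : Pt (p + 1) (q + 1)) :
    Fin 12 → ℝ :=
  ![P.s z, (P.s z)⁻¹, (P.psi z)⁻¹, (∑ r, P.gx r z ^ 2)
      - bil (fun i j => A i j z) (fun k => P.gy k z) (fun k => P.gy k z),
    bil (fun i j => dx 0 (A i j) z) (fun k => P.gy k z) (fun k => P.gy k z), P.tangQ A z,
    ∑ i, A i i z, ∑ i, dx 0 (A i i) z, P.tangτ A z,
    ∑ k, app (fun i j => dy k (A i j) z) (fun j => P.gy j z) k,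
    ∑ r, P.gx r z ^ 2, ∑ k, P.gy k z ^ 2]

/-- Expansion in powers of `w`: the quadratic coefficient is the one of `potForm_scalar`, the linear
one is a polynomial in the twelve bounded quantities `atoms`, and the constant one involves only
second derivatives of `A`. -/
theorem potTotal_eq (hs : 0 < P.s z) (hψ : 0 < P.psi z) (α₁ β : ℝ) :
    P.potTotal A lam α₁ β z = P.w lam z ^ 2 *
      (P.δ ^ 3 * (P.s z ^ 3)⁻¹
        + P.δ * bil (fun i j => dx 0 (A i j) z) (fun k => P.gy k z) (fun k => P.gy k z)
        - P.s z ^ 2 * P.tangQ A z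
        - (p - P.divA A z + 2 * β) * (P.δ ^ 2 + P.s z ^ 2 * ((∑ r, P.gx r z ^ 2)
          - bil (fun i j => A i j z) (fun k => P.gy k z) (fun k => P.gy k z)))
        + 2 * (P.ν + 1) * (P.s z ^ 2)⁻¹ * (P.δ ^ 2 + P.s z ^ 2 * ((∑ r, P.gx r z ^ 2)
          - bil (fun i j => A i j z) (fun k => P.gy k z) (fun k => P.gy k z))) ^ 2 * (P.psi z)⁻¹
        + (β - 1) * P.s z ^ 2 * (∑ r, P.gx r z ^ 2)
        - 1 / 2 * P.δ * α₁ * P.s z * (∑ k, P.gy k z ^ 2) - 1 / 2 * P.ν * P.δ ^ 4 * (P.psi z)⁻¹)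
      + P.w lam z * linPot p (q + 1) P.δ P.ν α₁ β (P.atoms A z)
      + 1 / 2 * β * P.s z ^ 2 * ∑ k, ∑ j, dy k (dy j (A k j)) z := by
  have hs' := hs.ne'
  have hψ' := hψ.ne'
  rw [Params.potTotal, Params.potForm, bigPhi_eq hψ, CC_Q', CC_τ', Params.Q_eq, Params.τ,
    Params.divA, linPot, Params.atoms]
  simp only [Matrix.cons_val]
  generalize (∑ k, ∑ j, dy k (dy j (A k j)) z) = DD
  generalize (∑ k, app (fun i j => dy k (A i j) z) (fun j => P.gy j z) k) = dG
  generalize ∑ r, P.gx r z ^ 2 = gg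
  generalize ∑ r, P.gy r z ^ 2 = gyy
  generalize bil (fun i j => A i j z) (fun k => P.gy k z) (fun k => P.gy k z) = a
  generalize bil (fun i j => dx 0 (A i j) z) (fun k => P.gy k z) (fun k => P.gy k z) = G0
  generalize P.tangQ A z = B
  generalize P.tangτ A z = B'
  generalize ∑ i, A i i z = tr
  generalize ∑ i, dx 0 (A i i) z = tr0
  generalize P.w lam z = w
  generalize P.s z = s at *
  generalize P.psi z = ψ at *
  field_simp
  ring

theorem PointBounds.gg_le (hb : PointBounds P A M z) : ∑ r, P.gx r z ^ 2 ≤ 1 := by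
  rw [← nrm_sq]; exact pow_le_one₀ (nrm_nonneg _) hb.gx

theorem PointBounds.gyy_le (hb : PointBounds P A M z) : ∑ r, P.gy r z ^ 2 ≤ 1 := by
  rw [← nrm_sq]; exact pow_le_one₀ (nrm_nonneg _) hb.gy

theorem PointBounds.bil_gy_le (hb : PointBounds P A M z) (hM : 0 < M)
    {B : Fin (q + 1) → Fin (q + 1) → ℝ} (hB : ∀ i j, |B i j| ≤ M) :
    |bil B (fun k => P.gy k z) (fun k => P.gy k z)| ≤ kap q M :=
  (bil_le_kap_of_le_one hM hB hb.gy _).trans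
    (mul_le_of_le_one_right (kap_nonneg hM) hb.gy)

theorem PointBounds.app_gy_le (hb : PointBounds P A M z) (hM : 0 < M) (k : Fin (q + 1)) :
    |app (fun i j => A i j z) (fun j => P.gy j z) k| ≤ M * ((q : ℝ) + 1) :=
  (app_le hb.coeff _ k).trans (mul_le_of_le_one_right (by positivity) hb.gy)

theorem PointBounds.tangQ_le (hb : PointBounds P A M z) (hM : 0 < M) :
    |P.tangQ A z| ≤ p * (2 + kap q M) + 3 * kap q M ^ 2 := by
  have hκm := mul_le_kap (q := q) hM
  have hκ := kap_nonneg (q := q) hM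
  have hx : ∀ r, |P.gx r z| ≤ 1 := fun r => (abs_le_nrm (fun r => P.gx r z) r).trans hb.gx
  refine (abs_add_le _ _).trans (add_le_add ?_ ?_)
  · refine (abs_sum_le_card fun r => abs_mul_le_of_le (d := 2 + kap q M) (hx r) ?_).trans_eq ?_
    · refine (abs_sub _ _).trans (add_le_add ?_ (hb.bil_gy_le hM (hb.dx_succ r)))
      rw [abs_mul, abs_two]; linarith [hx r]
    · simp
  · refine (abs_sum_le_card fun k => abs_mul_le_of_le (d := 3 * kap q M)
      (hb.app_gy_le hM k) ?_).trans_eq ?_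
    · refine (abs_add_le _ _).trans ?_
      have h1 := hb.app_gy_le hM k
      have h2 := hb.bil_gy_le hM (hb.dy k)
      rw [abs_mul, abs_two]; linarith
    · simp [kap]; ring

theorem PointBounds.tangτ_le (hb : PointBounds P A M z) (hM : 0 < M) :
    |P.tangτ A z| ≤ p * kap q M + kap q M ^ 2 := by
  have hκm := mul_le_kap (q := q) hM
  have hx : ∀ r, |P.gx r z| ≤ 1 := fun r => (abs_le_nrm (fun r => P.gx r z) r).trans hb.gx
  refine (abs_add_le _ _).trans (add_le_add ?_ ?_)
  · rw [abs_neg]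
    refine (abs_sum_le_card fun r => abs_mul_le_of_le (hx r)
      ((tr_le fun i => hb.dx_succ r i i).trans hκm)).trans_eq ?_
    simp
  · refine (abs_sum_le_card fun k => abs_mul_le_of_le (hb.app_gy_le hM k)
      ((tr_le fun i => hb.dy k i i).trans hκm)).trans_eq ?_
    simp [kap]; ring

theorem PointBounds.R_le (hb : PointBounds P A M z) (hM : 0 < M) :
    |(∑ r, P.gx r z ^ 2) - bil (fun i j => A i j z) (fun k => P.gy k z) (fun k => P.gy k z)|
      ≤ 1 + kap q M := by
  refine (abs_sub _ _).trans (add_le_add ?_ (hb.bil_gy_le hM hb.coeff))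
  rw [abs_of_nonneg (Finset.sum_nonneg fun _ _ => sq_nonneg _)]
  exact hb.gg_le

theorem PointBounds.atoms_le (hb : PointBounds P A M z) (hM : 0 < M) {R : ℝ}
    (hR : bigK p q M ≤ R) (hs : (P.s z)⁻¹ ≤ R) (hψ : (P.psi z)⁻¹ ≤ R) (i : Fin 12) :
    |P.atoms A z i| ≤ R := by
  have hκ := kap_nonneg (q := q) hM
  have hκm := mul_le_kap (q := q) hM
  have hp : (0 : ℝ) ≤ p := by positivity
  have hpκ : 0 ≤ p * kap q M := by positivity
  have hκ2 : 0 ≤ kap q M ^ 2 := by positivity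
  have key : ∀ {a : ℝ}, a ≤ 10 + 5 * p + 5 * kap q M + p * kap q M + 3 * kap q M ^ 2 → a ≤ R :=
    fun h => (le_bigK hM h).trans hR
  have hsum : ∀ {κ : Type} [Fintype κ] (v : κ → ℝ), ∑ k, v k ^ 2 ≤ 1 → |∑ k, v k ^ 2| ≤ 1 :=
    fun v hv => by rwa [abs_of_nonneg (Finset.sum_nonneg fun _ _ => sq_nonneg _)]
  have hsp := hb.s_pos
  have hψp := hb.psi_pos
  fin_cases i
  · exact (abs_of_pos hsp).le.trans (key (by linarith [hb.s_lt]))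
  · exact (abs_of_pos (inv_pos.mpr hsp)).le.trans hs
  · exact (abs_of_pos (inv_pos.mpr hψp)).le.trans hψ
  · exact (hb.R_le hM).trans (key (by linarith))
  · exact (hb.bil_gy_le hM hb.dx_zero).trans (key (by linarith))
  · exact (hb.tangQ_le hM).trans (key (by linarith))
  · exact (tr_le fun i => hb.coeff i i).trans (key (by linarith))
  · exact (tr_le fun i => hb.dx_zero i i).trans (key (by linarith))
  · exact (hb.tangτ_le hM).trans (key (by linarith))
  · exact (sum_app_le hb.dy _).trans ((mul_le_of_le_one_right hκ hb.gy).trans (key (by linarith)))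
  · exact (hsum _ hb.gg_le).trans (key (by linarith))
  · exact (hsum _ hb.gyy_le).trans (key (by linarith))

/-- The polynomial is at least `w² - Lw - Kκ`, with `K = bigK p q M` and `κ = kap q M`. This is
nonnegative because `w ≥ 1 + L + Kκ` gives `w² ≥ w + Lw + wKκ` and `w ≥ 1`. -/
theorem PointBounds.potTotal_nonneg (hb : PointBounds P A M z) (hM : 0 < M) {α₁ β R L : ℝ}
    (hα : 0 < α₁) (hν : 0 < P.ν) (hβ : 1 ≤ β)
    (hβ2 : β ≤ p + 3 + M * ((q : ℝ) + 1) * (4 * ((q : ℝ) + 1) + 1))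
    (hδ : 1 + 4 * bigK p q M + α₁ ≤ P.δ)
    (hR : bigK p q M ≤ R) (hs : (P.s z)⁻¹ ≤ R) (hψ : (P.psi z)⁻¹ ≤ R)
    (hL : ∀ v : Fin 12 → ℝ, (∀ i, |v i| ≤ R) → |linPot p (q + 1) P.δ P.ν α₁ β v| ≤ L)
    (hlam : 1 + L + bigK p q M * kap q M ≤ P.w lam z) :
    0 ≤ P.potTotal A lam α₁ β z := by
  have hκ := kap_nonneg (q := q) hM
  have hκm := mul_le_kap (q := q) hM
  have hp : (0 : ℝ) ≤ p := by positivity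
  have hpκ : 0 ≤ p * kap q M := by positivity
  have hκ2 : 0 ≤ kap q M ^ 2 := by positivity
  have hK : 1 ≤ bigK p q M := le_bigK hM (by linarith)
  -- The last summand of `bigK` is made for the term `2β` here.
  have hβK : |p - P.divA A z + 2 * β| ≤ bigK p q M := by
    refine (abs_add_le _ _).trans ((add_le_add (hb.sub_divA_le hM) le_rfl).trans ?_)
    rw [abs_of_nonneg (by linarith), bigK]
    linarith
  have h2 := potForm_scalar (n := p) (e := P.divA A z) (gg := ∑ r, P.gx r z ^ 2) hα hν hK hb.s_pos hb.s_lt hb.psi_pos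
    hb.psi_lt ((hb.R_le hM).trans (le_bigK hM (by linarith)))
    ((hb.bil_gy_le hM hb.dx_zero).trans (le_bigK hM (by linarith)))
    ((hb.tangQ_le hM).trans (le_bigK hM (by linarith))) hβK hβ
    (Finset.sum_nonneg fun r _ => sq_nonneg (P.gx r z)) hb.gyy_le hδ
  have h1 := neg_le_of_abs_le (hL _ (hb.atoms_le hM hR hs hψ))
  have hL0 : 0 ≤ L := (abs_nonneg _).trans (hL _ (hb.atoms_le hM hR hs hψ))
  have hDD : |∑ k, ∑ j, UltraCarleman.dy k (UltraCarleman.dy j (A k j)) z| ≤ kap q M := by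
    refine (abs_sum_le_card fun k => tr_le (hb.dy_dy k)).trans_eq ?_
    simp [kap]; ring
  have hβK' : β ≤ bigK p q M := by unfold bigK; linarith
  have h0 : -(bigK p q M * kap q M) ≤ 1 / 2 * β * P.s z ^ 2
      * ∑ k, ∑ j, UltraCarleman.dy k (UltraCarleman.dy j (A k j)) z := by
    refine neg_le_of_abs_le (abs_mul_le_of_le ?_ hDD)
    have := hb.s_pos
    have hs2 : P.s z ^ 2 ≤ 1 := pow_le_one₀ this.le hb.s_lt.le
    rw [abs_of_nonneg (by positivity)]
    calc 1 / 2 * β * P.s z ^ 2 ≤ 1 / 2 * β * 1 := by gcongr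
      _ ≤ _ := by linarith
  rw [potTotal_eq hb.s_pos hb.psi_pos]
  have hKκ : 0 ≤ bigK p q M * kap q M := by positivity
  have hw : 1 ≤ P.w lam z := by linarith
  have m2 := mul_le_mul_of_nonneg_left h2 (sq_nonneg (P.w lam z))
  have m1 := mul_le_mul_of_nonneg_left h1 (by linarith : 0 ≤ P.w lam z)
  have m0 := mul_le_mul_of_nonneg_left hlam (by linarith : 0 ≤ P.w lam z)
  have m3 := mul_le_mul_of_nonneg_right hw hKκ
  linarith

end UltraCarleman

namespace UltraCarleman

/-! ### The coefficients in the new variables -/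

section Average

variable {E : Type*} [NormedAddCommGroup E] [NormedSpace ℝ E] {f g : E → ℝ} {z : E} {M : ℝ}

theorem fderiv_avg (hf : DifferentiableAt ℝ f z) (hg : DifferentiableAt ℝ g z) (v : E) :
    fderiv ℝ (fun w => (f w + g w) / 2) z v = (fderiv ℝ f z v + fderiv ℝ g z v) / 2 := by
  have h := (hf.hasFDerivAt.add hg.hasFDerivAt).mul_const (2⁻¹ : ℝ)
  rw [show (fun w => (f w + g w) / 2) = fun w => (f + g) w * 2⁻¹ by
    funext w; simp [div_eq_mul_inv], h.fderiv]
  simp; ring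

theorem fderiv_fderiv_avg (hf : ContDiffAt ℝ 2 f z) (hg : ContDiffAt ℝ 2 g z) (u v : E) :
    fderiv ℝ (fun w => fderiv ℝ (fun w => (f w + g w) / 2) w u) z v
      = (fderiv ℝ (fun w => fderiv ℝ f w u) z v + fderiv ℝ (fun w => fderiv ℝ g w u) z v) / 2 := by
  have h : (fun w => fderiv ℝ (fun w => (f w + g w) / 2) w u)
      =ᶠ[nhds z] fun w => (fderiv ℝ f w u + fderiv ℝ g w u) / 2 := by
    filter_upwards [hf.eventually (by simp), hg.eventually (by simp)] with w h1 h2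
    exact fderiv_avg (h1.differentiableAt (by norm_num)) (h2.differentiableAt (by norm_num)) u
  have d : ∀ {f : E → ℝ}, ContDiffAt ℝ 2 f z → DifferentiableAt ℝ (fun w => fderiv ℝ f w u) z :=
    fun hf => ((hf.fderiv_right (m := 1) (by norm_num)).differentiableAt (by norm_num)).clm_apply
      (differentiableAt_const _)
  rw [h.fderiv_eq, fderiv_avg (d hf) (d hg)]

theorem abs_avg_le {a b : ℝ} (ha : |a| ≤ M) (hb : |b| ≤ M) : |(a + b) / 2| ≤ M := by
  rw [abs_le] at *
  constructor <;> linarith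

end Average

/-- Used with the Hessian in `y` of `φ`, so that `L₀` sees only the symmetric part of `A`, and with
`ξ_i ξ_j`, so that coercivity survives symmetrisation. -/
theorem sum_avg_mul {κ : Type*} [Fintype κ] (c H : κ → κ → ℝ) (hH : ∀ i j, H i j = H j i) :
    ∑ i, ∑ j, (c i j + c j i) / 2 * H i j = ∑ i, ∑ j, c i j * H i j := by
  have h : ∑ i, ∑ j, c j i * H i j = ∑ i, ∑ j, c i j * H i j := by
    rw [Finset.sum_comm]
    exact Finset.sum_congr rfl fun i _ => Finset.sum_congr rfl fun j _ => by rw [hH]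
  have h2 : ∑ i, ∑ j, (c i j + c j i) / 2 * H i j
      = ((∑ i, ∑ j, c i j * H i j) + ∑ i, ∑ j, c j i * H i j) / 2 := by
    rw [← Finset.sum_add_distrib, Finset.sum_div]
    refine Finset.sum_congr rfl fun i _ => ?_
    rw [← Finset.sum_add_distrib, Finset.sum_div]
    exact Finset.sum_congr rfl fun j _ => by ring
  rw [h2, h]; ring

variable {p q : ℕ} {P : Params p q} {z : Pt (p + 1) (q + 1)} {M : ℝ}

theorem contDiff_s : ContDiff ℝ 2 P.s := by
  unfold Params.s; fun_prop

theorem contDiff_orig : ContDiff ℝ 2 P.orig := by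
  have hs := contDiff_s (P := P)
  refine ContDiff.prodMk (contDiff_pi.mpr fun i => ?_) (contDiff_pi.mpr fun j => ?_)
  · refine Fin.cases ?_ (fun r => ?_) i
    · simp only [Function.update_self]; fun_prop
    · simp only [Function.update_of_ne (Fin.succ_ne_zero r)]; fun_prop
  · simp only [Fin.init]; fun_prop

theorem fderiv_orig_fst (K : Idx p q) (i : Fin (p + 1)) :
    (fderiv ℝ P.orig z (dir K)).1 i
      = fderiv ℝ (fun w => (P.orig w).1 i) z (dir K) := by
  have h := (contDiff_orig (P := P)).differentiable (by norm_num) z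
  have h2 := (((ContinuousLinearMap.proj i).comp (ContinuousLinearMap.fst ℝ (Fin (p + 1) → ℝ)
    (Fin q → ℝ))).hasFDerivAt (x := P.orig z)).comp z h.hasFDerivAt
  exact (DFunLike.congr_fun h2.fderiv (dir K)).symm

theorem fderiv_orig_snd (K : Idx p q) (j : Fin q) :
    (fderiv ℝ P.orig z (dir K)).2 j
      = fderiv ℝ (fun w => (P.orig w).2 j) z (dir K) := by
  have h := (contDiff_orig (P := P)).differentiable (by norm_num) z
  have h2 := (((ContinuousLinearMap.proj j).comp (ContinuousLinearMap.snd ℝ (Fin (p + 1) → ℝ)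
    (Fin q → ℝ))).hasFDerivAt (x := P.orig z)).comp z h.hasFDerivAt
  exact (DFunLike.congr_fun h2.fderiv (dir K)).symm

theorem hasPD_orig_fst_zero :
    HasPD dir (fun w => (P.orig w).1 0) (fun K => P.s z * vec 1 0 0 K) z := by
  have h : (fun w => (P.orig w).1 0) = fun w => 1 / 2 * (P.s w * P.s w) := by
    funext w; simp [Params.orig, sq]
  rw [h]
  refine ((HasPD.const (1 / 2)).mul ((P.hasPD_s z).mul (P.hasPD_s z))).congr_val fun K => ?_
  ring

theorem orig_fst_succ (r : Fin p) (w : Pt (p + 1) (q + 1)) :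
    (P.orig w).1 r.succ = w.1 r.succ := by
  simp [Params.orig]

theorem fderiv_orig_zero : fderiv ℝ P.orig z (dir (.inl 0)) = P.s z • (Pi.single 0 1, 0) := by
  refine Prod.ext (funext fun i => ?_) (funext fun j => ?_)
  · rw [fderiv_orig_fst]
    refine Fin.cases ?_ (fun r => ?_) i
    · rw [hasPD_orig_fst_zero.eq]; simp
    · simp only [orig_fst_succ, (hasPD_fst r.succ z).eq]; simp
  · rw [fderiv_orig_snd]
    refine ((hasPD_snd j.castSucc z).eq _).trans ?_
    simp

theorem fderiv_orig_succ (r : Fin p) :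
    fderiv ℝ P.orig z (dir (.inl r.succ)) = (Pi.single r.succ 1, 0) := by
  refine Prod.ext (funext fun i => ?_) (funext fun j => ?_)
  · rw [fderiv_orig_fst]
    refine Fin.cases ?_ (fun r' => ?_) i
    · rw [hasPD_orig_fst_zero.eq]; simp [(Fin.succ_ne_zero r).symm]
    · simp only [orig_fst_succ, (hasPD_fst r'.succ z).eq]; simp [Pi.single_apply]
  · rw [fderiv_orig_snd]
    refine ((hasPD_snd j.castSucc z).eq _).trans ?_
    simp

theorem fderiv_orig_castSucc (k : Fin q) :
    fderiv ℝ P.orig z (dir (.inr k.castSucc)) = (0, Pi.single k 1) := by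
  refine Prod.ext (funext fun i => ?_) (funext fun j => ?_)
  · rw [fderiv_orig_fst]
    refine Fin.cases ?_ (fun r' => ?_) i
    · rw [hasPD_orig_fst_zero.eq]; simp
    · simp only [orig_fst_succ, (hasPD_fst r'.succ z).eq]; simp
  · rw [fderiv_orig_snd]
    refine ((hasPD_snd j.castSucc z).eq _).trans ?_
    simp [Pi.single_apply]

theorem fderiv_orig_last : fderiv ℝ P.orig z (dir (.inr (Fin.last q))) = 0 := by
  refine Prod.ext (funext fun i => ?_) (funext fun j => ?_)
  · rw [fderiv_orig_fst]
    refine Fin.cases ?_ (fun r' => ?_) i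
    · rw [hasPD_orig_fst_zero.eq]; simp
    · simp only [orig_fst_succ, (hasPD_fst r'.succ z).eq]; simp
  · rw [fderiv_orig_snd]
    refine ((hasPD_snd j.castSucc z).eq _).trans ?_
    simp [(Fin.castSucc_lt_last j).ne]

section Comp

variable {b : Pt (p + 1) q → ℝ}

theorem fderiv_comp_orig (hb : DifferentiableAt ℝ b (P.orig z)) (K : Idx p q) :
    fderiv ℝ (fun w => b (P.orig w)) z (dir K)
      = fderiv ℝ b (P.orig z) (fderiv ℝ P.orig z (dir K)) := by
  have h := hb.hasFDerivAt.comp z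
    ((contDiff_orig (P := P)).differentiable (by norm_num) z).hasFDerivAt
  exact DFunLike.congr_fun h.fderiv (dir K)

/-- The factor `s` is the derivative of `½(x₁+η₀)²`; it turns the constant `α₁` of the hypothesis
into the `α₁s` of `coercive_symPart`. -/
theorem dx_zero_comp_orig (hb : DifferentiableAt ℝ b (P.orig z)) :
    dx 0 (fun w => b (P.orig w)) z = P.s z * dx 0 b (P.orig z) := by
  refine (fderiv_comp_orig hb (.inl 0)).trans ?_
  rw [fderiv_orig_zero, map_smul]; rfl

theorem dx_succ_comp_orig (hb : DifferentiableAt ℝ b (P.orig z)) (r : Fin p) :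
    dx r.succ (fun w => b (P.orig w)) z = dx r.succ b (P.orig z) := by
  refine (fderiv_comp_orig hb (.inl r.succ)).trans ?_
  rw [fderiv_orig_succ]; rfl

theorem dy_castSucc_comp_orig (hb : DifferentiableAt ℝ b (P.orig z)) (k : Fin q) :
    dy k.castSucc (fun w => b (P.orig w)) z = dy k b (P.orig z) := by
  refine (fderiv_comp_orig hb (.inr k.castSucc)).trans ?_
  rw [fderiv_orig_castSucc]; rfl

theorem dy_last_comp_orig (hb : DifferentiableAt ℝ b (P.orig z)) :
    dy (Fin.last q) (fun w => b (P.orig w)) z = 0 := by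
  refine (fderiv_comp_orig hb (.inr (Fin.last q))).trans ?_
  rw [fderiv_orig_last, map_zero]

theorem abs_dy_comp_orig_le (hM : 0 ≤ M) (hb : DifferentiableAt ℝ b (P.orig z))
    (h : ∀ k, |dy k b (P.orig z)| ≤ M) (k : Fin (q + 1)) :
    |dy k (fun w => b (P.orig w)) z| ≤ M := by
  refine Fin.lastCases ?_ (fun k => ?_) k
  · rw [dy_last_comp_orig hb, abs_zero]; exact hM
  · rw [dy_castSucc_comp_orig hb]; exact h k

theorem abs_dy_dy_comp_orig_le (hM : 0 ≤ M) (hb : ContDiffAt ℝ 2 b (P.orig z))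
    (h : ∀ k j, |dy k (dy j b) (P.orig z)| ≤ M) (k j : Fin (q + 1)) :
    |dy k (dy j (fun w => b (P.orig w))) z| ≤ M := by
  have hev : ∀ᶠ w in nhds z, DifferentiableAt ℝ b (P.orig w) :=
    (contDiff_orig (P := P)).continuous.continuousAt.eventually
      ((hb.eventually (by simp)).mono fun v hv => hv.differentiableAt (by norm_num))
  refine Fin.lastCases ?_ (fun j => ?_) j
  · have e : dy (Fin.last q) (fun w => b (P.orig w)) =ᶠ[nhds z] fun _ => 0 :=
      hev.mono fun w hw => dy_last_comp_orig hw
    rw [dy, e.fderiv_eq]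
    simpa using hM
  · have e : dy j.castSucc (fun w => b (P.orig w)) =ᶠ[nhds z] fun w => dy j b (P.orig w) :=
      hev.mono fun w hw => dy_castSucc_comp_orig hw j
    rw [dy, e.fderiv_eq]
    refine abs_dy_comp_orig_le (b := dy j b) hM ?_ (fun k => h k j) k
    exact ((hb.fderiv_right (m := 1) (by norm_num)).differentiableAt (by norm_num)).clm_apply
      (differentiableAt_const _)

end Comp

/-! ### Size of `∇ψ` and of `s` on the domain -/

section Domain

variable (P)

theorem isOpen_omega : IsOpen P.omega := by
  have h : Continuous P.psi₀ := by unfold Params.psi₀; fun_prop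
  have h0 : Continuous fun z : Pt (p + 1) (q + 1) => z.1 0 := by fun_prop
  exact ((isOpen_lt continuous_const h0).inter
    ((isOpen_lt continuous_const h).inter (isOpen_lt h continuous_const)))

variable {P}

/-- On the domain `ψ₀` is a sum of nonnegative terms less than `γ`, and its quadratic part is half
the squared length of the gradient of `ψ` in the variables other than `x₁`. -/
theorem grad_sq_le (hδ : 0 < P.δ) (hz : z ∈ P.omega) :
    (∑ r, P.gx r z ^ 2) + (∑ k, P.gy k z ^ 2) ≤ 2 * P.γ ∧ P.δ * z.1 0 ≤ P.γ := by
  obtain ⟨h1, -, h3⟩ := hz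
  rw [P.psi₀_eq] at h3
  have hx : 0 ≤ ∑ r, P.gx r z ^ 2 := Finset.sum_nonneg fun _ _ => sq_nonneg _
  have hy : 0 ≤ ∑ r, P.gy r z ^ 2 := Finset.sum_nonneg fun _ _ => sq_nonneg _
  have : 0 < P.δ * z.1 0 := mul_pos hδ h1
  constructor <;> linarith

theorem nrm_gx_le (hδ : 0 < P.δ) (hz : z ∈ P.omega) : nrm (fun r => P.gx r z) ≤ √(2 * P.γ) := by
  have := (grad_sq_le hδ hz).1
  have hy : 0 ≤ ∑ r, P.gy r z ^ 2 := Finset.sum_nonneg fun _ _ => sq_nonneg _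
  exact Real.sqrt_le_sqrt (by linarith)

theorem nrm_gy_le (hδ : 0 < P.δ) (hz : z ∈ P.omega) : nrm (fun r => P.gy r z) ≤ √(2 * P.γ) := by
  have := (grad_sq_le hδ hz).1
  have hy : 0 ≤ ∑ r, P.gx r z ^ 2 := Finset.sum_nonneg fun _ _ => sq_nonneg _
  exact Real.sqrt_le_sqrt (by linarith)

/-- `x₁ ≤ γ/4` because `δ ≥ 4`, and `η₀ ≤ γ/2`. The factor `3/4` matches the `4/3` in the hypothesis
on `γ`. -/
theorem s_le (hδ : 4 ≤ P.δ) (hz : z ∈ P.omega) : P.s z ≤ 3 / 4 * P.γ := by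
  have h1 := (grad_sq_le (by linarith) hz).2
  have h2 : 4 * z.1 0 ≤ P.δ * z.1 0 := mul_le_mul_of_nonneg_right hδ hz.1.le
  have h3 : P.eta₀ ≤ P.γ / 2 := by
    unfold Params.eta₀
    linarith [min_le_right P.α₀ P.γ]
  unfold Params.s
  linarith

end Domain

theorem L₀_symPart {A : Fin (q + 1) → Fin (q + 1) → Pt (p + 1) (q + 1) → ℝ}
    {φ : Pt (p + 1) (q + 1) → ℝ} (hφ : ContDiffAt ℝ 2 φ z) :
    P.L₀ (symPart A) φ z = P.L₀ A φ z := by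
  unfold Params.L₀ symPart
  rw [sum_avg_mul (fun i j => A i j z) (fun i j => dy i (dy j φ) z)]
  exact fun i j => fderiv_fderiv_comm hφ _ _

theorem pointBounds_symPart {U : Set (Pt (p + 1) q)} (hU : IsOpen U)
    {a : Fin (q + 1) → Fin (q + 1) → Pt (p + 1) q → ℝ} (ha : ∀ i j, IsC2Closure U (a i j))
    (haM : ∀ i j, C2NormLE U (a i j) M) (hM : 0 < M) (hδ : 4 ≤ P.δ) (hα₀ : 0 < P.α₀)
    (hγ : 0 < P.γ) (hγ1 : P.γ < 1 / 2) (hγα : P.γ + P.α₀ < 1) (hz : z ∈ P.omega)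
    (hzU : P.orig z ∈ U) : PointBounds P (symPart (P.tilde a)) M z := by
  have hc : ∀ i j, ContDiffAt ℝ 2 (a i j) (P.orig z) := fun i j =>
    (ha i j).1.contDiffAt (hU.mem_nhds hzU)
  have hd : ∀ i j, DifferentiableAt ℝ (a i j) (P.orig z) := fun i j =>
    (hc i j).differentiableAt (by norm_num)
  have hcb : ∀ i j, ContDiffAt ℝ 2 (fun v => (a i j v + a j i v) / 2) (P.orig z) := fun i j =>
    ((hc i j).add (hc j i)).div_const 2
  have hdb : ∀ i j, DifferentiableAt ℝ (fun v => (a i j v + a j i v) / 2) (P.orig z) := fun i j =>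
    (hcb i j).differentiableAt (by norm_num)
  have hA : ∀ i j, symPart (P.tilde a) i j
      = fun w => (fun v => (a i j v + a j i v) / 2) (P.orig w) := fun i j => rfl
  have hs0 : 0 < P.s z := by
    have : 0 < P.eta₀ := by unfold Params.eta₀; positivity
    have := hz.1
    unfold Params.s
    linarith
  have hs1 : P.s z < 1 := by linarith [s_le hδ hz]
  have hsq : √(2 * P.γ) ≤ 1 := by
    rw [Real.sqrt_le_one]; linarith
  have hx : ∀ l i j, |dx l (fun v => (a i j v + a j i v) / 2) (P.orig z)| ≤ M := fun l i j => by
    rw [dx, fderiv_avg (hd i j) (hd j i)]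
    exact abs_avg_le ((haM i j _ hzU).2.1 l) ((haM j i _ hzU).2.1 l)
  have hy : ∀ l i j, |dy l (fun v => (a i j v + a j i v) / 2) (P.orig z)| ≤ M := fun l i j => by
    rw [dy, fderiv_avg (hd i j) (hd j i)]
    exact abs_avg_le ((haM i j _ hzU).2.2.1 l) ((haM j i _ hzU).2.2.1 l)
  have hyy : ∀ i j k l, |dy k (dy l (fun v => (a i j v + a j i v) / 2)) (P.orig z)| ≤ M :=
    fun i j k l => by
      refine le_of_eq_of_le (congrArg abs (fderiv_fderiv_avg (hc i j) (hc j i) _ _)) ?_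
      exact abs_avg_le ((haM i j _ hzU).2.2.2.2.2 k l) ((haM j i _ hzU).2.2.2.2.2 k l)
  refine ⟨hs0, hs1, ?_, ?_, ?_, ?_, ?_, ?_, ?_, (nrm_gx_le (by linarith) hz).trans hsq,
    (nrm_gy_le (by linarith) hz).trans hsq⟩
  · have := hz.2.1; unfold Params.psi; linarith
  · have := hz.2.2; unfold Params.psi; linarith
  · exact fun i j => abs_avg_le (haM i j _ hzU).1 (haM j i _ hzU).1
  · intro i j
    rw [hA, dx_zero_comp_orig (hdb i j), abs_mul, abs_of_pos hs0]
    exact (mul_le_of_le_one_left (abs_nonneg _) hs1.le).trans (hx 0 i j)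
  · intro r i j
    rw [hA, dx_succ_comp_orig (hdb i j)]
    exact hx r.succ i j
  · intro k i j
    rw [hA]
    exact abs_dy_comp_orig_le hM.le (hdb i j) (fun k => hy k i j) k
  · intro k j
    rw [hA]
    exact abs_dy_dy_comp_orig_le hM.le (hcb k j) (fun l l' => hyy k j l l') k j

theorem coercive_symPart {U : Set (Pt (p + 1) q)} (hU : IsOpen U)
    {a : Fin (q + 1) → Fin (q + 1) → Pt (p + 1) q → ℝ} (ha : ∀ i j, IsC2Closure U (a i j))
    {α₁ : ℝ} (hco : ∀ z ∈ U, ∀ ξ : Fin (q + 1) → ℝ,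
      α₁ * ∑ i, ξ i ^ 2 ≤ -∑ i, ∑ j, dx 0 (a i j) z * ξ i * ξ j)
    (hs : 0 < P.s z) (hzU : P.orig z ∈ U) (ξ : Fin (q + 1) → ℝ) :
    α₁ * P.s z * ∑ i, ξ i ^ 2
      ≤ -bil (fun i j => dx 0 (symPart (P.tilde a) i j) z) ξ ξ := by
  have hd : ∀ i j, DifferentiableAt ℝ (a i j) (P.orig z) := fun i j =>
    ((ha i j).1.contDiffAt (hU.mem_nhds hzU)).differentiableAt (by norm_num)
  have e : ∀ i j, dx 0 (symPart (P.tilde a) i j) z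
      = P.s z * ((dx 0 (a i j) (P.orig z) + dx 0 (a j i) (P.orig z)) / 2) := by
    intro i j
    have hdb : DifferentiableAt ℝ (fun v => (a i j v + a j i v) / 2) (P.orig z) :=
      ((hd i j).add (hd j i)).mul_const (2 : ℝ)⁻¹
    rw [show symPart (P.tilde a) i j
      = fun w => (fun v => (a i j v + a j i v) / 2) (P.orig w) from rfl,
      dx_zero_comp_orig hdb, dx, fderiv_avg (hd i j) (hd j i)]
    rfl
  simp only [e]
  rw [bil_smul, bil]
  simp only [mul_assoc]
  rw [sum_avg_mul (fun i j => dx 0 (a i j) (P.orig z)) (fun i j => ξ i * ξ j)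
    (fun i j => mul_comm _ _)]
  have := mul_le_mul_of_nonneg_left (hco _ hzU ξ) hs.le
  simp only [mul_assoc] at this
  linarith

theorem contDiffAt_symPart {U : Set (Pt (p + 1) q)} (hU : IsOpen U)
    {a : Fin (q + 1) → Fin (q + 1) → Pt (p + 1) q → ℝ} (ha : ∀ i j, IsC2Closure U (a i j))
    (hzU : P.orig z ∈ U) (i j : Fin (q + 1)) : ContDiffAt ℝ 2 (symPart (P.tilde a) i j) z := by
  have hc : ∀ i j, ContDiffAt ℝ 2 (fun w => a i j (P.orig w)) z := fun i j =>
    ((ha i j).1.contDiffAt (hU.mem_nhds hzU)).comp z contDiff_orig.contDiffAt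
  exact ((hc i j).add (hc j i)).div_const 2

end UltraCarleman

/-! ### The smallness condition on `γ` -/

namespace UltraCarleman

theorem sq_mul_lt_of_lt_rpow {γ X : ℝ} (hγ : 0 < γ) (hX : 0 < X)
    (h : γ < 4 / 3 * X ^ (-(1 / 2) : ℝ)) : γ ^ 2 * X < 16 / 9 := by
  have h1 : (X ^ (-(1 / 2) : ℝ)) ^ 2 = X⁻¹ := by
    rw [← Real.rpow_mul_natCast hX.le]; norm_num [Real.rpow_neg_one]
  calc γ ^ 2 * X < (4 / 3 * X ^ (-(1 / 2) : ℝ)) ^ 2 * X := by gcongr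
    _ = 16 / 9 := by rw [mul_pow, h1]; field_simp; norm_num

/-- Of the sum under the root only the `ε₀⁻¹` term matters, through `ε₀⁻¹ > 4m/α₁`. Together with `s
≤ ¾γ` the conclusion is the condition on `s` needed for the critical term of `gradForm_scalar`. -/
theorem small_gamma {α₁ M m ε₀ γ : ℝ} (hα₁ : 0 < α₁) (hM : 0 < M) (hm : 1 ≤ m) (hε : 0 < ε₀)
    (hε' : ε₀ < α₁ / (4 * m)) (hγ : 0 < γ)
    (h : γ < 4 / 3 * (M * (M * m ^ 2 * ε₀⁻¹ + m ^ 2 + m * (m + 1))) ^ (-(1 / 2) : ℝ)) :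
    (3 / 4 * γ) ^ 2 * (M ^ 2 * m ^ 3) ≤ α₁ / 4 := by
  have hm0 : 0 < m := by linarith
  have h1 := sq_mul_lt_of_lt_rpow hγ (by positivity) h
  have h2 : 4 * m / α₁ < ε₀⁻¹ := by
    rw [lt_inv_comm₀ (by positivity) hε, inv_div]; exact hε'
  have h3 : M * (M * m ^ 2 * (4 * m / α₁))
      ≤ M * (M * m ^ 2 * ε₀⁻¹ + m ^ 2 + m * (m + 1)) := by
    have : M * m ^ 2 * (4 * m / α₁) ≤ M * m ^ 2 * ε₀⁻¹ := by gcongr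
    have h0 : 0 ≤ m ^ 2 + m * (m + 1) := by positivity
    gcongr
    linarith
  have h4 : γ ^ 2 * (M * (M * m ^ 2 * (4 * m / α₁))) < 16 / 9 :=
    (mul_le_mul_of_nonneg_left h3 (sq_nonneg γ)).trans_lt h1
  have h5 : γ ^ 2 * (M * (M * m ^ 2 * (4 * m / α₁))) = 4 * (γ ^ 2 * (M ^ 2 * m ^ 3)) / α₁ := by ring
  rw [h5, div_lt_iff₀ hα₁] at h4
  linarith

end UltraCarleman

/-! ### Choice of the constants and conclusion -/

theorem lemma1 (p q : ℕ) (hp : 2 ≤ p + 1) (hq : 2 ≤ q + 1)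
    (α₁ M ν : ℝ) (hα₁ : 0 < α₁) (hM : 0 < M) (hν : 0 < ν) :
    ∃ δstar : ℝ, 0 < δstar ∧
      ∀ ε₀ γ α₀ : ℝ, 0 < ε₀ → ε₀ < α₁ / (4 * ((q + 1 : ℕ) : ℝ)) →
      0 < γ →
      γ < min (1 / 2) (4 / 3 * (M * (M * ((q + 1 : ℕ) : ℝ) ^ 2 * ε₀⁻¹ + ((q + 1 : ℕ) : ℝ) ^ 2
        + ((q + 1 : ℕ) : ℝ) * (((q + 1 : ℕ) : ℝ) + 1))) ^ (-(1 / 2) : ℝ)) →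
      0 < α₀ → γ + α₀ < 1 →
      ∀ δ : ℝ, δstar < δ →
      ∃ lamstar : ℝ, 0 < lamstar ∧
        ∀ (D : Set (Fin (p + 1) → ℝ)) (G' : Set (Fin q → ℝ)) (x₀ : Fin p → ℝ) (y₀ : Fin q → ℝ)
          (a : Fin (q + 1) → Fin (q + 1) → Pt (p + 1) q → ℝ),
        IsOpen D → IsOpen G' →
        (∀ i j, IsC2Closure (D ×ˢ G') (a i j)) →
        (∀ i j, C2NormLE (D ×ˢ G') (a i j) M) →
        (∀ z ∈ D ×ˢ G', ∀ ξ : Fin (q + 1) → ℝ,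
          α₁ * ∑ i, ξ i ^ 2 ≤ -∑ i, ∑ j, dx 0 (a i j) z * ξ i * ξ j) →
        ∀ P : Params p q, P = ⟨γ, α₀, δ, ν, x₀, y₀⟩ →
        (∀ z ∈ P.omega, P.orig z ∈ D ×ˢ G') →
        ∀ φ : Pt (p + 1) (q + 1) → ℝ, IsC2Closure P.omega φ →
        ∀ lam : ℝ, lamstar < lam →
        ∀ z ∈ P.omega,
          2 * lam * ν * δ * (P.s z ^ 3)⁻¹ * dx 0 φ z ^ 2 * P.chi lam z ^ 2
            + 2 * lam * ν * P.s z ^ 2 * (∑ i : Fin p, dx i.succ φ z ^ 2) * P.chi lam z ^ 2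
            + 2 * lam * ν * P.s z * (∑ j, dy j φ z ^ 2) * P.chi lam z ^ 2
            + lam ^ 3 * ν ^ 4 * δ ^ 4 * P.psi z ^ (-2 * ν - 3) * φ z ^ 2 * P.chi lam z ^ 2
            + divTerm P (P.tilde a) lam α₁ (beta₀ (p + 1) (q + 1) M γ) φ z
          ≤ P.psi z ^ (ν + 1) * P.L₀ (P.tilde a) φ z ^ 2 * P.chi lam z ^ 2
            - 2 * lam * ν * beta₀ (p + 1) (q + 1) M γ * φ z * P.s z * P.L₀ (P.tilde a) φ z
              * P.chi lam z ^ 2 := by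
  have hκ := kap_nonneg (q := q) hM
  have hp0 : (1 : ℝ) ≤ p := by exact_mod_cast (by omega : 1 ≤ p)
  have hq0 : (0 : ℝ) ≤ q := by positivity
  have hpκ : 0 ≤ p * kap q M := by positivity
  have hκ2 : 0 ≤ kap q M ^ 2 := by positivity
  have hK : 1 ≤ bigK p q M := le_bigK hM (by linarith)
  have hKκ : 0 ≤ bigK p q M * kap q M := by positivity
  obtain ⟨c₁, hc₁⟩ : ∃ c, c = 6 * (4 * bigK p q M ^ 4 + 7 * bigK p q M ^ 2 + 7 * bigK p q M)
    + 2 * (1 + bigK p q M * kap q M) := ⟨_, rfl⟩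
  have hc₁0 : 0 < c₁ := by rw [hc₁]; positivity
  -- The summands serve in turn `s_le`, the `θ_{x₁}²` budget, the leading zeroth order coefficient,
  -- and, through `δα₁ ≥ c₁`, the `y` derivatives of both `θ` and `φ`.
  refine ⟨4 + 8 * bigK p q M + (1 + 4 * bigK p q M + α₁) + c₁ / α₁, by positivity, ?_⟩
  intro ε₀ γ α₀ hε hε' hγ hγ' hα₀ hγα δ hδ
  obtain ⟨hγ1, hγ2⟩ := lt_min_iff.mp hγ'
  have hcα : 0 < c₁ / α₁ := by positivity
  have hδα : c₁ ≤ δ * α₁ := by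
    rw [← div_le_iff₀ hα₁]; linarith
  have hη : 0 < min α₀ γ / 2 := by positivity
  -- On the domain `1/s ≤ 1/η₀` and `1/ψ ≤ 1/α₀`. Thus `R`, and with it `L`, is fixed before the
  -- coefficients and the centre are introduced, as the uniformity of the threshold for `λ`
  -- requires.
  obtain ⟨R, hR⟩ : ∃ R, R = bigK p q M + (min α₀ γ / 2)⁻¹ + α₀⁻¹ := ⟨_, rfl⟩
  obtain ⟨β, hβ⟩ : ∃ β, β = beta₀ (p + 1) (q + 1) M γ := ⟨_, rfl⟩
  obtain ⟨L, hL⟩ := exists_linPot_bound p (q + 1) δ ν α₁ β R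
  have hsq0 : 0 ≤ √(2 * γ) := Real.sqrt_nonneg _
  have hsq : √(2 * γ) ≤ 1 := by rw [Real.sqrt_le_one]; linarith
  have hβeq : β = p + 3 + M * ((q : ℝ) + 1) + kap q M * (1 + 3 * √(2 * γ)) := by
    rw [hβ, beta₀, kap]; push_cast; ring
  have hβ1 : 1 ≤ β := by
    have : 0 ≤ M * ((q : ℝ) + 1) := by positivity
    have : 0 ≤ kap q M * (1 + 3 * √(2 * γ)) := by positivity
    linarith
  have hβ2 : β ≤ p + 3 + M * ((q : ℝ) + 1) * (4 * ((q : ℝ) + 1) + 1) := by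
    have h1 : kap q M * (1 + 3 * √(2 * γ)) ≤ kap q M * 4 := by gcongr; linarith
    have h2 : M * ((q : ℝ) + 1) * (4 * ((q : ℝ) + 1) + 1)
      = M * ((q : ℝ) + 1) + kap q M * 4 := by rw [kap]; ring
    linarith
  have hβK : β ≤ bigK p q M := by
    have : 0 ≤ M * ((q : ℝ) + 1) * (4 * ((q : ℝ) + 1) + 1) := by positivity
    unfold bigK; linarith
  have hL0 : 0 ≤ 1 + |L| + bigK p q M * kap q M := by positivity
  -- Since `0 < ψ < 1`, `w ≥ λν`, so this threshold yields the lower bound on `w` required by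
  -- `potTotal_nonneg`.
  refine ⟨(1 + |L| + bigK p q M * kap q M) / ν, by positivity, ?_⟩
  intro D G' x₀ y₀ a hD hG ha haM hco P hPeq hPU φ hφ lam hlam z hz
  have hU := hD.prod hG
  have hzU := hPU z hz
  have hPδ : P.δ = δ := by rw [hPeq]
  have hPγ : P.γ = γ := by rw [hPeq]
  have hPα : P.α₀ = α₀ := by rw [hPeq]
  have hPν : P.ν = ν := by rw [hPeq]
  have hδ4 : 4 ≤ P.δ := by rw [hPδ]; linarith
  have hb := pointBounds_symPart hU ha haM hM hδ4 (hPα ▸ hα₀) (hPγ ▸ hγ) (hPγ ▸ hγ1)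
    (by rw [hPγ, hPα]; exact hγα) hz hzU
  have hφz : ContDiffAt ℝ 2 φ z := hφ.1.contDiffAt ((isOpen_omega P).mem_nhds hz)
  have hgy := nrm_gy_le (by linarith : 0 < P.δ) hz
  rw [hPγ] at hgy
  have hlam0 : 0 < lam := lt_of_le_of_lt (by positivity) hlam
  rw [← L₀_symPart hφz, divTerm, ← hβ]
  rw [← hPν, ← hPδ]
  refine carleman_of_nonneg hb.s_pos hb.psi_pos (hPν ▸ hν) hlam0
    (contDiffAt_symPart hU ha hzU) (fun i j v => by simp only [symPart, add_comm]) hφz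
    (by linarith) ?_ ?_ ?_
  · refine hb.gradForm_ge hM (coercive_symPart hU ha hco hb.s_pos hzU) ?_ ?_ ?_ ?_
    · have h1 := s_le hδ4 hz
      rw [hPγ] at h1
      have h2 := small_gamma (m := (q : ℝ) + 1) hα₁ hM (by linarith) hε
        (by exact_mod_cast hε') hγ (by exact_mod_cast hγ2)
      have := hb.s_pos
      refine le_trans ?_ h2
      gcongr
    -- With `m = q + 1`, `div(A∇ψ)` is at most `Mm + Mm²√(2γ)`, which `β₀` exceeds with room to
    -- spare.
    · have h1 := (le_abs_self _).trans hb.divA_le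
      have h2 := mul_le_mul_of_nonneg_left hgy hκ
      have h3 : 0 ≤ kap q M * √(2 * γ) := by positivity
      linarith
    · rw [hPδ]; linarith
    · rw [hPδ]; linarith
  -- As `s² ≤ s`, the unfavourable `y` part of `β C(∇φ,∇φ)` has the same weight `s` as the good
  -- term, and `δα₁ ≥ 2(1 + Kκ)` absorbs it.
  · intro u
    have h1 := le_of_abs_le (bil_le_kap hb.coeff u u)
    rw [← sq, nrm_sq] at h1
    have hs := hb.s_pos
    have hu : 0 ≤ ∑ k, u k ^ 2 := Finset.sum_nonneg fun _ _ => sq_nonneg _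
    have h2 : β * P.s z ^ 2 * bil (fun i j => symPart (P.tilde a) i j z) u u
        ≤ β * P.s z ^ 2 * (kap q M * ∑ k, u k ^ 2) := by gcongr
    have h3 : β * P.s z ^ 2 * (kap q M * ∑ k, u k ^ 2)
        ≤ bigK p q M * P.s z * (kap q M * ∑ k, u k ^ 2) := by
      have : P.s z ^ 2 ≤ P.s z := pow_le_of_le_one hs.le hb.s_lt.le two_ne_zero
      gcongr
    have h4 : 2 * (1 + bigK p q M * kap q M) ≤ P.δ * α₁ := by
      have : 0 ≤ 6 * (4 * bigK p q M ^ 4 + 7 * bigK p q M ^ 2 + 7 * bigK p q M) := by positivity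
      rw [hPδ]; linarith
    have h5 := mul_le_mul_of_nonneg_right h4 (mul_nonneg hs.le hu)
    linarith
  · have hψi : (P.psi z)⁻¹ ≤ α₀⁻¹ := by
      apply inv_anti₀ hα₀
      have := hz.2.1
      rw [Params.psi, hPα]; linarith
    have hsi : (P.s z)⁻¹ ≤ (min α₀ γ / 2)⁻¹ := by
      apply inv_anti₀ hη
      have := hz.1
      rw [Params.s, Params.eta₀, hPα, hPγ]; linarith
    have i1 : 0 < (min α₀ γ / 2)⁻¹ := by positivity
    have i2 : 0 < α₀⁻¹ := by positivity
    refine hb.potTotal_nonneg hM hα₁ (hPν ▸ hν) hβ1 hβ2 ?_ (R := R) (L := |L|) ?_ ?_ ?_ ?_ ?_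
    · rw [hPδ]; linarith
    · rw [hR]; linarith
    · rw [hR]; linarith
    · rw [hR]; linarith
    · intro v hv
      rw [hPδ, hPν]
      exact (hL v hv).trans (le_abs_self _)
    · have h1 : 1 ≤ P.psi z ^ (-P.ν - 1) :=
        Real.one_le_rpow_of_pos_of_le_one_of_nonpos hb.psi_pos hb.psi_lt.le (by rw [hPν]; linarith)
      have h2 : 1 + |L| + bigK p q M * kap q M < lam * ν := (div_lt_iff₀ hν).mp hlam
      have h3 : lam * ν * 1 ≤ lam * ν * P.psi z ^ (-P.ν - 1) := by gcongr
      rw [Params.w, hPν] at *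
      linarith
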